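/- Let $X=\{0,1\}$, let $S$ be a finite invertible automaton (transducer) over $X$ that is bounded, i.e. the number of directed paths of length $n$ in $S$ avoiding the states that act trivially is bounded independently of $n$, and let $G$ be the group of transformations of $X^{\omega}$ generated by the states of $S$. For $w\in X^{\omega}$ let $\Gamma_w$ be the orbital Schreier graph: its vertex set is the $G$-orbit of $w$, and distinct $u,v$ are adjacent iff $s(u)=v$ or $s(v)=u$ for some $s\in S$. For a finite word $v$, the restriction $g|_v$ is the transformation with $g(vw)=g(v)\,g|_v(w)$ for all $w\in X^{\omega}$. The nucleus of $G$ is the smallest finite set $\mathcal N\subseteq G$ such that for every $g\in G$ there is $n$ with $g|_v\in\mathcal N$ for all words $v$ of length at least $n$. Then $\Gamma_w$ has exactly two ends for almost every $w\in X^{\omega}$ (with respect to the uniform Bernoulli measure) if and only if the nucleus of $G$ exists and one of the following holds. 1. The nucleus is $\{a,a^{-1},1\}$ for an adding machine $a$. Here $a$ is called an adding machine if for some $m\ge 1$ the cyclic group $\langle a\rangle$ acts transitively on $X^m$ and there are words $x\neq y$ in $X^m$ with $a(x)=y$, $a|_x=a$, and $a|_v=1$ for all $v\in X^m\setminus\{x\}$.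 (So $a$ is a classical adding machine over the alphabet $X^m$, up to renaming of letters.) 2. Up to switching the letters $0\leftrightarrow1$ of the alphabet, the nucleus is the set of transformations defined by the states of one of Šunić's automata $A_{\omega,\rho}$: for some $k$, some automorphism $\rho$ of $B=(\mathbb Z/2\mathbb Z)^k$ and some surjective homomorphism $\omega:B\to A=\mathbb Z/2\mathbb Z$, the states are the elements of $A$ and $B$, where the nontrivial element of $A$ changes the first letter of a sequence and nothing else, the zero elements act trivially, and $b\in B$ acts by $b(0u)=0\,\omega(b)(u)$, $b(1u)=1\,\rho(b)(u)$. -/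

import Mathlib

/-- A sequence `x₀ x₁ x₂ …` over the alphabet `X` is a function `ℕ → X`.
`consSeq x w` is the sequence `x w`. -/
def consSeq {X : Type*} (x : X) (w : ℕ → X) : ℕ → X
  | 0 => x
  | n + 1 => w n

/-- The sequence `v w`, for a finite word `v` and an infinite sequence `w`. -/
def prependWord {X : Type*} (v : List X) (w : ℕ → X) : ℕ → X :=
  v.foldr consSeq w

/-- An invertible transducer over the alphabet `X` with set of states `S`: the transition map and
the output map, each state acting on letters by a permutation. -/
@[ext]
structure Transducer (S X : Type*) where
  trans : S → X → S
  out : S → Equiv.Perm X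

namespace Transducer

variable {S X : Type*}

/-- The state reached from `s` after reading the first `n` letters of `w`. -/
def run (A : Transducer S X) (s : S) (w : ℕ → X) : ℕ → S
  | 0 => s
  | n + 1 => A.trans (A.run s w n) (w n)

/-- The transformation of the space of sequences defined by the state `s`. -/
def act (A : Transducer S X) (s : S) (w : ℕ → X) : ℕ → X :=
  fun n => A.out (A.run s w n) (w n)

/-- The inverse transducer (every label `x|y` is replaced by `y|x`). -/
def inverse (A : Transducer S X) : Transducer S X where
  trans s y := A.trans s ((A.out s).symm y)
  out s := (A.out s).symm

theorem inverse_inverse (A : Transducer S X) : A.inverse.inverse = A := by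
  ext <;> simp [inverse]

theorem run_inverse_act (A : Transducer S X) (s : S) (w : ℕ → X) (n : ℕ) :
    A.inverse.run s (A.act s w) n = A.run s w n := by
  induction n with
  | zero => rfl
  | succ n ih => simp only [run, ih]; simp [inverse, act]

theorem act_inverse_act (A : Transducer S X) (s : S) (w : ℕ → X) :
    A.inverse.act s (A.act s w) = w := by
  funext n
  change A.inverse.out (A.inverse.run s (A.act s w) n) (A.act s w n) = w n
  rw [run_inverse_act]
  simp [inverse, act]

/-- The transformation defined by the state `s`, as a permutation of the space of sequences. -/
def perm (A : Transducer S X) (s : S) : Equiv.Perm (ℕ → X) where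
  toFun := A.act s
  invFun := A.inverse.act s
  left_inv := A.act_inverse_act s
  right_inv w := by
    have h := A.inverse.act_inverse_act s w
    rwa [inverse_inverse] at h

/-- The paths of length `n` in the transducer (arrows are counted together with their input
letters) that avoid the states acting trivially. -/
def nontrivialPaths (A : Transducer S X) (n : ℕ) : Set ((Fin (n + 1) → S) × (Fin n → X)) :=
  {p | (∀ i, A.perm (p.1 i) ≠ 1) ∧
    ∀ i : Fin n, p.1 i.succ = A.trans (p.1 i.castSucc) (p.2 i)}

/-- A (finite) transducer is bounded if the number of paths of length `n` avoiding the trivial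
state is bounded independently of `n`. -/
def IsBounded (A : Transducer S X) : Prop :=
  Finite S ∧ ∃ C : ℕ, ∀ n : ℕ, (A.nontrivialPaths n).ncard ≤ C

/-- The group generated by the transformations defined by the states. -/
def group (A : Transducer S X) : Subgroup (Equiv.Perm (ℕ → X)) :=
  Subgroup.closure (Set.range A.perm)

/-- The orbital Schreier graph of the sequence `w`: its vertices are the points of the orbit of `w`
under the group, and distinct vertices `u`, `v` are adjacent if some state maps one to the other. -/
def schreierGraph (A : Transducer S X) (w : ℕ → X) :
    SimpleGraph (MulAction.orbit A.group w) :=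
  SimpleGraph.fromRel fun u v => ∃ s : S, A.perm s (u : ℕ → X) = (v : ℕ → X)

/-- The transducer obtained by renaming the letters of the alphabet through `e`. -/
def relabel (A : Transducer S X) (e : Equiv.Perm X) : Transducer S X where
  trans s x := A.trans s (e.symm x)
  out s := (e.symm.trans (A.out s)).trans e

end Transducer

/-- `g` maps the word `v` to the word `u` and its restriction `g|_v` is `h`, that is,
`g (v w) = u h(w)` for all sequences `w`. -/
def HasRestriction {X : Type*} (g : Equiv.Perm (ℕ → X)) (v u : List X)
    (h : Equiv.Perm (ℕ → X)) : Prop :=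
  u.length = v.length ∧ ∀ w : ℕ → X, g (prependWord v w) = prependWord u (h w)

/-- `N` is a finite subset of `G` such that, for every `g ∈ G`, all restrictions of `g` at
sufficiently long words belong to `N`. -/
def IsAbsorbing {X : Type*} (G : Subgroup (Equiv.Perm (ℕ → X)))
    (N : Set (Equiv.Perm (ℕ → X))) : Prop :=
  N.Finite ∧ N ⊆ (G : Set (Equiv.Perm (ℕ → X))) ∧
    ∀ g ∈ G, ∃ n : ℕ, ∀ v : List X, n ≤ v.length → ∃ u, ∃ h ∈ N, HasRestriction g v u h

/-- `N` is the nucleus of `G`: the smallest absorbing set. -/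
def IsNucleus {X : Type*} (G : Subgroup (Equiv.Perm (ℕ → X)))
    (N : Set (Equiv.Perm (ℕ → X))) : Prop :=
  IsLeast {M | IsAbsorbing G M} N

/-- Adding machines. After passing to a power `X ^ m` of the alphabet, `a` acts transitively on
the letters, and in the automaton given by its restrictions it has a single loop, labeled `x|y`
with `x ≠ y`, while all its other arrows go to the trivial state. -/
def IsAddingMachine {X : Type*} (a : Equiv.Perm (ℕ → X)) : Prop :=
  ∃ m : ℕ, 0 < m ∧
    (∀ v u : List X, v.length = m → u.length = m → ∃ (k : ℤ) (h : Equiv.Perm (ℕ → X)),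
      HasRestriction (a ^ k) v u h) ∧
    ∃ x y : List X, x.length = m ∧ x ≠ y ∧ HasRestriction a x y a ∧
      ∀ v : List X, v.length = m → v ≠ x → ∃ u, HasRestriction a v u 1

/-- The automaton of Šunić attached to an automorphism `ρ` of `B = (ℤ/2)^k` and a homomorphism
`ω : B → A = ℤ/2`. Its states are the elements of `A` and `B`: the nontrivial element of `A` only
changes the first letter, and `b ∈ B` acts by the recursion `b = (ω b, ρ b)`. -/
def sunicTransducer {k : ℕ} (ρ : (Fin k → ZMod 2) ≃+ (Fin k → ZMod 2))
    (ω : (Fin k → ZMod 2) →+ ZMod 2) : Transducer (ZMod 2 ⊕ (Fin k → ZMod 2)) (Fin 2) where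
  trans
    | Sum.inl _, _ => Sum.inl 0
    | Sum.inr b, x => if x = 0 then Sum.inl (ω b) else Sum.inr (ρ b)
  out
    | Sum.inl c => if c = 0 then 1 else Equiv.swap 0 1
    | Sum.inr _ => 1

/-- The uniform Bernoulli measure on the space of binary sequences. -/
noncomputable def bernoulliMeasure : MeasureTheory.Measure (ℕ → Fin 2) :=
  MeasureTheory.Measure.infinitePi fun _ => (PMF.uniformOfFintype (Fin 2)).toMeasure

/-- A graph has exactly two ends. -/
def HasTwoEnds {V : Type*} (Γ : SimpleGraph V) : Prop :=
  Γ.end.ncard = 2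

/-! Ends are counted by disjoint infinite subsets of the orbit that every group element preserves up
to finitely many points (`HasPieces`): exactly two ends means that two such pieces exist and three
do not. A bounded automaton generates a contracting group (`exists_finite_absorbing`), so the
nucleus always exists; it consists of the restrictions occurring at arbitrarily long words of a
single element, and its Schreier graph replaces that of the generators. Almost surely an orbit lies
in one cofinality class.

Necessity. Call a tile the set of sequences with a given tail after $n$ letters. Collapsing the
tiles turns the graph of $w$ into the graph of the $n$-th shift of $w$. Two disjoint pieces leak at
finitely many points, so for large $n$ every leak lies in the tile of $w$, and the $n$-th shift of
$w$ is a cut point of its own graph. The shift preserves the Bernoulli measure, hence almost every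
$w$ is already a cut point (`ae_isCutPoint`). A vertex with three neighbours would then have an
unbounded branch behind each of them, giving three ends (`not_three_neighbors`), so degrees are at
most two. The tile graph on the four words of length two is connected, and a word with a nontrivial
restriction spends one of its two edges on leaving the tile; counting degrees leaves at most two
such words (`ncard_active_le_two`). Every element of the nucleus is itself a restriction of one, so
either the second letter of these words is the first plus a constant, or they all share the first
letter (`nucleus_classification`). In the first case nontrivial elements switch letters all along
one forced path, which makes an adding machine. In the second, the restrictions at the common letter
form an elementary abelian 2-group on which restriction is an automorphism, which is Šunić's
recursion.

Sufficiency. At each point the nucleus acts like a finite subset of a self-replicating group $D$: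
the cyclic group of the adding machine, or an infinite dihedral group. Its orbits are lines, for all
$w$ or for almost all $w$ respectively. By contraction and self-replication each $g\in G$ agrees at
every point with one of finitely many elements of $D$, so it moves points of the line by a bounded
amount (`movesBoundedly`), and a line has two ends. -/

open MeasureTheory Relation

/-! ### Ends of graphs and infinite sets with finite boundary -/

namespace SimpleGraph

variable {V : Type} (Γ : SimpleGraph V)

/-- The vertices of `U` adjacent to a vertex outside `U`. -/
def innerBoundary (U : Set V) : Set V := {v ∈ U | ∃ u ∉ U, Γ.Adj v u}

variable {Γ}

/-- A path out of $U$ has to pass through the inner boundary, which has been deleted with $K$. -/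
theorem componentCompl_subset_of_innerBoundary_subset {U K : Set V} (hK : Γ.innerBoundary U ⊆ K)
    (C : Γ.ComponentCompl K) {v : V} (hv : v ∈ C) (hvU : v ∈ U) : C.supp ⊆ U := by
  rintro u ⟨huK, hu⟩
  obtain ⟨hvK, hv⟩ := hv
  have hr : (Γ.induce Kᶜ).Reachable ⟨v, hvK⟩ ⟨u, huK⟩ :=
    ConnectedComponent.exact (hv.trans hu.symm)
  obtain ⟨p⟩ := hr
  have key : ∀ {a b : (Kᶜ : Set V)} (_ : (Γ.induce Kᶜ).Walk a b), (a : V) ∈ U → (b : V) ∈ U := by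
    intro a b p
    induction p with
    | nil => exact id
    | cons h _ ih =>
      rename_i x y z q
      intro hx
      apply ih
      by_contra hy
      exact x.2 (hK ⟨hx, y, hy, h⟩)
  exact key p hvU

/-- An infinite component lies in the eventual range of the inverse system of components. On the
eventual ranges, which are finite, the transition maps are surjective, so a compatible family passes
through the given component. -/
theorem exists_end_eval_eq [LocallyFinite Γ] [Fact Γ.Preconnected] {K : Finset V}
    (C : Γ.ComponentCompl K) (hC : C.supp.Infinite) :
    ∃ e : Γ.end, e.1 (Opposite.op K) = C := by
  have : Infinite V := Set.infinite_univ_iff.mp (hC.mono (Set.subset_univ _))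
  let F := Γ.componentComplFunctor
  have hF : F.IsMittagLeffler :=
    F.isMittagLeffler_of_exists_finite_range fun j => ⟨j, CategoryTheory.CategoryStruct.id j, Set.toFinite _⟩
  have h1 : ∀ j, Nonempty (F.toEventualRanges.obj j) := F.toEventualRanges_nonempty hF
  have h2 : ∀ j, Finite (F.toEventualRanges.obj j) := fun j =>
    inferInstanceAs (Finite (F.eventualRange j))
  obtain ⟨s, hs⟩ := F.toEventualRanges.eval_section_surjective_of_surjective
    (F.surjective_toEventualRanges hF) (Opposite.op K)
    ⟨C, (Γ.infinite_iff_in_eventualRange (K := Opposite.op K) C).1 hC⟩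
  refine ⟨F.toEventualRangesSectionsEquiv s, ?_⟩
  exact congrArg Subtype.val hs

/-- Finitely many distinct ends are separated by one finite set $L$, and the boundary of a component
of its complement consists of neighbours of $L$. Conversely, after deletion of all the boundaries
each $U_i$ contains an infinite component, which extends to an end. -/
theorem exists_injective_end_iff [LocallyFinite Γ] [Fact Γ.Preconnected] {ι : Type} [Finite ι] :
    (∃ e : ι → Γ.end, Function.Injective e) ↔
      ∃ U : ι → Set V, Pairwise (Function.onFun Disjoint U) ∧
        ∀ i, (U i).Infinite ∧ (Γ.innerBoundary (U i)).Finite := by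
  classical
  have := Fintype.ofFinite ι
  constructor
  · rintro ⟨e, he⟩
    have h1 : ∀ i j, ∃ K : Finset V, i ≠ j → (e i).1 (Opposite.op K) ≠ (e j).1 (Opposite.op K) := by
      intro i j
      by_contra! hcon
      have hij : i ≠ j := (hcon ∅).1
      refine hij (he (Subtype.ext (funext fun K => ?_)))
      exact (hcon K.unop).2
    choose K hK using h1
    let L : Finset V := Finset.univ.biUnion fun p : ι × ι => K p.1 p.2
    have hL : ∀ i j, K i j ⊆ L := fun i j =>
      Finset.subset_biUnion_of_mem (fun p : ι × ι => K p.1 p.2) (Finset.mem_univ (i, j))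
    refine ⟨fun i => ((e i).1 (Opposite.op L)).supp, ?_, fun i => ⟨?_, ?_⟩⟩
    · intro i j hij
      refine ComponentCompl.pairwise_disjoint fun h => hK i j hij ?_
      have hi := (e i).2 (CategoryTheory.opHomOfLE (hL i j))
      have hj := (e j).2 (CategoryTheory.opHomOfLE (hL i j))
      exact hi.symm.trans ((congrArg _ h).trans hj)
    · exact Γ.end_componentCompl_infinite (e i) (Opposite.op L)
    · refine Set.Finite.subset (Finset.finite_toSet (L.biUnion fun v => Γ.neighborFinset v)) ?_
      rintro v ⟨hv, u, hu, hvu⟩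
      have huL : u ∈ L := by
        by_contra huL
        exact hu (ComponentCompl.mem_of_adj v u hv huL hvu)
      simpa using ⟨u, huL, hvu.symm⟩
  · rintro ⟨U, hd, hU⟩
    let K : Finset V := Finset.univ.biUnion fun i => (hU i).2.toFinset
    have hK : ∀ i, Γ.innerBoundary (U i) ⊆ (K : Set V) := by
      intro i v hv
      simp only [K, Finset.coe_biUnion, Set.mem_iUnion]
      exact ⟨i, by simp, by simpa using hv⟩
    have h1 : ∀ i, ∃ C : Γ.ComponentCompl K, (C.supp ∩ U i).Infinite := by
      intro i
      by_contra! hcon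
      refine (hU i).1.sdiff K.finite_toSet ((Set.finite_iUnion hcon).subset ?_)
      rintro v ⟨hv, hvK⟩
      exact Set.mem_iUnion.2 ⟨Γ.componentComplMk hvK, ⟨hvK, rfl⟩, hv⟩
    choose C hC using h1
    have h2 : ∀ i, (C i).supp ⊆ U i := by
      intro i
      obtain ⟨v, hv, hvU⟩ := (hC i).nonempty
      exact componentCompl_subset_of_innerBoundary_subset (hK i) (C i) hv hvU
    choose e he using fun i => exists_end_eval_eq (C i) ((hC i).mono Set.inter_subset_left)
    refine ⟨e, fun i j hij => ?_⟩
    by_contra hne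
    obtain ⟨v, hv⟩ := (C i).nonempty
    have hCij : C i = C j := by rw [← he i, ← he j, hij]
    exact Set.disjoint_left.1 (hd hne) (h2 i hv) (h2 j (hCij ▸ hv))

end SimpleGraph

/-- Infinite sets have `ncard` zero, so positivity of $k$ is what forces finiteness here. -/
theorem Set.ncard_eq_iff_exists_injective {α : Type*} {s : Set α} {k : ℕ} (hk : 0 < k) :
    s.ncard = k ↔ (∃ e : Fin k → s, Function.Injective e) ∧
      ¬ ∃ e : Fin (k + 1) → s, Function.Injective e := by
  have key : ∀ n : ℕ, (∃ e : Fin n → s, Function.Injective e) ↔ (n : ℕ∞) ≤ s.encard := by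
    intro n
    constructor
    · rintro ⟨e, he⟩
      have := ENat.card_le_card_of_injective he
      simpa using this
    · intro h
      obtain ⟨t, hts, ht⟩ := Set.exists_subset_encard_eq h
      have hfin : t.Finite := Set.finite_of_encard_eq_coe ht
      have hc : Nat.card t = n := by
        rw [Nat.card_coe_set_eq, Set.ncard_def, ht]; rfl
      have := hfin.to_subtype
      let f := (Finite.equivFinOfCardEq hc).symm
      exact ⟨fun i => ⟨f i, hts (f i).2⟩, fun i j hij => f.injective (Subtype.ext (by simpa using hij))⟩
  rw [key, key]
  constructor
  · intro h
    have hf : s.Finite := Set.finite_of_ncard_pos (h ▸ hk)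
    rw [← hf.cast_ncard_eq, h]
    norm_cast
    omega
  · rintro ⟨h1, h2⟩
    push Not at h2
    have hf : s.Finite := Set.finite_of_encard_le_coe (k := k) (by
      exact Order.le_of_lt_add_one (by exact_mod_cast h2))
    rw [← hf.cast_ncard_eq] at h1 h2
    norm_cast at h1 h2
    omega

/-! ### Binary sequences and finite words -/

abbrev BinSeq := ℕ → Fin 2

def tailSeq (w : BinSeq) : BinSeq := fun n => w (n + 1)

@[simp] theorem consSeq_zero (x : Fin 2) (w : BinSeq) : consSeq x w 0 = x := rfl

@[simp] theorem consSeq_succ (x : Fin 2) (w : BinSeq) (n : ℕ) : consSeq x w (n + 1) = w n := rfl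

@[simp] theorem tailSeq_consSeq (x : Fin 2) (w : BinSeq) : tailSeq (consSeq x w) = w := rfl

@[simp] theorem consSeq_tailSeq (w : BinSeq) : consSeq (w 0) (tailSeq w) = w := by
  funext n; cases n <;> rfl

theorem consSeq_inj {x y : Fin 2} {u v : BinSeq} : consSeq x u = consSeq y v ↔ x = y ∧ u = v :=
  ⟨fun h => ⟨congrFun h 0, congrArg tailSeq h⟩, by rintro ⟨rfl, rfl⟩; rfl⟩

@[simp] theorem prependWord_nil (w : BinSeq) : prependWord [] w = w := rfl

@[simp] theorem prependWord_cons (x : Fin 2) (v : List (Fin 2)) (w : BinSeq) :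
    prependWord (x :: v) w = consSeq x (prependWord v w) := rfl

theorem prependWord_inj {u v : List (Fin 2)} (h : u.length = v.length) {a b : BinSeq} :
    prependWord u a = prependWord v b ↔ u = v ∧ a = b := by
  induction u generalizing v with
  | nil =>
    obtain rfl : v = [] := List.length_eq_zero_iff.1 h.symm
    simp
  | cons x u ih =>
    cases v with
    | nil => simp at h
    | cons y v => simp [consSeq_inj, ih (by simpa using h), and_assoc]

def prefixWord : ℕ → BinSeq → List (Fin 2)
  | 0, _ => []
  | n + 1, w => w 0 :: prefixWord n (tailSeq w)

@[simp] theorem length_prefixWord (n : ℕ) (w : BinSeq) : (prefixWord n w).length = n := by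
  induction n generalizing w with
  | zero => rfl
  | succ n ih => simp [prefixWord, ih]

theorem prependWord_prefixWord (n : ℕ) (w : BinSeq) :
    prependWord (prefixWord n w) (tailSeq^[n] w) = w := by
  induction n generalizing w with
  | zero => rfl
  | succ n ih => simp [prefixWord, ih]

@[simp] theorem tailSeq_iterate_prependWord (v : List (Fin 2)) (w : BinSeq) :
    tailSeq^[v.length] (prependWord v w) = w := by
  induction v with
  | nil => rfl
  | cons x v ih => simp [ih]

theorem prefixWord_prependWord (v : List (Fin 2)) (w : BinSeq) :
    prefixWord v.length (prependWord v w) = v := by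
  induction v with
  | nil => rfl
  | cons x v ih => simp [prefixWord, ih]

theorem exists_eq_prependWord (n : ℕ) (w : BinSeq) :
    ∃ v : List (Fin 2), v.length = n ∧ w = prependWord v (tailSeq^[n] w) :=
  ⟨prefixWord n w, by simp, (prependWord_prefixWord n w).symm⟩

/-! ### Tree automorphisms and their restrictions -/

/-- Automorphisms of the binary tree, as transformations of its boundary. -/
def treeAut : Subgroup (Equiv.Perm BinSeq) where
  carrier := {g | ∀ n u v, (∀ i < n, u i = v i) ↔ ∀ i < n, g u i = g v i}
  one_mem' := fun _ _ _ => Iff.rfl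
  mul_mem' := fun {g h} hg hh n u v => (hh n u v).trans (hg n (h u) (h v))
  inv_mem' := fun {g} hg n u v => by
    have := hg n (g⁻¹ u) (g⁻¹ v)
    simpa using this.symm

abbrev TreeAut := treeAut

namespace TreeAut

instance : MulAction TreeAut BinSeq := inferInstance

theorem agree (g : TreeAut) {n : ℕ} {u v : BinSeq} (h : ∀ i < n, u i = v i) :
    ∀ i < n, (g • u) i = (g • v) i := (g.2 n u v).1 h

def rootFun (g : TreeAut) (x : Fin 2) : Fin 2 := (g • consSeq x 0 : BinSeq) 0

theorem smul_consSeq_zero (g : TreeAut) (x : Fin 2) (u : BinSeq) :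
    (g • consSeq x u : BinSeq) 0 = rootFun g x :=
  agree g (n := 1) (by intro i hi; obtain rfl : i = 0 := by omega
                       rfl) 0 one_pos

def secFun (g : TreeAut) (x : Fin 2) (u : BinSeq) : BinSeq := tailSeq (g • consSeq x u : BinSeq)

theorem smul_consSeq' (g : TreeAut) (x : Fin 2) (u : BinSeq) :
    (g • consSeq x u : BinSeq) = consSeq (rootFun g x) (secFun g x u) := by
  rw [← smul_consSeq_zero g x u, secFun, consSeq_tailSeq]

theorem rootFun_inv (g : TreeAut) (x : Fin 2) : rootFun g⁻¹ (rootFun g x) = x := by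
  have h := smul_consSeq' g x 0
  have h2 : (g⁻¹ • (g • consSeq x 0) : BinSeq) 0 = x := by simp
  rwa [h, smul_consSeq_zero] at h2

theorem secFun_inv (g : TreeAut) (x : Fin 2) (u : BinSeq) :
    secFun g⁻¹ (rootFun g x) (secFun g x u) = u := by
  rw [secFun, ← smul_consSeq', inv_smul_smul, tailSeq_consSeq]

/-- The permutation of letters induced by a tree automorphism. -/
def root (g : TreeAut) : Equiv.Perm (Fin 2) where
  toFun := rootFun g
  invFun := rootFun g⁻¹
  left_inv := rootFun_inv g
  right_inv x := by simpa using rootFun_inv g⁻¹ x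

/-- The restriction of a tree automorphism at a letter. -/
def sec (g : TreeAut) (x : Fin 2) : TreeAut where
  val :=
    { toFun := secFun g x
      invFun := secFun g⁻¹ (rootFun g x)
      left_inv := secFun_inv g x
      right_inv := fun u => by
        have := secFun_inv g⁻¹ (rootFun g x) u
        rwa [rootFun_inv, inv_inv] at this }
  property := by
    intro n u v
    have h := g.2 (n + 1) (consSeq x u) (consSeq x v)
    change _ ↔ ∀ i < n + 1, (g • consSeq x u : BinSeq) i = (g • consSeq x v : BinSeq) i at h
    rw [smul_consSeq', smul_consSeq'] at h
    have key : ∀ y : Fin 2, ∀ a b : BinSeq,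
        (∀ i < n + 1, consSeq y a i = consSeq y b i) ↔ ∀ i < n, a i = b i := by
      intro y a b
      constructor
      · intro h i hi
        exact h (i + 1) (by omega)
      · rintro h (_ | i) hi
        · rfl
        · exact h i (by omega)
    rw [key, key] at h
    exact h

theorem smul_consSeq (g : TreeAut) (x : Fin 2) (u : BinSeq) :
    g • consSeq x u = consSeq (root g x) (sec g x • u) := smul_consSeq' g x u

theorem ext_smul {g h : TreeAut} (H : ∀ w : BinSeq, g • w = h • w) : g = h :=
  Subtype.ext (Equiv.ext H)

theorem root_sec_unique {g : TreeAut} {x y : Fin 2} {h : TreeAut}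
    (H : ∀ u : BinSeq, g • consSeq x u = consSeq y (h • u)) : root g x = y ∧ sec g x = h := by
  have h1 := fun u => (smul_consSeq g x u).symm.trans (H u)
  simp only [consSeq_inj] at h1
  exact ⟨(h1 0).1, ext_smul fun u => (h1 u).2⟩

theorem ext_root_sec {g h : TreeAut} (hr : root g = root h) (hs : ∀ x, sec g x = sec h x) :
    g = h :=
  ext_smul fun w => by rw [← consSeq_tailSeq w, smul_consSeq, smul_consSeq, hr, hs]

theorem root_sec_mul (g h : TreeAut) (x : Fin 2) :
    root (g * h) x = root g (root h x) ∧ sec (g * h) x = sec g (root h x) * sec h x :=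
  root_sec_unique fun u => by rw [mul_smul, smul_consSeq, smul_consSeq, mul_smul]

@[simp] theorem root_mul (g h : TreeAut) : root (g * h) = root g * root h :=
  Equiv.ext fun x => (root_sec_mul g h x).1

@[simp] theorem sec_mul (g h : TreeAut) (x : Fin 2) :
    sec (g * h) x = sec g (root h x) * sec h x := (root_sec_mul g h x).2

@[simp] theorem root_one : root 1 = 1 :=
  Equiv.ext fun x => (root_sec_unique (h := 1) fun u => by rw [one_smul, one_smul]; rfl).1

@[simp] theorem sec_one (x : Fin 2) : sec 1 x = 1 :=
  (root_sec_unique (y := x) fun u => by rw [one_smul, one_smul]).2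

@[simp] theorem root_inv (g : TreeAut) : root g⁻¹ = (root g)⁻¹ := by
  rw [eq_inv_iff_mul_eq_one, ← root_mul, inv_mul_cancel, root_one]

theorem sec_inv_root (g : TreeAut) (x : Fin 2) : sec g⁻¹ (root g x) = (sec g x)⁻¹ := by
  rw [eq_inv_iff_mul_eq_one, ← sec_mul, inv_mul_cancel, sec_one]

/-- The image of a word under a tree automorphism. -/
def actW : TreeAut → List (Fin 2) → List (Fin 2)
  | _, [] => []
  | g, x :: v => root g x :: actW (sec g x) v

/-- The restriction of a tree automorphism at a word. -/
def secW : TreeAut → List (Fin 2) → TreeAut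
  | g, [] => g
  | g, x :: v => secW (sec g x) v

@[simp] theorem actW_nil (g : TreeAut) : actW g [] = [] := rfl
@[simp] theorem secW_nil (g : TreeAut) : secW g [] = g := rfl
@[simp] theorem actW_cons (g : TreeAut) (x : Fin 2) (v : List (Fin 2)) :
    actW g (x :: v) = root g x :: actW (sec g x) v := rfl
@[simp] theorem secW_cons (g : TreeAut) (x : Fin 2) (v : List (Fin 2)) :
    secW g (x :: v) = secW (sec g x) v := rfl

@[simp] theorem length_actW (g : TreeAut) (v : List (Fin 2)) : (actW g v).length = v.length := by
  induction v generalizing g with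
  | nil => rfl
  | cons x v ih => simp [ih]

theorem smul_prependWord (g : TreeAut) (v : List (Fin 2)) (u : BinSeq) :
    g • prependWord v u = prependWord (actW g v) (secW g v • u) := by
  induction v generalizing g with
  | nil => rfl
  | cons x v ih => simp [smul_consSeq, ih]

theorem actW_append (g : TreeAut) (u v : List (Fin 2)) :
    actW g (u ++ v) = actW g u ++ actW (secW g u) v := by
  induction u generalizing g with
  | nil => rfl
  | cons x u ih => simp [ih]

theorem secW_append (g : TreeAut) (u v : List (Fin 2)) :
    secW g (u ++ v) = secW (secW g u) v := by
  induction u generalizing g with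
  | nil => rfl
  | cons x u ih => simp [ih]

@[simp] theorem actW_one (v : List (Fin 2)) : actW 1 v = v := by
  induction v with
  | nil => rfl
  | cons x v ih => simp [ih]

@[simp] theorem secW_one (v : List (Fin 2)) : secW 1 v = 1 := by
  induction v with
  | nil => rfl
  | cons x v ih => simp [ih]

theorem actW_mul (g h : TreeAut) (v : List (Fin 2)) : actW (g * h) v = actW g (actW h v) := by
  induction v generalizing g h with
  | nil => rfl
  | cons x v ih => simp [ih]

theorem secW_mul (g h : TreeAut) (v : List (Fin 2)) :
    secW (g * h) v = secW g (actW h v) * secW h v := by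
  induction v generalizing g h with
  | nil => rfl
  | cons x v ih => simp [ih]

@[simp] theorem actW_inv_actW (g : TreeAut) (v : List (Fin 2)) : actW g⁻¹ (actW g v) = v := by
  rw [← actW_mul, inv_mul_cancel, actW_one]

@[simp] theorem actW_actW_inv (g : TreeAut) (v : List (Fin 2)) : actW g (actW g⁻¹ v) = v := by
  rw [← actW_mul, mul_inv_cancel, actW_one]

theorem actW_injective (g : TreeAut) : Function.Injective (actW g) :=
  Function.LeftInverse.injective (actW_inv_actW g)

theorem secW_inv_actW (g : TreeAut) (v : List (Fin 2)) :
    secW g⁻¹ (actW g v) = (secW g v)⁻¹ := by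
  rw [eq_inv_iff_mul_eq_one, ← secW_mul, inv_mul_cancel, secW_one]

theorem secW_inv (g : TreeAut) (v : List (Fin 2)) :
    secW g⁻¹ v = (secW g (actW g⁻¹ v))⁻¹ := by
  rw [← secW_inv_actW, actW_actW_inv]

/-- Words of equal length are recovered from the sequences that they begin, so both the image word
and the restriction are determined by $g$ and $v$. -/
theorem hasRestriction_iff (g : TreeAut) (v u : List (Fin 2)) (h : Equiv.Perm BinSeq) :
    HasRestriction g.1 v u h ↔ actW g v = u ∧ ((secW g v : TreeAut) : Equiv.Perm BinSeq) = h := by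
  constructor
  · rintro ⟨hl, H⟩
    have h1 : ∀ w, prependWord (actW g v) (secW g v • w) = prependWord u (h w) :=
      fun w => (smul_prependWord g v w).symm.trans (H w)
    have hl' : (actW g v).length = u.length := by simp [hl]
    simp only [prependWord_inj hl'] at h1
    exact ⟨(h1 0).1, Equiv.ext fun w => (h1 w).2⟩
  · rintro ⟨rfl, rfl⟩
    exact ⟨length_actW g v, fun w => smul_prependWord g v w⟩

/-- Two tree automorphisms agree if they act in the same way on all finite words. -/
theorem ext_of_actW {g h : TreeAut} (H : ∀ v, actW g v = actW h v) : g = h := by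
  refine ext_smul fun w => funext fun n => ?_
  have h1 : ∀ g : TreeAut, prefixWord (n + 1) (g • w) = actW g (prefixWord (n + 1) w) := by
    intro g
    conv_lhs => rw [← prependWord_prefixWord (n + 1) w, smul_prependWord]
    have := prefixWord_prependWord (actW g (prefixWord (n + 1) w))
      (secW g (prefixWord (n + 1) w) • tailSeq^[n + 1] w)
    rwa [length_actW, length_prefixWord] at this
  have h2 : ∀ (n : ℕ) (a b : BinSeq), prefixWord (n + 1) a = prefixWord (n + 1) b → a n = b n := by
    intro n
    induction n with
    | zero => intro a b hab; simpa [prefixWord] using hab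
    | succ n ih =>
      intro a b hab
      exact ih _ _ (List.cons.inj hab).2
  exact h2 n _ _ (by rw [h1, h1, H])

theorem eq_one_of_root_of_sec {g : TreeAut} (hr : root g = 1) (hs : ∀ x, sec g x = 1) : g = 1 :=
  ext_root_sec (by simpa using hr) (by simpa using hs)

end TreeAut

/-! ### Bounded automata generate contracting groups -/

namespace TreeAut

/-- The automorphisms with trivial restrictions at all words of length `d`. -/
def depthLE (d : ℕ) : Set TreeAut := {g | ∀ v : List (Fin 2), v.length = d → secW g v = 1}

theorem secW_eq_one_of_depthLE {g : TreeAut} {d : ℕ} (hg : g ∈ depthLE d) {v : List (Fin 2)}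
    (hv : d ≤ v.length) : secW g v = 1 := by
  rw [← List.take_append_drop d v, secW_append, hg _ (by simpa using hv), secW_one]

theorem depthLE_mono {d e : ℕ} (h : d ≤ e) : depthLE d ⊆ depthLE e :=
  fun _ hg _ hv => secW_eq_one_of_depthLE hg (by omega)

theorem one_mem_depthLE (d : ℕ) : 1 ∈ depthLE d := fun v _ => secW_one v

theorem mul_mem_depthLE {g h : TreeAut} {d : ℕ} (hg : g ∈ depthLE d) (hh : h ∈ depthLE d) :
    g * h ∈ depthLE d := fun v hv => by
  rw [secW_mul, hg _ (by simpa using hv), hh v hv, one_mul]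

theorem inv_mem_depthLE {g : TreeAut} {d : ℕ} (hg : g ∈ depthLE d) : g⁻¹ ∈ depthLE d :=
  fun v hv => by rw [secW_inv, hg _ (by simpa using hv), inv_one]

theorem secW_mem_depthLE {g : TreeAut} {d : ℕ} (hg : g ∈ depthLE d) (v : List (Fin 2)) :
    secW g v ∈ depthLE d := fun u hu => by
  rw [← secW_append]
  exact secW_eq_one_of_depthLE hg (by simp [hu])

theorem root_sec_injective : Function.Injective fun g : TreeAut => (root g, sec g) :=
  fun _ _ hgh => ext_root_sec (Prod.ext_iff.1 hgh).1 fun x => congrFun (Prod.ext_iff.1 hgh).2 x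

/-- An automorphism is determined by its root permutation and its two restrictions, whose depth is
smaller by one. -/
theorem finite_depthLE (d : ℕ) : (depthLE d).Finite := by
  induction d with
  | zero =>
    refine (Set.finite_singleton (1 : TreeAut)).subset fun g hg => ?_
    exact hg [] rfl
  | succ d ih =>
    have h := (Set.finite_univ (α := Equiv.Perm (Fin 2))).prod (Set.Finite.pi' fun _ : Fin 2 => ih)
    refine (h.preimage root_sec_injective.injOn).subset fun g hg => ⟨trivial, fun x v hv => ?_⟩
    exact hg (x :: v) (by simp [hv])

theorem mem_depthLE_of_sec {g : TreeAut} (h : ∀ x, ∃ d, sec g x ∈ depthLE d) :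
    ∃ d, g ∈ depthLE d := by
  choose d hd using h
  refine ⟨max (d 0) (d 1) + 1, fun v hv => ?_⟩
  cases v with
  | nil => simp at hv
  | cons x v =>
    simp only [List.length_cons, Nat.add_right_cancel_iff] at hv
    refine secW_eq_one_of_depthLE (hd x) ?_
    rw [hv]
    fin_cases x
    · exact le_max_left _ _
    · exact le_max_right _ _

theorem mem_depthLE_of_secW {g : TreeAut} (n : ℕ)
    (h : ∀ v : List (Fin 2), v.length = n → ∃ d, secW g v ∈ depthLE d) : ∃ d, g ∈ depthLE d := by
  induction n generalizing g with
  | zero => exact h [] rfl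
  | succ n ih => exact mem_depthLE_of_sec fun x => ih fun v hv => h (x :: v) (by simp [hv])

theorem ext_of_actW_mul {g h : TreeAut} {m : ℕ} (hm : 0 < m)
    (H : ∀ k v, v.length = m * k → actW g v = actW h v) : g = h := by
  refine ext_of_actW fun v => ?_
  have hl : v.length ≤ m * v.length := Nat.le_mul_of_pos_left _ hm
  have h1 := H v.length (v ++ List.replicate (m * v.length - v.length) 0) (by simp; omega)
  rw [actW_append, actW_append] at h1
  exact List.append_inj_left h1 (by simp)

/-- The automorphisms reproducing themselves at one word of length `m`, with restrictions of
depth at most `d` at the other words of that length. -/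
def circuits (m d : ℕ) : Set TreeAut :=
  {g | ∃ x : List (Fin 2), x.length = m ∧ secW g x = g ∧
    ∀ v : List (Fin 2), v.length = m → v ≠ x → secW g v ∈ depthLE d}

/-- For a fixed word $x$, the equation $g|_x=g$ is a recursion that determines $g$ from its action
on words of length $m$ and its finitary restrictions away from $x$. Both range over finite sets. -/
theorem finite_circuits {m : ℕ} (hm : 0 < m) (d : ℕ) : (circuits m d).Finite := by
  classical
  have hL : {x : List (Fin 2) | x.length = m}.Finite := List.finite_length_eq _ m
  have hL' := hL.to_subtype
  have hU : circuits m d ⊆ ⋃ x ∈ {x : List (Fin 2) | x.length = m}, {g | secW g x = g ∧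
      ∀ v : List (Fin 2), v.length = m → v ≠ x → secW g v ∈ depthLE d} := by
    rintro g ⟨x, hx, hg⟩
    exact Set.mem_biUnion hx hg
  refine (hL.biUnion fun x hx => ?_).subset hU
  -- The entry at $x$ is replaced by 1: the restriction there is $g$ itself, which is not known to
  -- lie in a finite set.
  let f : TreeAut → ({x : List (Fin 2) | x.length = m} → {x : List (Fin 2) | x.length = m}) ×
      ({x : List (Fin 2) | x.length = m} → TreeAut) :=
    fun g => (fun v => ⟨actW g v, (length_actW g v).trans v.2⟩, fun v => if v.1 = x then 1 else secW g v)
  refine Set.Finite.of_finite_image (f := f)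
    (((Set.finite_univ).prod (Set.Finite.pi' fun _ => finite_depthLE d)).subset ?_) ?_
  · rintro _ ⟨g, ⟨-, hg⟩, rfl⟩
    refine ⟨trivial, fun v => ?_⟩
    by_cases hv : v.1 = x
    · simp only [f, hv, if_true]; exact one_mem_depthLE d
    · simp only [f, hv, if_false]; exact hg v.1 v.2 hv
  · rintro g ⟨hgx, -⟩ h ⟨hhx, -⟩ hgh
    have h1 : ∀ v, v.length = m → actW g v = actW h v := fun v hv =>
      congrArg Subtype.val (congrFun (congrArg Prod.fst hgh) ⟨v, hv⟩)
    have h2 : ∀ v, v.length = m → v ≠ x → secW g v = secW h v := fun v hv hvx => by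
      have := congrFun (congrArg Prod.snd hgh) ⟨v, hv⟩
      simpa [f, hvx] using this
    refine ext_of_actW_mul hm fun k => ?_
    induction k with
    | zero =>
      intro v hv
      obtain rfl : v = [] := List.length_eq_zero_iff.1 (by simpa using hv)
      rfl
    | succ k ih =>
      intro v hv
      rw [Nat.mul_succ] at hv
      have ht : (v.take m).length = m := by simp; omega
      have hd : (v.drop m).length = m * k := by simp; omega
      rw [← List.take_append_drop m v, actW_append, actW_append, h1 _ ht]
      by_cases hvx : v.take m = x
      · rw [hvx, hgx, hhx, ih _ hd]
      · rw [h2 _ ht hvx]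

/-- The automorphisms that are circuits or of depth at most `d`. -/
def basicSet (m d : ℕ) : Set TreeAut := circuits m d ∪ depthLE d

theorem secW_mem_basicSet {m d : ℕ} {g : TreeAut} (hg : g ∈ basicSet m d)
    {v : List (Fin 2)} (hv : v.length = m) : secW g v ∈ basicSet m d := by
  rcases hg with ⟨x, hx, hgx, hg⟩ | hg
  · by_cases hvx : v = x
    · rw [hvx, hgx]; exact Or.inl ⟨x, hx, hgx, hg⟩
    · exact Or.inr (hg v hv hvx)
  · exact Or.inr (secW_mem_depthLE hg v)

theorem secW_mem_basicSet_mul {m d : ℕ} {g : TreeAut} (hg : g ∈ basicSet m d)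
    {k : ℕ} {v : List (Fin 2)} (hv : v.length = m * k) : secW g v ∈ basicSet m d := by
  induction k generalizing g v with
  | zero =>
    obtain rfl : v = [] := List.length_eq_zero_iff.1 (by simpa using hv)
    exact hg
  | succ k ih =>
    rw [Nat.mul_succ] at hv
    rw [← List.take_append_drop m v, secW_append]
    exact ih (secW_mem_basicSet hg (by simp; omega)) (by simp; omega)

theorem inv_mem_basicSet {m d : ℕ} {g : TreeAut} (hg : g ∈ basicSet m d) :
    g⁻¹ ∈ basicSet m d := by
  rcases hg with ⟨x, hx, hgx, hg⟩ | hg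
  · refine Or.inl ⟨actW g x, by simpa using hx, by rw [secW_inv_actW, hgx], fun v hv hvx => ?_⟩
    rw [secW_inv]
    refine inv_mem_depthLE (hg _ (by simpa using hv) fun h => hvx ?_)
    rw [← h, actW_actW_inv]
  · exact Or.inr (inv_mem_depthLE hg)

theorem secW_depthLE_mul_circuit {m d : ℕ} (hdm : d ≤ m) {f g : TreeAut}
    (hf : f ∈ depthLE d) (hg : g ∈ basicSet m d) {v : List (Fin 2)} (hv : v.length = m) :
    secW (f * g) v ∈ basicSet m d := by
  rw [secW_mul, secW_eq_one_of_depthLE hf (by simp [hv, hdm]), one_mul]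
  exact secW_mem_basicSet hg hv

theorem secW_circuit_mul_depthLE {m d : ℕ} (hdm : d ≤ m) {f g : TreeAut}
    (hg : g ∈ basicSet m d) (hf : f ∈ depthLE d) {v : List (Fin 2)} (hv : v.length = m) :
    secW (g * f) v ∈ basicSet m d := by
  rw [secW_mul, secW_eq_one_of_depthLE hf (by simp [hv, hdm]), mul_one]
  exact secW_mem_basicSet hg (by simp [hv])

/-- If $h$ carries its circuit word to that of $g$, then $gh$ is again a circuit. Otherwise, at each
word of length $m$, at least one factor has become finitary, and the next $m\ge d$ letters kill it.
This is why two blocks of $m$ letters are needed. -/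
theorem secW_mul_mem_basicSet {m d : ℕ} (hdm : d ≤ m) {g h : TreeAut} (hg : g ∈ basicSet m d)
    (hh : h ∈ basicSet m d) {v : List (Fin 2)} (hv : v.length = m + m) :
    secW (g * h) v ∈ basicSet m d := by
  have ht : (v.take m).length = m := by simp; omega
  have hd : (v.drop m).length = m := by simp; omega
  rw [← List.take_append_drop m v, secW_append]
  rcases hg with hg | hg
  swap
  · exact secW_mem_basicSet (secW_depthLE_mul_circuit hdm hg hh ht) hd
  rcases hh with hh | hh
  swap
  · exact secW_mem_basicSet (secW_circuit_mul_depthLE hdm (Or.inl hg) hh ht) hd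
  have hg' := hg
  have hh' := hh
  obtain ⟨x, hx, hgx, hg⟩ := hg
  obtain ⟨z, hz, hhz, hh⟩ := hh
  by_cases hxz : actW h z = x
  · refine secW_mem_basicSet (secW_mem_basicSet (Or.inl ⟨z, hz, ?_, fun u hu huz => ?_⟩) ht) hd
    · rw [secW_mul, hxz, hgx, hhz]
    · rw [secW_mul]
      refine mul_mem_depthLE (hg _ (by simpa using hu) fun h' => huz ?_) (hh u hu huz)
      exact actW_injective h (h'.trans hxz.symm)
  · rw [secW_mul]
    by_cases hvz : v.take m = z
    · rw [hvz, hhz]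
      exact secW_depthLE_mul_circuit hdm (hg _ (by simpa using hz) hxz) (Or.inl hh') hd
    · exact secW_circuit_mul_depthLE hdm (secW_mem_basicSet (Or.inl hg') (by simpa using ht))
        (hh _ ht hvz) hd

/-- The words of length `n` at which the restriction of `g` is nontrivial. -/
def activeWords (g : TreeAut) (n : ℕ) : Set (List (Fin 2)) := {v | v.length = n ∧ secW g v ≠ 1}

theorem finite_activeWords (g : TreeAut) (n : ℕ) : (activeWords g n).Finite :=
  (List.finite_length_eq _ n).subset fun _ hv => hv.1

/-- Bounded automorphisms of the tree. -/
def IsBdd (g : TreeAut) : Prop := ∃ C : ℕ, ∀ n, (activeWords g n).ncard ≤ C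

theorem IsBdd.one : IsBdd 1 := ⟨0, fun n => by
  rw [Nat.le_zero, Set.ncard_eq_zero (finite_activeWords 1 n)]
  exact Set.eq_empty_of_forall_notMem fun v hv => hv.2 (secW_one v)⟩

theorem IsBdd.mul {g h : TreeAut} (hg : IsBdd g) (hh : IsBdd h) : IsBdd (g * h) := by
  obtain ⟨C, hC⟩ := hg
  obtain ⟨D, hD⟩ := hh
  refine ⟨C + D, fun n => ?_⟩
  have hsub : activeWords (g * h) n ⊆ actW h⁻¹ '' activeWords g n ∪ activeWords h n := by
    rintro v ⟨hv, hne⟩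
    by_cases h1 : secW h v = 1
    · refine Or.inl ⟨actW h v, ⟨by simpa using hv, fun h2 => hne ?_⟩, by simp⟩
      rw [secW_mul, h1, h2, mul_one]
    · exact Or.inr ⟨hv, h1⟩
  refine (Set.ncard_le_ncard hsub (((finite_activeWords g n).image _).union
    (finite_activeWords h n))).trans ((Set.ncard_union_le _ _).trans ?_)
  exact add_le_add ((Set.ncard_image_le (finite_activeWords g n)).trans (hC n)) (hD n)

theorem IsBdd.inv {g : TreeAut} (hg : IsBdd g) : IsBdd g⁻¹ := by
  obtain ⟨C, hC⟩ := hg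
  refine ⟨C, fun n => ?_⟩
  have hsub : activeWords g⁻¹ n ⊆ actW g '' activeWords g n := by
    rintro v ⟨hv, hne⟩
    refine ⟨actW g⁻¹ v, ⟨by simpa using hv, fun h2 => hne ?_⟩, by simp⟩
    rw [secW_inv, h2, inv_one]
  exact (Set.ncard_le_ncard hsub ((finite_activeWords g n).image _)).trans
    ((Set.ncard_image_le (finite_activeWords g n)).trans (hC n))

def powWord (x : List (Fin 2)) : ℕ → List (Fin 2)
  | 0 => []
  | n + 1 => x ++ powWord x n

theorem length_powWord (x : List (Fin 2)) (n : ℕ) : (powWord x n).length = n * x.length := by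
  induction n with
  | zero => simp [powWord]
  | succ n ih => simp [powWord, ih]; ring

theorem powWord_add (x : List (Fin 2)) (n k : ℕ) :
    powWord x (n + k) = powWord x n ++ powWord x k := by
  induction n with
  | zero => simp [powWord]
  | succ n ih => rw [Nat.add_right_comm, powWord, powWord, ih, List.append_assoc]

theorem secW_powWord {g : TreeAut} {x : List (Fin 2)} (h : secW g x = g) (n : ℕ) :
    secW g (powWord x n) = g := by
  induction n with
  | zero => rfl
  | succ n ih => rw [powWord, secW_append, h, ih]

/-- If $t|_v$ were not finitary, the words $x^i v y_i$ for $0\le i\le C$, with $y_i$ chosen to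
equalise lengths, would be $C+1$ distinct active words of one length. -/
theorem IsBdd.finitary_of_ne {t : TreeAut} (ht : IsBdd t) {x v : List (Fin 2)}
    (hx : secW t x = t) (hl : v.length = x.length) (hvx : v ≠ x) :
    ∃ d, secW t v ∈ depthLE d := by
  by_contra! hcon
  obtain ⟨C, hC⟩ := ht
  have h1 : ∀ d, ∃ y : List (Fin 2), y.length = d ∧ secW (secW t v) y ≠ 1 := by
    intro d
    have := hcon d
    simp only [depthLE, Set.mem_ofPred_eq] at this
    push Not at this
    exact this
  choose y hyl hy using h1
  let W : ℕ → List (Fin 2) := fun i => powWord x i ++ (v ++ y ((C - i) * x.length))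
  have hW : ∀ i ∈ Finset.range (C + 1), W i ∈ activeWords t ((C + 1) * x.length) := by
    intro i hi
    rw [Finset.mem_range] at hi
    refine ⟨?_, ?_⟩
    · simp only [W, List.length_append, length_powWord, hyl, hl]
      obtain ⟨k, rfl⟩ := Nat.exists_eq_add_of_le (Nat.lt_succ_iff.1 hi)
      rw [Nat.add_sub_cancel_left]; ring
    · simp only [W, secW_append, secW_powWord hx]
      exact hy _
  have hne : ∀ i k, W i ≠ W (i + (k + 1)) := by
    intro i k h
    simp only [W] at h
    rw [powWord_add, show powWord x (k + 1) = x ++ powWord x k from rfl, List.append_assoc,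
      List.append_assoc] at h
    exact hvx (List.append_inj_left (List.append_cancel_left h) hl)
  have hinj : Set.InjOn W (Finset.range (C + 1)) := by
    intro i _ j _ hij
    rcases lt_trichotomy i j with h | h | h
    · obtain ⟨k, rfl⟩ := Nat.exists_eq_add_of_lt h
      exact absurd hij (hne i k)
    · exact h
    · obtain ⟨k, rfl⟩ := Nat.exists_eq_add_of_lt h
      exact absurd hij.symm (hne j k)
  have h2 := Set.ncard_le_ncard (s := W '' (Finset.range (C + 1) : Finset ℕ))
    (by rintro _ ⟨i, hi, rfl⟩; exact hW i (by simpa using hi)) (finite_activeWords t _)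
  rw [hinj.ncard_image, Set.ncard_coe_finset, Finset.card_range] at h2
  exact absurd (h2.trans (hC _)) (by omega)

/-- By the pigeonhole principle two prefixes of $v$ lead to the same restriction, so the path along
$v$ passes through a cycle. -/
theorem exists_secW_recurrent {Sg : Set TreeAut} (hfin : Sg.Finite)
    (hsec : ∀ g ∈ Sg, ∀ x, sec g x ∈ Sg) {g : TreeAut} (hg : g ∈ Sg) {v : List (Fin 2)}
    (hv : Sg.ncard ≤ v.length) :
    ∃ u r c : List (Fin 2), v = u ++ r ∧ c ≠ [] ∧ secW (secW g u) c = secW g u := by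
  have hmem : ∀ u, secW g u ∈ Sg := by
    intro u
    induction u generalizing g with
    | nil => exact hg
    | cons x u ih => exact ih (hsec g hg x)
  obtain ⟨i, hi, j, hj, hne, hij⟩ := Finset.exists_ne_map_eq_of_card_lt_of_maps_to
    (s := Finset.range (v.length + 1)) (t := hfin.toFinset) (f := fun i => secW g (v.take i))
    (by rw [← Set.ncard_eq_toFinset_card _ hfin, Finset.card_range]; omega)
    (fun i _ => by simpa using hmem _)
  have key : ∀ i j, i < j → j ≤ v.length → secW g (v.take i) = secW g (v.take j) →
      ∃ u r c : List (Fin 2), v = u ++ r ∧ c ≠ [] ∧ secW (secW g u) c = secW g u := by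
    intro i j hlt hj h
    refine ⟨v.take i, v.drop i, (v.take j).drop i, by simp, ?_, ?_⟩
    · intro hnil
      have := congrArg List.length hnil
      simp at this
      omega
    · rw [← secW_append]
      have : v.take i ++ (v.take j).drop i = v.take j := by
        conv_rhs => rw [← List.take_append_drop i (v.take j), List.take_take, min_eq_left hlt.le]
      rw [this, h]
  simp only [Finset.mem_range] at hi hj
  rcases lt_or_gt_of_ne hne with h | h
  · exact key i j h (by omega) hij
  · exact key j i h (by omega) hij.symm

/-- As long as $u$ is a prefix of a power of $c$, the path stays on the cycle. Once it leaves the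
cycle, boundedness makes the restriction finitary. -/
theorem IsBdd.finitary_or_recurrent {t : TreeAut} (ht : IsBdd t) {c : List (Fin 2)} (hc : c ≠ [])
    (hct : secW t c = t) (u : List (Fin 2)) :
    (∃ d, secW t u ∈ depthLE d) ∨
      ∃ c' : List (Fin 2), c' ≠ [] ∧ secW (secW t u) c' = secW t u := by
  have hcl : 0 < c.length := List.length_pos_iff.2 hc
  set x := powWord c (u.length + 1) with hx
  have hxl : u.length + 1 ≤ x.length := by
    rw [hx, length_powWord]; exact Nat.le_mul_of_pos_right _ hcl
  have hxt : secW t x = t := secW_powWord hct _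
  by_cases hpre : u <+: x
  · right
    obtain ⟨r, hr⟩ := hpre
    refine ⟨r ++ u, ?_, ?_⟩
    · intro h
      have h1 := congrArg List.length h
      have h2 := congrArg List.length hr
      simp only [List.length_append, List.length_nil] at h1 h2
      omega
    · rw [secW_append, ← secW_append t u r, hr, hxt]
  · left
    refine mem_depthLE_of_secW (x.length - u.length) fun r hr => ?_
    rw [← secW_append]
    refine ht.finitary_of_ne hxt (by simp; omega) fun h => hpre ⟨r, h⟩

/-- After as many letters as there are states the path has met a cycle, so the restriction reached
is finitary or lies on a cycle. Uniform parameters for the two kinds exist because there are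
finitely many states. -/
theorem exists_secW_mem_basicSet {Sg : Set TreeAut} (hfin : Sg.Finite)
    (hsec : ∀ g ∈ Sg, ∀ x, sec g x ∈ Sg) (hbdd : ∀ g ∈ Sg, IsBdd g) :
    ∃ m d, 0 < m ∧ d ≤ m ∧ ∀ g ∈ Sg, ∀ v : List (Fin 2), Sg.ncard ≤ v.length →
      secW g v ∈ basicSet m d := by
  classical
  have hmem : ∀ g ∈ Sg, ∀ u, secW g u ∈ Sg := by
    intro g hg u
    induction u generalizing g with
    | nil => exact hg
    | cons x u ih => exact ih _ (hsec g hg x)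
  have h1 : ∀ g : TreeAut, ∃ d, (∃ d, g ∈ depthLE d) → g ∈ depthLE d := by
    intro g
    by_cases h : ∃ d, g ∈ depthLE d
    · obtain ⟨d, hd⟩ := h
      exact ⟨d, fun _ => hd⟩
    · exact ⟨0, fun h' => absurd h' h⟩
  choose dep hdep using h1
  have h2 : ∀ g : TreeAut, ∃ l, 0 < l ∧ ((∃ c : List (Fin 2), c ≠ [] ∧ secW g c = g) →
      ∃ c : List (Fin 2), c.length = l ∧ secW g c = g) := by
    intro g
    by_cases h : ∃ c : List (Fin 2), c ≠ [] ∧ secW g c = g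
    · obtain ⟨c, hc, hgc⟩ := h
      exact ⟨c.length, List.length_pos_iff.2 hc, fun _ => ⟨c, rfl, hgc⟩⟩
    · exact ⟨1, one_pos, fun h' => absurd h' h⟩
  choose per hper hper' using h2
  let F := hfin.toFinset
  let d := F.sup dep
  let P := ∏ g ∈ F, per g
  have hP : 0 < P := Finset.prod_pos fun g _ => hper g
  have hfd : ∀ g ∈ Sg, (∃ d, g ∈ depthLE d) → g ∈ depthLE d := fun g hg h =>
    depthLE_mono (Finset.le_sup (f := dep) (by simpa [F] using hg)) (hdep g h)
  -- The factor $P$ is a common multiple of the chosen cycle lengths, so recurrent states return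
  -- after exactly $m$ letters; the factor $d+1$ ensures $d\le m$.
  refine ⟨(d + 1) * P, d, by positivity, ?_, fun g hg v hv => ?_⟩
  · calc d ≤ d + 1 := by omega
      _ ≤ (d + 1) * P := Nat.le_mul_of_pos_right _ hP
  · obtain ⟨u, r, c, rfl, hc, huc⟩ := exists_secW_recurrent hfin hsec hg hv
    have htS := hmem g hg u
    rw [secW_append]
    have hhS := hmem _ htS r
    rcases (hbdd _ htS).finitary_or_recurrent hc huc r with h | h
    · exact Or.inr (hfd _ hhS h)
    · left
      obtain ⟨c', hc'l, hc'⟩ := hper' _ h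
      set t := secW (secW g u) r
      obtain ⟨q, hq⟩ : per t ∣ P := Finset.dvd_prod_of_mem per (by simpa [F] using hhS)
      refine ⟨powWord c' ((d + 1) * q), ?_, secW_powWord hc' _, fun w hw hwx => ?_⟩
      · rw [length_powWord, hc'l, hq]; ring
      · refine hfd _ (hmem _ hhS w) ((hbdd _ hhS).finitary_of_ne (secW_powWord hc' _) ?_ hwx)
        rw [hw, length_powWord, hc'l, hq]; ring

/-- The finite set `basicSet m d` is closed under inverses and restrictions at blocks of length $m$,
and absorbs products after two blocks. Induction over the generated group shows that every element
eventually restricts into it. -/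
theorem exists_finite_absorbing {Sg : Set TreeAut} (hfin : Sg.Finite)
    (hsec : ∀ g ∈ Sg, ∀ x, sec g x ∈ Sg) (hbdd : ∀ g ∈ Sg, IsBdd g) :
    ∃ M : Set TreeAut, M.Finite ∧ ∀ g ∈ Subgroup.closure Sg, ∃ n, ∀ v : List (Fin 2),
      n ≤ v.length → secW g v ∈ M := by
  obtain ⟨m, d, hm, hdm, hK⟩ := exists_secW_mem_basicSet hfin hsec hbdd
  have key : ∀ g ∈ Subgroup.closure Sg, ∃ j, ∀ v : List (Fin 2), v.length = m * j →
      secW g v ∈ basicSet m d := by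
    intro g hg
    induction hg using Subgroup.closure_induction with
    | mem g hg =>
      exact ⟨Sg.ncard, fun v hv => hK g hg v (by rw [hv]; exact Nat.le_mul_of_pos_left _ hm)⟩
    | one => exact ⟨0, fun v _ => by rw [secW_one]; exact Or.inr (one_mem_depthLE d)⟩
    | inv g _ ih =>
      obtain ⟨j, hj⟩ := ih
      exact ⟨j, fun v hv => by
        rw [secW_inv]; exact inv_mem_basicSet (hj _ (by simpa using hv))⟩
    | mul g h _ _ ihg ihh =>
      obtain ⟨j, hj⟩ := ihg
      obtain ⟨k, hk⟩ := ihh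
      -- The first $j+k$ blocks bring both factors into the basic set, and two further blocks bring
      -- in their product.
      refine ⟨j + k + 2, fun v hv => ?_⟩
      have hv' : v.length = m * j + m * k + (m + m) := by rw [hv]; ring
      have ht : (v.take (m * j + m * k)).length = m * j + m * k := by simp; omega
      have key : ∀ (g : TreeAut) (a b : ℕ), (∀ v : List (Fin 2), v.length = m * a →
          secW g v ∈ basicSet m d) → ∀ v : List (Fin 2), v.length = m * a + m * b →
          secW g v ∈ basicSet m d := by
        intro g a b hg v hv
        rw [← List.take_append_drop (m * a) v, secW_append]
        exact secW_mem_basicSet_mul (hg _ (by simp; omega)) (k := b) (by simp; omega)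
      rw [← List.take_append_drop (m * j + m * k) v, secW_append, secW_mul]
      refine secW_mul_mem_basicSet hdm (key g j k hj _ (by simpa using ht))
        (key h k j hk _ (by rw [ht]; ring)) (by simp; omega)
  -- So far only lengths divisible by $m$ are controlled; the words shorter than $m$ account for the
  -- remainder.
  refine ⟨Set.image2 secW (basicSet m d) {r | r.length < m}, ?_, fun g hg => ?_⟩
  · exact Set.Finite.image2 _ ((finite_circuits hm d).union (finite_depthLE d))
      (List.finite_length_lt _ m)
  · obtain ⟨j, hj⟩ := key g hg
    refine ⟨m * j, fun v hv => ?_⟩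
    have hq : m * j ≤ m * (v.length / m) :=
      Nat.mul_le_mul_left m ((Nat.le_div_iff_mul_le hm).2 (by rwa [mul_comm]))
    have hdiv := Nat.div_add_mod v.length m
    have hmod := Nat.mod_lt v.length hm
    refine ⟨secW g (v.take (m * (v.length / m))), ?_, v.drop (m * (v.length / m)), ?_, ?_⟩
    · rw [← List.take_append_drop (m * j) (v.take (m * (v.length / m))), secW_append]
      refine secW_mem_basicSet_mul (hj _ ?_) (k := v.length / m - j) ?_
      · simp; omega
      · rw [Nat.mul_sub]; simp; omega
    · simp; omega
    · rw [← secW_append, List.take_append_drop]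

/-! ### The nucleus of a contracting group -/

/-- The automorphisms occurring as restrictions at arbitrarily long words of some element. -/
def nucleus (G : Subgroup TreeAut) : Set TreeAut :=
  {h | ∃ g ∈ G, ∀ n, ∃ v : List (Fin 2), n ≤ v.length ∧ secW g v = h}

/-- A self-similar contracting group. -/
structure Contracting (G : Subgroup TreeAut) : Prop where
  sec_mem : ∀ g ∈ G, ∀ x, sec g x ∈ G
  absorbing : ∃ M : Set TreeAut, M.Finite ∧ ∀ g ∈ G, ∃ n, ∀ v : List (Fin 2),
    n ≤ v.length → secW g v ∈ M

variable {G : Subgroup TreeAut}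

theorem Contracting.secW_mem (hG : Contracting G) {g : TreeAut} (hg : g ∈ G)
    (v : List (Fin 2)) : secW g v ∈ G := by
  induction v generalizing g with
  | nil => exact hg
  | cons x v ih => exact ih (hG.sec_mem g hg x)

theorem Contracting.nucleus_subset (hG : Contracting G) : nucleus G ⊆ G := by
  rintro h ⟨g, hg, hv⟩
  obtain ⟨v, -, rfl⟩ := hv 0
  exact hG.secW_mem hg v

theorem nucleus_subset_of_absorbing {M : Set TreeAut}
    (hM : ∀ g ∈ G, ∃ n, ∀ v : List (Fin 2), n ≤ v.length → secW g v ∈ M) : nucleus G ⊆ M := by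
  rintro h ⟨g, hg, hv⟩
  obtain ⟨n, hn⟩ := hM g hg
  obtain ⟨v, hnv, rfl⟩ := hv n
  exact hn v hnv

theorem Contracting.finite_nucleus (hG : Contracting G) : (nucleus G).Finite := by
  obtain ⟨M, hM, h⟩ := hG.absorbing
  exact hM.subset (nucleus_subset_of_absorbing h)

/-- Each element outside the nucleus stops occurring among the restrictions of $g$ beyond some
length. Only the finitely many elements of $M$ matter, so one length serves for all. -/
theorem Contracting.exists_secW_mem_nucleus (hG : Contracting G) {g : TreeAut} (hg : g ∈ G) :
    ∃ n, ∀ v : List (Fin 2), n ≤ v.length → secW g v ∈ nucleus G := by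
  obtain ⟨M, hM, h⟩ := hG.absorbing
  obtain ⟨n, hn⟩ := h g hg
  have h1 : ∀ k : TreeAut, ∃ n, k ∉ nucleus G → ∀ v : List (Fin 2), n ≤ v.length →
      secW g v ≠ k := by
    intro k
    by_contra! hcon
    refine (hcon 0).1 ⟨g, hg, fun n => ?_⟩
    obtain ⟨-, v, hv⟩ := hcon n
    exact ⟨v, hv⟩
  choose N hN using h1
  refine ⟨max n (hM.toFinset.sup N), fun v hv => ?_⟩
  by_contra hcon
  have hvM := hn v ((le_max_left _ _).trans hv)
  refine hN (secW g v) hcon v (le_trans ?_ hv) rfl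
  exact le_max_of_le_right (Finset.le_sup (f := N) (by simpa using hvM))

theorem sec_mem_nucleus {h : TreeAut} (hh : h ∈ nucleus G) (x : Fin 2) : sec h x ∈ nucleus G := by
  obtain ⟨g, hg, hv⟩ := hh
  refine ⟨g, hg, fun n => ?_⟩
  obtain ⟨v, hn, rfl⟩ := hv n
  exact ⟨v ++ [x], by simp; omega, by rw [secW_append]; rfl⟩

theorem secW_mem_nucleus {h : TreeAut} (hh : h ∈ nucleus G) (v : List (Fin 2)) :
    secW h v ∈ nucleus G := by
  induction v generalizing h with
  | nil => exact hh
  | cons x v ih => exact ih (sec_mem_nucleus hh x)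

theorem one_mem_nucleus : 1 ∈ nucleus G :=
  ⟨1, G.one_mem, fun n => ⟨List.replicate n 0, by simp, secW_one _⟩⟩

theorem inv_mem_nucleus {h : TreeAut} (hh : h ∈ nucleus G) : h⁻¹ ∈ nucleus G := by
  obtain ⟨g, hg, hv⟩ := hh
  refine ⟨g⁻¹, G.inv_mem hg, fun n => ?_⟩
  obtain ⟨v, hn, rfl⟩ := hv n
  exact ⟨actW g v, by simpa using hn, secW_inv_actW g v⟩

/-- Cutting a long word $n$ letters before its end leaves a first part at which the restriction is
already in the nucleus. Thus nucleus elements can be lifted backwards through any number of levels.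
-/
theorem Contracting.exists_secW_eq (hG : Contracting G) {h : TreeAut} (hh : h ∈ nucleus G)
    (n : ℕ) : ∃ g ∈ nucleus G, ∃ v : List (Fin 2), v.length = n ∧ secW g v = h := by
  obtain ⟨g, hg, hv⟩ := hh
  obtain ⟨N, hN⟩ := hG.exists_secW_mem_nucleus hg
  obtain ⟨v, hn, rfl⟩ := hv (N + n)
  refine ⟨secW g (v.take (v.length - n)), hN _ (by simp; omega), v.drop (v.length - n), ?_, ?_⟩
  · simp; omega
  · rw [← secW_append, List.take_append_drop]

end TreeAut

/-! ### Transducers as tree automorphisms -/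

namespace Transducer

variable {S : Type*} (A : Transducer S (Fin 2))

theorem run_consSeq (s : S) (x : Fin 2) (u : BinSeq) (n : ℕ) :
    A.run s (consSeq x u) (n + 1) = A.run (A.trans s x) u n := by
  induction n with
  | zero => rfl
  | succ n ih => rw [run, ih]; rfl

theorem act_consSeq (s : S) (x : Fin 2) (u : BinSeq) :
    A.act s (consSeq x u) = consSeq (A.out s x) (A.act (A.trans s x) u) := by
  funext n
  cases n with
  | zero => rfl
  | succ n => rw [act, run_consSeq]; rfl

theorem run_congr (s : S) {n : ℕ} {u v : BinSeq} (h : ∀ i < n, u i = v i) :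
    A.run s u n = A.run s v n := by
  induction n with
  | zero => rfl
  | succ n ih => rw [run, run, ih fun i hi => h i (by omega), h n (by omega)]

theorem act_congr (s : S) {n : ℕ} {u v : BinSeq} (h : ∀ i < n, u i = v i) :
    ∀ i < n, A.act s u i = A.act s v i := fun i hi => by
  rw [act, act, A.run_congr s fun j hj => h j (by omega), h i hi]

/-- The tree automorphism defined by a state. -/
def aut (s : S) : TreeAut where
  val := A.perm s
  property n u v := ⟨A.act_congr s, fun h => by
    have := A.inverse.act_congr s (u := A.act s u) (v := A.act s v) h
    rwa [act_inverse_act, act_inverse_act] at this⟩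

theorem root_sec_aut (s : S) (x : Fin 2) :
    TreeAut.root (A.aut s) x = A.out s x ∧ TreeAut.sec (A.aut s) x = A.aut (A.trans s x) :=
  TreeAut.root_sec_unique fun u => A.act_consSeq s x u

theorem secW_aut (s : S) (v : List (Fin 2)) :
    TreeAut.secW (A.aut s) v = A.aut (v.foldl A.trans s) := by
  induction v generalizing s with
  | nil => rfl
  | cons x v ih => rw [TreeAut.secW_cons, (A.root_sec_aut s x).2, ih]; rfl

/-- The group generated by the states, as a group of tree automorphisms. -/
def treeGroup : Subgroup TreeAut := Subgroup.closure (Set.range A.aut)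

theorem map_treeGroup : A.treeGroup.map treeAut.subtype = A.group := by
  rw [treeGroup, MonoidHom.map_closure, ← Set.range_comp]
  rfl

theorem mem_group_iff {g : Equiv.Perm BinSeq} :
    g ∈ A.group ↔ ∃ h ∈ A.treeGroup, (h : Equiv.Perm BinSeq) = g := by
  rw [← map_treeGroup]; rfl

variable {A}

/-- An active word, together with the states along it, is a path avoiding trivial states, since a
trivial state never becomes nontrivial again. The input letters recorded in the path make the
correspondence injective. -/
theorem IsBounded.isBdd (hA : A.IsBounded) (s : S) : TreeAut.IsBdd (A.aut s) := by
  obtain ⟨hS, C, hC⟩ := hA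
  refine ⟨C, fun n => le_trans ?_ (hC n)⟩
  refine Set.ncard_le_ncard_of_injOn
    (fun v => (fun i => (v.take i).foldl A.trans s, fun i => v.getD i 0)) ?_ ?_ (Set.toFinite _)
  · rintro v ⟨hv, hne⟩
    refine ⟨fun i h1 => hne ?_, fun i => ?_⟩
    · rw [← List.take_append_drop i v, TreeAut.secW_append, secW_aut,
        show A.aut ((v.take i).foldl A.trans s) = 1 from Subtype.ext h1, TreeAut.secW_one]
    · have hi : (i : ℕ) < v.length := by omega
      have h2 : v.take (i + 1) = v.take i ++ [v[i]] := (List.take_concat_get' v i hi).symm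
      change (v.take (i + 1)).foldl A.trans s = _
      rw [h2, List.foldl_append]
      simp [hi]
  · rintro v ⟨hv, -⟩ u ⟨hu, -⟩ h
    refine List.ext_getElem (hv.trans hu.symm) fun i hi hi' => ?_
    have := congrFun (congrArg Prod.snd h) ⟨i, hv ▸ hi⟩
    simpa [hi, hi'] using this

theorem IsBounded.isBdd_of_mem (hA : A.IsBounded) {g : TreeAut} (hg : g ∈ A.treeGroup) :
    TreeAut.IsBdd g := by
  induction hg using Subgroup.closure_induction with
  | mem g hg => obtain ⟨s, rfl⟩ := hg; exact hA.isBdd s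
  | one => exact TreeAut.IsBdd.one
  | mul g h _ _ ihg ihh => exact ihg.mul ihh
  | inv g _ ih => exact ih.inv

theorem IsBounded.contracting (hA : A.IsBounded) : TreeAut.Contracting A.treeGroup where
  sec_mem g hg := by
    induction hg using Subgroup.closure_induction with
    | mem g hg =>
      obtain ⟨s, rfl⟩ := hg
      intro x
      rw [(A.root_sec_aut s x).2]
      exact Subgroup.subset_closure ⟨_, rfl⟩
    | one => intro x; rw [TreeAut.sec_one]; exact one_mem _
    | mul g h _ _ ihg ihh => intro x; rw [TreeAut.sec_mul]; exact mul_mem (ihg _) (ihh _)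
    | inv g _ ih =>
      intro x
      obtain ⟨y, rfl⟩ := (TreeAut.root g).surjective x
      rw [TreeAut.sec_inv_root]
      exact inv_mem (ih y)
  absorbing := by
    have := hA.1
    refine TreeAut.exists_finite_absorbing (Set.finite_range _) ?_ ?_
    · rintro _ ⟨s, rfl⟩ x
      exact ⟨_, (A.root_sec_aut s x).2.symm⟩
    · rintro _ ⟨s, rfl⟩
      exact hA.isBdd s

end Transducer

/-! ### Uniqueness of the nucleus, and ends as pieces of orbits -/

namespace TreeAut

/-- A restriction found at arbitrarily long words of one element has to belong to every absorbing
set; this is the minimality. -/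
theorem isNucleus_map (G : Subgroup TreeAut) (hG : Contracting G) :
    IsNucleus (G.map treeAut.subtype) (treeAut.subtype '' nucleus G) := by
  constructor
  · refine ⟨hG.finite_nucleus.image _, Set.image_mono hG.nucleus_subset, ?_⟩
    rintro _ ⟨g, hg, rfl⟩
    obtain ⟨n, hn⟩ := hG.exists_secW_mem_nucleus hg
    exact ⟨n, fun v hv => ⟨actW g v, _, ⟨_, hn v hv, rfl⟩, (hasRestriction_iff g v _ _).2 ⟨rfl, rfl⟩⟩⟩
  · rintro M ⟨-, -, hM⟩ _ ⟨h, ⟨g, hg, hv⟩, rfl⟩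
    obtain ⟨n, hn⟩ := hM g.1 ⟨g, hg, rfl⟩
    obtain ⟨v, hnv, rfl⟩ := hv n
    obtain ⟨u, k, hk, hr⟩ := hn v hnv
    rw [((hasRestriction_iff g v _ _).1 hr).2.symm] at hk
    exact hk

theorem isNucleus_iff {G : Subgroup TreeAut} (hG : Contracting G) {N : Set (Equiv.Perm BinSeq)} :
    IsNucleus (G.map treeAut.subtype) N ↔ N = treeAut.subtype '' nucleus G :=
  ⟨fun h => h.unique (isNucleus_map G hG), fun h => h ▸ isNucleus_map G hG⟩

/-- The orbit of a sequence under a group of tree automorphisms. -/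
def orbitSet (G : Subgroup TreeAut) (w : BinSeq) : Set BinSeq := {u | ∃ g ∈ G, g • w = u}

theorem smul_mem_orbitSet {G : Subgroup TreeAut} {w u : BinSeq} (hu : u ∈ orbitSet G w)
    {g : TreeAut} (hg : g ∈ G) : g • u ∈ orbitSet G w := by
  obtain ⟨h, hh, rfl⟩ := hu
  exact ⟨g * h, G.mul_mem hg hh, mul_smul g h w⟩

/-- Sets moved only up to finitely many points by the elements of a group. -/
def AlmostInvariant (G : Subgroup TreeAut) (U : Set BinSeq) : Prop :=
  ∀ g ∈ G, {x ∈ U | g • x ∉ U}.Finite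

theorem finite_escape_mul {g h : TreeAut} {U : Set BinSeq} (hg : {x ∈ U | g • x ∉ U}.Finite)
    (hh : {x ∈ U | h • x ∉ U}.Finite) : {x ∈ U | (g * h) • x ∉ U}.Finite := by
  refine (hh.union (hg.preimage (MulAction.injective h).injOn)).subset ?_
  rintro x ⟨hx, hghx⟩
  by_cases hhx : h • x ∈ U
  · exact Or.inr ⟨hhx, by rwa [mul_smul] at hghx⟩
  · exact Or.inl ⟨hx, hhx⟩

/-- The orbit of `w` contains `k` disjoint infinite almost invariant sets. -/
def HasPieces (G : Subgroup TreeAut) (w : BinSeq) (k : ℕ) : Prop :=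
  ∃ U : Fin k → Set BinSeq, Pairwise (Function.onFun Disjoint U) ∧
    ∀ i, U i ⊆ orbitSet G w ∧ (U i).Infinite ∧ AlmostInvariant G (U i)

end TreeAut

namespace Transducer

open TreeAut

variable {S : Type*} {A : Transducer S (Fin 2)}

theorem mem_orbit_iff {w u : BinSeq} :
    u ∈ MulAction.orbit A.group w ↔ u ∈ orbitSet A.treeGroup w := by
  constructor
  · rintro ⟨⟨g, hg⟩, rfl⟩
    obtain ⟨h, hh, rfl⟩ := A.mem_group_iff.1 hg
    exact ⟨h, hh, rfl⟩
  · rintro ⟨h, hh, rfl⟩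
    exact ⟨⟨h.1, A.mem_group_iff.2 ⟨h, hh, rfl⟩⟩, rfl⟩

theorem schreierGraph_adj {w : BinSeq} {u v : MulAction.orbit A.group w} :
    (A.schreierGraph w).Adj u v ↔ u ≠ v ∧ ∃ s, A.aut s • (u : BinSeq) = v ∨
      (A.aut s)⁻¹ • (u : BinSeq) = v := by
  rw [schreierGraph, SimpleGraph.fromRel_adj]
  refine and_congr_right fun _ => ⟨?_, ?_⟩
  · rintro (⟨s, hs⟩ | ⟨s, hs⟩)
    · exact ⟨s, Or.inl hs⟩
    · exact ⟨s, Or.inr (inv_smul_eq_iff.2 hs.symm)⟩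
  · rintro ⟨s, hs | hs⟩
    · exact Or.inl ⟨s, hs⟩
    · exact Or.inr ⟨s, (inv_smul_eq_iff.1 hs).symm⟩

theorem aut_mem_treeGroup (A : Transducer S (Fin 2)) (s : S) : A.aut s ∈ A.treeGroup :=
  Subgroup.subset_closure ⟨s, rfl⟩

theorem preconnected_schreierGraph (w : BinSeq) : (A.schreierGraph w).Preconnected := by
  have key : ∀ g ∈ A.treeGroup, ∀ u v : MulAction.orbit A.group w, g • (u : BinSeq) = v →
      (A.schreierGraph w).Reachable u v := by
    intro g hg
    induction hg using Subgroup.closure_induction with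
    | mem g hg =>
      obtain ⟨s, rfl⟩ := hg
      intro u v h
      by_cases huv : u = v
      · rw [huv]
      · exact (schreierGraph_adj.2 ⟨huv, s, Or.inl h⟩).reachable
    | one =>
      intro u v h
      rw [one_smul] at h
      rw [Subtype.ext h]
    | mul g h hg hh ihg ihh =>
      intro u v huv
      let m : MulAction.orbit A.group w :=
        ⟨h • (u : BinSeq), mem_orbit_iff.2 (smul_mem_orbitSet (mem_orbit_iff.1 u.2) hh)⟩
      exact (ihh u m rfl).trans (ihg m v (by rw [← huv, mul_smul]))
    | inv g _ ih =>
      intro u v huv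
      exact (ih v u (by rw [← huv, smul_inv_smul])).symm
  intro u v
  obtain ⟨g, hg, hgu⟩ := mem_orbit_iff.1 u.2
  obtain ⟨h, hh, hhv⟩ := mem_orbit_iff.1 v.2
  refine key (h * g⁻¹) (mul_mem hh (inv_mem hg)) u v ?_
  rw [mul_smul, ← hgu, inv_smul_smul, hhv]

theorem finite_neighborSet [Finite S] (w : BinSeq) (u : MulAction.orbit A.group w) :
    ((A.schreierGraph w).neighborSet u).Finite := by
  refine Set.Finite.of_finite_image (f := Subtype.val) ?_ Subtype.val_injective.injOn
  refine ((Set.finite_range fun s => A.aut s • (u : BinSeq)).union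
    (Set.finite_range fun s => (A.aut s)⁻¹ • (u : BinSeq))).subset ?_
  rintro _ ⟨v, hv, rfl⟩
  obtain ⟨-, s, hs | hs⟩ := schreierGraph_adj.1 hv
  · exact Or.inl ⟨s, hs⟩
  · exact Or.inr ⟨s, hs⟩

theorem almostInvariant_of_generators [Finite S] {U : Set BinSeq}
    (h : ∀ s, {x ∈ U | A.aut s • x ∉ U}.Finite) (h' : ∀ s, {x ∈ U | (A.aut s)⁻¹ • x ∉ U}.Finite) :
    AlmostInvariant A.treeGroup U := by
  have key : ∀ g ∈ A.treeGroup, {x ∈ U | g • x ∉ U}.Finite ∧ {x ∈ U | g⁻¹ • x ∉ U}.Finite := by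
    intro g hg
    induction hg using Subgroup.closure_induction with
    | mem g hg => obtain ⟨s, rfl⟩ := hg; exact ⟨h s, h' s⟩
    | one =>
      have : {x ∈ U | (1 : TreeAut) • x ∉ U} = ∅ :=
        Set.eq_empty_of_forall_notMem fun x hx => hx.2 (by rw [one_smul]; exact hx.1)
      rw [inv_one, this]
      exact ⟨Set.finite_empty, Set.finite_empty⟩
    | mul g h _ _ ihg ihh =>
      rw [mul_inv_rev]
      exact ⟨finite_escape_mul ihg.1 ihh.1, finite_escape_mul ihh.2 ihg.2⟩
    | inv g _ ih => rw [inv_inv]; exact ⟨ih.2, ih.1⟩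
  exact fun g hg => (key g hg).1

/-- Boundary points are the points that one of the finitely many generators or their inverses moves
out of the set. The finite exceptions then propagate to products. -/
theorem finite_innerBoundary_iff [Finite S] {w : BinSeq} (U : Set (MulAction.orbit A.group w)) :
    ((A.schreierGraph w).innerBoundary U).Finite ↔
      AlmostInvariant A.treeGroup (Subtype.val '' U) := by
  constructor
  · intro h
    have key : ∀ g ∈ A.treeGroup, (∀ u v : MulAction.orbit A.group w, u ≠ v →
        g • (u : BinSeq) = v → (A.schreierGraph w).Adj u v) →
        {x ∈ Subtype.val '' U | g • x ∉ Subtype.val '' U}.Finite := by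
      intro g hg hadj
      refine (h.image Subtype.val).subset ?_
      rintro _ ⟨⟨u, hu, rfl⟩, hgu⟩
      let v : MulAction.orbit A.group w :=
        ⟨g • (u : BinSeq), mem_orbit_iff.2 (smul_mem_orbitSet (mem_orbit_iff.1 u.2) hg)⟩
      have hv : v ∉ U := fun hv => hgu ⟨v, hv, rfl⟩
      exact ⟨u, ⟨hu, v, hv, hadj u v (fun huv => hv (huv ▸ hu)) rfl⟩, rfl⟩
    refine almostInvariant_of_generators (fun s => ?_) fun s => ?_
    · exact key _ (A.aut_mem_treeGroup s) fun u v hne huv =>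
        schreierGraph_adj.2 ⟨hne, s, Or.inl huv⟩
    · exact key _ (inv_mem (A.aut_mem_treeGroup s)) fun u v hne huv =>
        schreierGraph_adj.2 ⟨hne, s, Or.inr huv⟩
  · intro h
    have h1 : (⋃ s, {x ∈ Subtype.val '' U | A.aut s • x ∉ Subtype.val '' U} ∪
        {x ∈ Subtype.val '' U | (A.aut s)⁻¹ • x ∉ Subtype.val '' U}).Finite :=
      Set.finite_iUnion fun s => (h _ (A.aut_mem_treeGroup s)).union
        (h _ (inv_mem (A.aut_mem_treeGroup s)))
    refine Set.Finite.of_finite_image (f := Subtype.val) (h1.subset ?_)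
      Subtype.val_injective.injOn
    rintro _ ⟨u, ⟨hu, v, hv, huv⟩, rfl⟩
    obtain ⟨-, s, hs | hs⟩ := schreierGraph_adj.1 huv
    · refine Set.mem_iUnion.2 ⟨s, Or.inl ⟨⟨u, hu, rfl⟩, ?_⟩⟩
      rw [hs]
      rintro ⟨v', hv', he⟩
      exact hv (Subtype.ext he ▸ hv')
    · refine Set.mem_iUnion.2 ⟨s, Or.inr ⟨⟨u, hu, rfl⟩, ?_⟩⟩
      rw [hs]
      rintro ⟨v', hv', he⟩
      exact hv (Subtype.ext he ▸ hv')

theorem exists_injective_end_iff [Finite S] (w : BinSeq) (k : ℕ) :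
    (∃ e : Fin k → (A.schreierGraph w).end, Function.Injective e) ↔
      HasPieces A.treeGroup w k := by
  have : (A.schreierGraph w).LocallyFinite := fun u => (finite_neighborSet w u).fintype
  have : Fact (A.schreierGraph w).Preconnected := ⟨preconnected_schreierGraph w⟩
  rw [SimpleGraph.exists_injective_end_iff]
  constructor
  · rintro ⟨U, hd, hU⟩
    refine ⟨fun i => Subtype.val '' U i, fun i j hij =>
      (Set.disjoint_image_iff Subtype.val_injective).2 (hd hij), fun i => ⟨?_, ?_, ?_⟩⟩
    · rintro _ ⟨u, -, rfl⟩
      exact mem_orbit_iff.1 u.2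
    · exact (hU i).1.image Subtype.val_injective.injOn
    · exact (finite_innerBoundary_iff _).1 (hU i).2
  · rintro ⟨U, hd, hU⟩
    have himg : ∀ i, Subtype.val '' (Subtype.val ⁻¹' U i : Set (MulAction.orbit A.group w)) = U i :=
      fun i => by
        rw [Subtype.image_preimage_coe, Set.inter_eq_right]
        exact fun x hx => mem_orbit_iff.2 ((hU i).1 hx)
    refine ⟨fun i => Subtype.val ⁻¹' U i, fun i j hij => (hd hij).preimage _, fun i => ⟨?_, ?_⟩⟩
    · have := (hU i).2.1
      rw [← himg i] at this
      exact Set.Infinite.of_image _ this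
    · rw [finite_innerBoundary_iff, himg]
      exact (hU i).2.2

theorem hasTwoEnds_iff [Finite S] (w : BinSeq) :
    HasTwoEnds (A.schreierGraph w) ↔
      HasPieces A.treeGroup w 2 ∧ ¬ HasPieces A.treeGroup w 3 := by
  rw [HasTwoEnds, Set.ncard_eq_iff_exists_injective two_pos, exists_injective_end_iff,
    exists_injective_end_iff]

end Transducer

/-! ### Nuclei in which each letter determines the next: adding machines -/

theorem perm_fin_two_apply {π : Equiv.Perm (Fin 2)} (h : π ≠ 1) (x : Fin 2) : π x = x + 1 := by
  revert π x; decide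

theorem perm_fin_two_eq {π τ : Equiv.Perm (Fin 2)} (h : π ≠ 1) (h' : τ ≠ 1) : π = τ := by
  revert π τ; decide

theorem fin_two_eq_add_one {x y : Fin 2} (h : y ≠ x) : y = x + 1 := by
  revert x y; decide

theorem fin_two_add_one_ne (x : Fin 2) : x + 1 ≠ x := by
  revert x; decide

theorem fin_two_add_one_add_one (x : Fin 2) : x + 1 + 1 = x := by
  revert x; decide

namespace TreeAut

variable {G : Subgroup TreeAut}

/-- The restrictions at the letter `x` of the elements of the nucleus. -/
def nucleusAt (G : Subgroup TreeAut) (x : Fin 2) : Set TreeAut := (fun g => sec g x) '' nucleus G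

theorem nucleusAt_subset (x : Fin 2) : nucleusAt G x ⊆ nucleus G := by
  rintro _ ⟨g, hg, rfl⟩
  exact sec_mem_nucleus hg x

theorem one_mem_nucleusAt (x : Fin 2) : 1 ∈ nucleusAt G x := ⟨1, one_mem_nucleus, sec_one x⟩

theorem Contracting.exists_mem_nucleusAt (hG : Contracting G) {h : TreeAut}
    (hh : h ∈ nucleus G) : ∃ x, h ∈ nucleusAt G x := by
  obtain ⟨g, hg, v, hv, rfl⟩ := hG.exists_secW_eq hh 1
  obtain ⟨x, rfl⟩ := List.length_eq_one_iff.1 hv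
  exact ⟨x, g, hg, rfl⟩


/-- Only the pairs `x, ν x` of consecutive letters are read along paths in the nucleus. -/
structure FollowsLetterMap (G : Subgroup TreeAut) (ν : Fin 2 → Fin 2) : Prop where
  equivariant : ∀ x, ν (x + 1) = ν x + 1
  sec_sec : ∀ g ∈ nucleus G, ∀ x y, y ≠ ν x → sec (sec g x) y = 1

section FollowsLetterMap

variable {ν : Fin 2 → Fin 2}

theorem FollowsLetterMap.sec_eq_one (hν : FollowsLetterMap G ν) {x y : Fin 2} {h : TreeAut}
    (hh : h ∈ nucleusAt G x) (hy : y ≠ ν x) : sec h y = 1 := by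
  obtain ⟨g, hg, rfl⟩ := hh
  exact hν.sec_sec g hg x y hy

theorem FollowsLetterMap.apply_apply (hν : FollowsLetterMap G ν) (x : Fin 2) : ν (ν x) = x := by
  have key : ∀ ν : Fin 2 → Fin 2, (∀ x, ν (x + 1) = ν x + 1) → ∀ x, ν (ν x) = x := by decide
  exact key ν hν.equivariant x

theorem FollowsLetterMap.apply_add_one_ne (_ : FollowsLetterMap G ν) (x : Fin 2) :
    ν x + 1 ≠ ν x := fin_two_add_one_ne _

/-- Every nucleus element is a restriction at some letter. If that letter is not $x$, its
restriction at $\nu x$ is trivial and is also obtained from 1. -/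
theorem FollowsLetterMap.image_nucleusAt (hν : FollowsLetterMap G ν) (hG : Contracting G)
    (x : Fin 2) : (fun h => sec h (ν x)) '' nucleusAt G x = nucleusAt G (ν x) := by
  apply Set.Subset.antisymm
  · rintro _ ⟨h, hh, rfl⟩
    exact ⟨h, nucleusAt_subset x hh, rfl⟩
  · rintro _ ⟨g, hg, rfl⟩
    obtain ⟨y, hy⟩ := hG.exists_mem_nucleusAt hg
    by_cases hyx : y = x
    · exact ⟨g, hyx ▸ hy, rfl⟩
    · refine ⟨1, one_mem_nucleusAt x, ?_⟩
      obtain rfl := fin_two_eq_add_one hyx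
      have : sec g (ν x) = 1 := hν.sec_eq_one hy (by rw [hν.equivariant]; exact (hν.apply_add_one_ne x).symm)
      simp [this]

theorem Contracting.finite_nucleusAt (hG : Contracting G) (x : Fin 2) : (nucleusAt G x).Finite :=
  hG.finite_nucleus.image _

/-- Restriction maps the set at $x$ onto the set at $\nu x$, and that one onto the set at $\nu\nu
x=x$. Both are finite, so the surjections are bijections. -/
theorem FollowsLetterMap.injOn (hν : FollowsLetterMap G ν) (hG : Contracting G) (x : Fin 2) :
    Set.InjOn (fun h => sec h (ν x)) (nucleusAt G x) := by
  have hle : ∀ x, (nucleusAt G (ν x)).ncard ≤ (nucleusAt G x).ncard := fun x => by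
    rw [← hν.image_nucleusAt hG x]
    exact Set.ncard_image_le (hG.finite_nucleusAt x)
  refine Set.injOn_of_ncard_image_eq ?_ (hG.finite_nucleusAt x)
  rw [hν.image_nucleusAt hG]
  refine le_antisymm (hle x) ?_
  have := hle (ν x)
  rwa [hν.apply_apply] at this

theorem FollowsLetterMap.sec_ne_one (hν : FollowsLetterMap G ν) (hG : Contracting G) {x : Fin 2}
    {h : TreeAut} (hh : h ∈ nucleusAt G x) (h1 : h ≠ 1) : sec h (ν x) ≠ 1 := fun he =>
  h1 (hν.injOn hG x hh (one_mem_nucleusAt x) (by simpa using he))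

/-- Were $h^{-1}$ a restriction at $x$ too, it would be trivial at $\nu x+1=h(\nu x)$; but there it
restricts to the inverse of the nontrivial $h|_{\nu x}$. -/
theorem FollowsLetterMap.inv_mem (hν : FollowsLetterMap G ν) (hG : Contracting G) {x : Fin 2}
    {h : TreeAut} (hh : h ∈ nucleusAt G x) (hr : root h ≠ 1) : h⁻¹ ∈ nucleusAt G (x + 1) := by
  obtain ⟨y, hy⟩ := hG.exists_mem_nucleusAt (inv_mem_nucleus (nucleusAt_subset x hh))
  by_cases hyx : y = x
  · subst hyx
    exfalso
    have h1 := hν.sec_eq_one hy (hν.apply_add_one_ne y)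
    rw [← perm_fin_two_apply hr, sec_inv_root, inv_eq_one] at h1
    exact hν.sec_ne_one hG hh (fun he => hr (by rw [he, root_one])) h1
  · rwa [fin_two_eq_add_one hyx] at hy

/-- Let $k=h|_{\nu x}$. As $h$ switches letters, $k^{-1}$ is a restriction of $h^{-1}$ at $\nu x+1$
and so is trivial at $\nu\nu x$. If $k$ fixed letters, then $k|_{\nu\nu x}$ would be trivial,
contrary to injectivity. -/
theorem FollowsLetterMap.root_sec_ne_one (hν : FollowsLetterMap G ν) (hG : Contracting G)
    {x : Fin 2} {h : TreeAut} (hh : h ∈ nucleusAt G x) (hr : root h ≠ 1) :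
    root (sec h (ν x)) ≠ 1 := by
  intro hk
  have hh1 : h ≠ 1 := fun he => hr (by rw [he, root_one])
  have hkx : sec h (ν x) ∈ nucleusAt G (ν x) := ⟨h, nucleusAt_subset x hh, rfl⟩
  have hk1 := hν.sec_ne_one hG hh hh1
  have hkk := hν.sec_ne_one hG hkx hk1
  have hinv : (sec h (ν x))⁻¹ ∈ nucleusAt G (ν x + 1) := by
    refine ⟨h⁻¹, inv_mem_nucleus (nucleusAt_subset x hh), ?_⟩
    change sec h⁻¹ (ν x + 1) = _
    rw [← perm_fin_two_apply hr, sec_inv_root]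
  have h2 := hν.sec_eq_one hinv (y := ν (ν x)) (by
    rw [hν.equivariant]; exact (fin_two_add_one_ne _).symm)
  have h3 := sec_inv_root (sec h (ν x)) (ν (ν x))
  rw [hk, Equiv.Perm.one_apply, h2] at h3
  exact hkk (inv_eq_one.1 h3.symm)

/-- Restriction injects the switching elements at $x$ into those at $\nu x$ and conversely, so by
counting it is onto them. A nonswitching element cannot share an image with a switching one. -/
theorem FollowsLetterMap.root_sec_eq_one (hν : FollowsLetterMap G ν) (hG : Contracting G)
    {x : Fin 2} {h : TreeAut} (hh : h ∈ nucleusAt G x) (hr : root h = 1) :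
    root (sec h (ν x)) = 1 := by
  by_contra hcon
  let Sw : Fin 2 → Set TreeAut := fun x => {h ∈ nucleusAt G x | root h ≠ 1}
  have hfin : ∀ x, (Sw x).Finite := fun x => (hG.finite_nucleusAt x).subset fun _ h => h.1
  have hinj : ∀ x, Set.InjOn (fun h => sec h (ν x)) (Sw x) := fun x =>
    (hν.injOn hG x).mono fun _ h => h.1
  have hsub : ∀ x, (fun h => sec h (ν x)) '' Sw x ⊆ Sw (ν x) := by
    rintro x _ ⟨h, ⟨hh, hr⟩, rfl⟩
    exact ⟨⟨h, nucleusAt_subset x hh, rfl⟩, hν.root_sec_ne_one hG hh hr⟩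
  have hle : ∀ x, (Sw x).ncard ≤ (Sw (ν x)).ncard := fun x => by
    rw [← (hinj x).ncard_image]
    exact Set.ncard_le_ncard (hsub x) (hfin _)
  have heq := Set.eq_of_subset_of_ncard_le (hsub x) (by
    rw [(hinj x).ncard_image]
    have := hle (ν x)
    rwa [hν.apply_apply] at this) (hfin _)
  have hmem : sec h (ν x) ∈ Sw (ν x) := ⟨⟨h, nucleusAt_subset x hh, rfl⟩, hcon⟩
  rw [← heq] at hmem
  obtain ⟨k, ⟨hk, hkr⟩, hkh⟩ := hmem
  exact hkr (hν.injOn hG x hk hh hkh ▸ hr)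

/-- An element that does not switch at the root does not switch anywhere along the only path on
which its restrictions are nontrivial. -/
theorem FollowsLetterMap.root_ne_one (hν : FollowsLetterMap G ν) (hG : Contracting G)
    {x : Fin 2} {h : TreeAut} (hh : h ∈ nucleusAt G x) (h1 : h ≠ 1) : root h ≠ 1 := by
  intro hr
  refine h1 (ext_of_actW fun v => ?_)
  rw [actW_one]
  induction v generalizing x h with
  | nil => rfl
  | cons y v ih =>
    rw [actW_cons, hr, Equiv.Perm.one_apply]
    by_cases hy : y = ν x
    · subst hy
      rw [ih ⟨h, nucleusAt_subset x hh, rfl⟩ (hν.sec_ne_one hG hh h1)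
        (hν.root_sec_eq_one hG hh hr)]
    · rw [hν.sec_eq_one hh hy, actW_one]

/-- Both elements switch at every step of the same forced path and are trivial off it. -/
theorem FollowsLetterMap.eq_of_ne_one (hν : FollowsLetterMap G ν) (hG : Contracting G)
    {x : Fin 2} {h k : TreeAut} (hh : h ∈ nucleusAt G x) (h1 : h ≠ 1) (hk : k ∈ nucleusAt G x)
    (k1 : k ≠ 1) : h = k := by
  refine ext_of_actW fun v => ?_
  induction v generalizing x h k with
  | nil => rfl
  | cons y v ih =>
    rw [actW_cons, actW_cons,
      perm_fin_two_eq (hν.root_ne_one hG hh h1) (hν.root_ne_one hG hk k1)]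
    by_cases hy : y = ν x
    · subst hy
      rw [ih ⟨h, nucleusAt_subset x hh, rfl⟩ (hν.sec_ne_one hG hh h1)
        ⟨k, nucleusAt_subset x hk, rfl⟩ (hν.sec_ne_one hG hk k1)]
    · rw [hν.sec_eq_one hh hy, hν.sec_eq_one hk hy]

theorem FollowsLetterMap.exists_nucleus_eq (hν : FollowsLetterMap G ν) (hG : Contracting G)
    (hne : ∃ h ∈ nucleus G, h ≠ 1) : ∃ x, ∃ a ∈ nucleusAt G x, a ≠ 1 ∧
      nucleus G = {a, a⁻¹, 1} := by
  obtain ⟨a, ha, ha1⟩ := hne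
  obtain ⟨x, hx⟩ := hG.exists_mem_nucleusAt ha
  have hinv := hν.inv_mem hG hx (hν.root_ne_one hG hx ha1)
  refine ⟨x, a, hx, ha1, Set.Subset.antisymm (fun k hk => ?_) ?_⟩
  · by_cases k1 : k = 1
    · simp [k1]
    · obtain ⟨y, hy⟩ := hG.exists_mem_nucleusAt hk
      by_cases hyx : y = x
      · subst hyx
        exact Or.inl (hν.eq_of_ne_one hG hy k1 hx ha1)
      · obtain rfl := fin_two_eq_add_one hyx
        exact Or.inr (Or.inl (hν.eq_of_ne_one hG hy k1 hinv (by simpa using ha1)))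
  · rintro k (rfl | rfl | rfl)
    · exact ha
    · exact inv_mem_nucleus ha
    · exact one_mem_nucleus

/-- The action on words of length two of the adding machine over the alphabet of such words. -/
def twoLetterCycle (x : Fin 2) (p : Fin 2 × Fin 2) : Fin 2 × Fin 2 :=
  (p.1 + 1, if p.1 = x + 1 then p.2 + 1 else p.2)

theorem twoLetterCycle_transitive (x : Fin 2) (p q : Fin 2 × Fin 2) :
    ∃ k : Fin 4, (twoLetterCycle x)^[k] p = q := by
  revert x p q; decide

theorem actW_pow (a : TreeAut) (k : ℕ) (v : List (Fin 2)) : actW (a ^ k) v = (actW a)^[k] v := by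
  induction k generalizing v with
  | zero => simp
  | succ k ih => rw [pow_succ, actW_mul, ih, Function.iterate_succ_apply]

theorem exists_hasRestriction_zpow {a : TreeAut} {v u : List (Fin 2)} {k : ℕ}
    (h : (actW a)^[k] v = u) : ∃ (k : ℤ) (h : Equiv.Perm BinSeq),
      HasRestriction (a.1 ^ k) v u h :=
  ⟨k, _, (hasRestriction_iff (a ^ k) v u _).2 ⟨by rw [actW_pow, h], rfl⟩⟩

/-- The restriction of $a$ at $\nu x$ is the only nontrivial candidate. If $\nu x=x$ it is $a$, and
one letter suffices; otherwise it is $a^{-1}$, and two letters are needed to return to $a$. -/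
theorem FollowsLetterMap.isAddingMachine (hν : FollowsLetterMap G ν) (hG : Contracting G)
    {x : Fin 2} {a : TreeAut} (ha : a ∈ nucleusAt G x) (ha1 : a ≠ 1) : IsAddingMachine a.1 := by
  have hr : ∀ y, root a y = y + 1 := perm_fin_two_apply (hν.root_ne_one hG ha ha1)
  have hs : ∀ y, y ≠ ν x → sec a y = 1 := fun y hy => hν.sec_eq_one ha hy
  have hsN : sec a (ν x) ∈ nucleusAt G (ν x) := ⟨a, nucleusAt_subset x ha, rfl⟩
  have hs1 := hν.sec_ne_one hG ha ha1
  by_cases hx : ν x = x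
  · rw [hx] at hs hsN hs1
    have hsa : sec a x = a := hν.eq_of_ne_one hG hsN hs1 ha ha1
    refine ⟨1, one_pos, ?_, [x], [x + 1], rfl, ?_, ?_, ?_⟩
    · intro v u hv hu
      obtain ⟨y, rfl⟩ := List.length_eq_one_iff.1 hv
      obtain ⟨z, rfl⟩ := List.length_eq_one_iff.1 hu
      by_cases hzy : z = y
      · exact exists_hasRestriction_zpow (k := 0) (by rw [hzy]; rfl)
      · exact exists_hasRestriction_zpow (k := 1) (by simp [hr, fin_two_eq_add_one hzy])
    · simp
    · exact (hasRestriction_iff a _ _ _).2 ⟨by simp [hr], by simp [hsa]⟩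
    · intro v hv hvx
      obtain ⟨y, rfl⟩ := List.length_eq_one_iff.1 hv
      exact ⟨_, (hasRestriction_iff a _ _ _).2 ⟨rfl, by simp [hs y (by simpa using hvx)]⟩⟩
  · replace hx : ν x = x + 1 := fin_two_eq_add_one hx
    rw [hx] at hs hsN hs1
    have hsa : sec a (x + 1) = a⁻¹ := hν.eq_of_ne_one hG hsN hs1
      (hν.inv_mem hG ha (hν.root_ne_one hG ha ha1)) (by simpa using ha1)
    have hsx : sec a x = 1 := hs x (fin_two_add_one_ne x).symm
    have hr' : ∀ y, root a⁻¹ y = y + 1 := perm_fin_two_apply (by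
      rw [root_inv, Ne, inv_eq_one]; exact hν.root_ne_one hG ha ha1)
    have hsi : ∀ y, sec a⁻¹ (y + 1) = (sec a y)⁻¹ := fun y => by
      rw [← hr y, sec_inv_root]
    have hcases : ∀ v : List (Fin 2), v.length = 2 → ∃ p : Fin 2 × Fin 2, v = [p.1, p.2] := by
      intro v hv
      obtain ⟨y, z, rfl⟩ := List.length_eq_two.1 hv
      exact ⟨(y, z), rfl⟩
    have hact : ∀ p : Fin 2 × Fin 2, actW a [p.1, p.2] =
        [(twoLetterCycle x p).1, (twoLetterCycle x p).2] := by
      rintro ⟨y, z⟩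
      by_cases hy : y = x
      · subst hy
        simp [hr, hsx, twoLetterCycle, (fin_two_add_one_ne y).symm]
      · obtain rfl := fin_two_eq_add_one hy
        simp [hr, hsa, hr', twoLetterCycle, -root_inv]
    refine ⟨2, two_pos, ?_, [x + 1, x], [x, x + 1], rfl, ?_, ?_, ?_⟩
    · intro v u hv hu
      obtain ⟨p, rfl⟩ := hcases v hv
      obtain ⟨q, rfl⟩ := hcases u hu
      obtain ⟨k, hk⟩ := twoLetterCycle_transitive x p q
      refine exists_hasRestriction_zpow (k := k) ?_
      have : ∀ (k : ℕ) (p : Fin 2 × Fin 2), (actW a)^[k] [p.1, p.2] =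
          [((twoLetterCycle x)^[k] p).1, ((twoLetterCycle x)^[k] p).2] := by
        intro k
        induction k with
        | zero => intro p; rfl
        | succ k ih => intro p; rw [Function.iterate_succ_apply, hact, ih]; rfl
      rw [this, hk]
    · simp [fin_two_add_one_ne x]
    · refine (hasRestriction_iff a _ _ _).2 ⟨by simp [hr, hsa, hr', fin_two_add_one_add_one, -root_inv], ?_⟩
      have h1 := hsi (x + 1)
      rw [fin_two_add_one_add_one, hsa, inv_inv] at h1
      simp [hsa, h1]
    · intro v hv hvx
      obtain ⟨⟨y, z⟩, rfl⟩ := hcases v hv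
      refine ⟨_, (hasRestriction_iff a _ _ _).2 ⟨rfl, ?_⟩⟩
      by_cases hy : y = x
      · subst hy
        simp [hsx]
      · obtain rfl := fin_two_eq_add_one hy
        have hz : z = x + 1 := fin_two_eq_add_one fun h => hvx (by simp [h])
        subst hz
        simp [hsa, hsi, hsx]

end FollowsLetterMap

end TreeAut

/-! ### Nuclei in which one letter carries all activity: Šunić's automata -/

namespace TreeAut

variable {S : Type*}

theorem aut_relabel_inl_zero {k : ℕ} (ρ : (Fin k → ZMod 2) ≃+ (Fin k → ZMod 2))
    (ω : (Fin k → ZMod 2) →+ ZMod 2) (e : Equiv.Perm (Fin 2)) :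
    ((sunicTransducer ρ ω).relabel e).aut (Sum.inl 0) = 1 := by
  refine ext_of_actW fun v => ?_
  rw [actW_one]
  induction v with
  | nil => rfl
  | cons x v ih =>
    obtain ⟨h1, h2⟩ := ((sunicTransducer ρ ω).relabel e).root_sec_aut (Sum.inl 0) x
    rw [actW_cons, h1, h2]
    change _ :: actW (((sunicTransducer ρ ω).relabel e).aut (Sum.inl 0)) v = _
    rw [ih]
    simp [Transducer.relabel, sunicTransducer]

theorem sec_aut_relabel_inl {k : ℕ} (ρ : (Fin k → ZMod 2) ≃+ (Fin k → ZMod 2))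
    (ω : (Fin k → ZMod 2) →+ ZMod 2) (e : Equiv.Perm (Fin 2)) (c : ZMod 2) (x : Fin 2) :
    sec (((sunicTransducer ρ ω).relabel e).aut (Sum.inl c)) x = 1 :=
  (((sunicTransducer ρ ω).relabel e).root_sec_aut (Sum.inl c) x).2.trans
    (aut_relabel_inl_zero ρ ω e)

theorem root_aut_relabel_inl_one {k : ℕ} (ρ : (Fin k → ZMod 2) ≃+ (Fin k → ZMod 2))
    (ω : (Fin k → ZMod 2) →+ ZMod 2) (e : Equiv.Perm (Fin 2)) :
    root (((sunicTransducer ρ ω).relabel e).aut (Sum.inl 1)) ≠ 1 := by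
  intro h
  have h1 := (((sunicTransducer ρ ω).relabel e).root_sec_aut (Sum.inl 1) 0).1
  rw [h] at h1
  have h2 : ∀ e : Equiv.Perm (Fin 2), (0 : Fin 2) ≠ ((e.symm.trans (Equiv.swap 0 1)).trans e) 0 := by
    decide
  exact h2 e h1

theorem root_aut_relabel_inr {k : ℕ} (ρ : (Fin k → ZMod 2) ≃+ (Fin k → ZMod 2))
    (ω : (Fin k → ZMod 2) →+ ZMod 2) (e : Equiv.Perm (Fin 2)) (b : Fin k → ZMod 2) :
    root (((sunicTransducer ρ ω).relabel e).aut (Sum.inr b)) = 1 := by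
  refine Equiv.ext fun x => ?_
  rw [(((sunicTransducer ρ ω).relabel e).root_sec_aut (Sum.inr b) x).1]
  simp [Transducer.relabel, sunicTransducer]

theorem sec_aut_relabel_inr_zero {k : ℕ} (ρ : (Fin k → ZMod 2) ≃+ (Fin k → ZMod 2))
    (ω : (Fin k → ZMod 2) →+ ZMod 2) (e : Equiv.Perm (Fin 2)) (b : Fin k → ZMod 2) :
    sec (((sunicTransducer ρ ω).relabel e).aut (Sum.inr b)) (e 0) =
      ((sunicTransducer ρ ω).relabel e).aut (Sum.inl (ω b)) := by
  rw [(((sunicTransducer ρ ω).relabel e).root_sec_aut (Sum.inr b) _).2]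
  simp [Transducer.relabel, sunicTransducer]

theorem sec_aut_relabel_inr_one {k : ℕ} (ρ : (Fin k → ZMod 2) ≃+ (Fin k → ZMod 2))
    (ω : (Fin k → ZMod 2) →+ ZMod 2) (e : Equiv.Perm (Fin 2)) (b : Fin k → ZMod 2) :
    sec (((sunicTransducer ρ ω).relabel e).aut (Sum.inr b)) (e 1) =
      ((sunicTransducer ρ ω).relabel e).aut (Sum.inr (ρ b)) := by
  rw [(((sunicTransducer ρ ω).relabel e).root_sec_aut (Sum.inr b) _).2]
  simp [Transducer.relabel, sunicTransducer]

/-- The sign of a permutation of two letters, as an element of `ℤ/2`. -/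
def permSign (π : Equiv.Perm (Fin 2)) : ZMod 2 := if π = 1 then 0 else 1

theorem permSign_mul (π τ : Equiv.Perm (Fin 2)) : permSign (π * τ) = permSign π + permSign τ := by
  revert π τ; decide

variable {G : Subgroup TreeAut}

/-- Paths in the nucleus that have read the letter `p + 1` end one letter later. -/
def FollowsConstant (G : Subgroup TreeAut) (p : Fin 2) : Prop :=
  ∀ g ∈ nucleus G, ∀ y, sec (sec g (p + 1)) y = 1

section FollowsConstant

variable {p : Fin 2}

theorem FollowsConstant.sec_eq_one (hp : FollowsConstant G p) {h : TreeAut}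
    (hh : h ∈ nucleusAt G (p + 1)) (y : Fin 2) : sec h y = 1 := by
  obtain ⟨g, hg, rfl⟩ := hh
  exact hp g hg y

theorem FollowsConstant.image_nucleusAt (hp : FollowsConstant G p) (hG : Contracting G) :
    (fun h => sec h p) '' nucleusAt G p = nucleusAt G p := by
  apply Set.Subset.antisymm
  · rintro _ ⟨h, hh, rfl⟩
    exact ⟨h, nucleusAt_subset p hh, rfl⟩
  · rintro _ ⟨g, hg, rfl⟩
    obtain ⟨y, hy⟩ := hG.exists_mem_nucleusAt hg
    by_cases hyp : y = p
    · exact ⟨g, hyp ▸ hy, rfl⟩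
    · obtain rfl := fin_two_eq_add_one hyp
      exact ⟨1, one_mem_nucleusAt p, by simp [hp.sec_eq_one hy p]⟩

theorem FollowsConstant.injOn (hp : FollowsConstant G p) (hG : Contracting G) :
    Set.InjOn (fun h => sec h p) (nucleusAt G p) :=
  Set.injOn_of_ncard_image_eq (by rw [hp.image_nucleusAt hG]) (hG.finite_nucleusAt p)

theorem FollowsConstant.sec_ne_one (hp : FollowsConstant G p) (hG : Contracting G)
    {h : TreeAut} (hh : h ∈ nucleusAt G p) (h1 : h ≠ 1) : sec h p ≠ 1 := fun he =>
  h1 (hp.injOn hG hh (one_mem_nucleusAt p) (by simpa using he))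

/-- If $h$ switched letters, $(h|_p)^{-1}$ would be a restriction of $h^{-1}$ at $p+1$ and would
have only trivial restrictions. Then $h|_p$ would be trivial at $p$ without being trivial, against
injectivity. -/
theorem FollowsConstant.root_eq_one (hp : FollowsConstant G p) (hG : Contracting G)
    {h : TreeAut} (hh : h ∈ nucleusAt G p) : root h = 1 := by
  by_contra hr
  have h1 : h ≠ 1 := fun he => hr (by rw [he, root_one])
  have hk := hp.sec_ne_one hG hh h1
  have hinv : (sec h p)⁻¹ ∈ nucleusAt G (p + 1) := by
    refine ⟨h⁻¹, inv_mem_nucleus (nucleusAt_subset p hh), ?_⟩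
    change sec h⁻¹ (p + 1) = _
    rw [← perm_fin_two_apply hr, sec_inv_root]
  have hkp : sec h p ∈ nucleusAt G p := ⟨h, nucleusAt_subset p hh, rfl⟩
  refine hp.sec_ne_one hG hkp hk ?_
  have h2 := hp.sec_eq_one hinv (root (sec h p) p)
  rwa [sec_inv_root, inv_eq_one] at h2

/-- Restriction at $p$ permutes the finite set `nucleusAt G p`, and it is multiplicative because
roots are trivial. If its order is $n$, then $gh$ reappears as its own restriction at all words
$p^{nj}$, hence lies in the nucleus and is a restriction at $p$. -/
theorem FollowsConstant.mul_mem (hp : FollowsConstant G p) (hG : Contracting G)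
    {g h : TreeAut} (hg : g ∈ nucleusAt G p) (hh : h ∈ nucleusAt G p) :
    g * h ∈ nucleusAt G p := by
  have hfin := (hG.finite_nucleusAt p).to_subtype
  let f : nucleusAt G p → nucleusAt G p := fun h => ⟨sec h p, h, nucleusAt_subset p h.2, rfl⟩
  have hf : Function.Injective f := fun a b hab =>
    Subtype.ext (hp.injOn hG a.2 b.2 (congrArg Subtype.val hab))
  have hmul : ∀ (n : ℕ) (a b : nucleusAt G p),
      secW (a * b : TreeAut) (List.replicate n p) = f^[n] a * f^[n] b := by
    intro n
    induction n with
    | zero => intro a b; rfl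
    | succ n ih =>
      intro a b
      rw [List.replicate_succ, secW_cons, sec_mul, hp.root_eq_one hG b.2, Equiv.Perm.one_apply]
      exact ih (f a) (f b)
  obtain ⟨n, hn, hfn⟩ : ∃ n, 0 < n ∧ f^[n] = id := by
    obtain ⟨n, hn, h⟩ := isOfFinOrder_iff_pow_eq_one.1
      (isOfFinOrder_of_finite (Equiv.ofBijective f (Finite.injective_iff_bijective.1 hf) :
        Equiv.Perm (nucleusAt G p)))
    refine ⟨n, hn, funext fun a => ?_⟩
    have := congrArg (fun π : Equiv.Perm (nucleusAt G p) => π a) h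
    rw [Equiv.Perm.coe_one] at this
    rw [← this, ← Equiv.Perm.iterate_eq_pow]
    rfl
  have hrep : ∀ j : ℕ, secW (g * h) (List.replicate (n * j) p) = g * h := by
    intro j
    rw [hmul _ ⟨g, hg⟩ ⟨h, hh⟩, Function.iterate_mul, hfn, Function.iterate_id]
    rfl
  have hgh : g * h ∈ nucleus G := by
    refine ⟨g * h, G.mul_mem (hG.nucleus_subset (nucleusAt_subset p hg))
      (hG.nucleus_subset (nucleusAt_subset p hh)), fun j => ⟨List.replicate (n * j) p, ?_, hrep j⟩⟩
    simpa using Nat.le_mul_of_pos_left j hn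
  refine ⟨secW (g * h) (List.replicate (n - 1) p), secW_mem_nucleus hgh _, ?_⟩
  have h1 := hrep 1
  rw [mul_one, show n = n - 1 + 1 by omega, List.replicate_succ', secW_append] at h1
  exact h1

/-- Off the letter $p$ the restriction can only change its first letter, so its square is trivial;
at $p$ the argument repeats. -/
theorem FollowsConstant.mul_self (hp : FollowsConstant G p) (hG : Contracting G)
    {g : TreeAut} (hg : g ∈ nucleusAt G p) : g * g = 1 := by
  have h1 : ∀ k : TreeAut, (∀ y, sec k y = 1) → k * k = 1 := by
    intro k hk
    refine eq_one_of_root_of_sec ?_ fun x => by simp [hk]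
    rw [root_mul]
    generalize root k = π
    revert π; decide
  refine ext_of_actW fun v => ?_
  rw [actW_one]
  induction v generalizing g with
  | nil => rfl
  | cons y v ih =>
    rw [actW_cons, root_mul, sec_mul, hp.root_eq_one hG hg]
    by_cases hy : y = p
    · subst hy
      rw [Equiv.Perm.one_apply, ih ⟨g, nucleusAt_subset y hg, rfl⟩]
      rfl
    · obtain rfl := fin_two_eq_add_one hy
      rw [Equiv.Perm.one_apply, h1 _ (hp.sec_eq_one ⟨g, nucleusAt_subset p hg, rfl⟩), actW_one]
      rfl

/-- The restrictions of the nucleus at `p` form a group. -/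
def FollowsConstant.group (hp : FollowsConstant G p) (hG : Contracting G) : Subgroup TreeAut where
  carrier := nucleusAt G p
  one_mem' := one_mem_nucleusAt p
  mul_mem' := hp.mul_mem hG
  inv_mem' {g} hg := by rwa [inv_eq_of_mul_eq_one_left (hp.mul_self hG hg)]

theorem FollowsConstant.exists_addEquiv (hp : FollowsConstant G p) (hG : Contracting G) :
    ∃ k : ℕ, Nonempty ((Fin k → ZMod 2) ≃+ Additive (hp.group hG)) := by
  have hsq : ∀ g : hp.group hG, g * g = 1 := fun g => Subtype.ext (hp.mul_self hG g.2)
  have hinv : ∀ g : hp.group hG, g⁻¹ = g := fun g => inv_eq_of_mul_eq_one_left (hsq g)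
  let _ : CommGroup (hp.group hG) :=
    { (inferInstance : Group (hp.group hG)) with
      mul_comm := fun a b => by rw [← hinv (a * b), mul_inv_rev, hinv, hinv] }
  let _ : Module (ZMod 2) (Additive (hp.group hG)) :=
    AddCommGroup.zmodModule fun x => by
      rw [two_nsmul]; exact hsq x.toMul
  have : Finite (Additive (hp.group hG)) := (hG.finite_nucleusAt p).to_subtype
  exact ⟨_, ⟨(Module.finBasis (ZMod 2) (Additive (hp.group hG))).equivFun.symm.toAddEquiv⟩⟩

/-- Coordinates on the group of restrictions at $p$ turn restriction at $p$ into $\rho$, and the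
letter switch performed after $p+1$ into $\omega$. Elements arising only at $p+1$ can change nothing
but the first letter. -/
theorem FollowsConstant.exists_nucleus_eq (hp : FollowsConstant G p) (hG : Contracting G)
    (hne : ∃ h ∈ nucleus G, root h ≠ 1) :
    ∃ (k : ℕ) (ρ : (Fin k → ZMod 2) ≃+ (Fin k → ZMod 2)) (ω : (Fin k → ZMod 2) →+ ZMod 2)
        (e : Equiv.Perm (Fin 2)), Function.Surjective ω ∧
        nucleus G = Set.range ((sunicTransducer ρ ω).relabel e).aut := by
  obtain ⟨k, ⟨φ⟩⟩ := hp.exists_addEquiv hG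
  have : Finite (hp.group hG) := (hG.finite_nucleusAt p).to_subtype
  let f : hp.group hG →* hp.group hG :=
    { toFun := fun g => ⟨sec g p, g, nucleusAt_subset p g.2, rfl⟩
      map_one' := Subtype.ext (sec_one p)
      map_mul' := fun a b => Subtype.ext (by
        change sec (a * b : TreeAut) p = sec a p * sec b p
        rw [sec_mul, hp.root_eq_one hG b.2, Equiv.Perm.one_apply]) }
  have hf : Function.Bijective f := Finite.injective_iff_bijective.1 fun a b hab =>
    Subtype.ext (hp.injOn hG a.2 b.2 (congrArg Subtype.val hab))
  let F : Additive (hp.group hG) ≃+ Additive (hp.group hG) :=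
    MulEquiv.toAdditive (MulEquiv.ofBijective f hf)
  let ρ : (Fin k → ZMod 2) ≃+ (Fin k → ZMod 2) := (φ.trans F).trans φ.symm
  let val : (Fin k → ZMod 2) → TreeAut := fun b => ((φ b).toMul : hp.group hG).1
  have hval : ∀ b, val b ∈ nucleusAt G p := fun b => ((φ b).toMul : hp.group hG).2
  have hρ : ∀ b, val (ρ b) = sec (val b) p := by
    intro b
    change ((φ (φ.symm (F (φ b)))).toMul : hp.group hG).1 = _
    rw [AddEquiv.apply_symm_apply]
    rfl
  have hvadd : ∀ a b, val (a + b) = val a * val b := by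
    intro a b
    change ((φ (a + b)).toMul : hp.group hG).1 = _
    rw [map_add]
    rfl
  let ω : (Fin k → ZMod 2) →+ ZMod 2 := AddMonoidHom.mk' 
    (fun b => permSign (root (sec (val b) (p + 1)))) (fun a b => by
      rw [hvadd, sec_mul, hp.root_eq_one hG (hval b), Equiv.Perm.one_apply, root_mul, permSign_mul])
  -- In Šunić's automaton the $B$-states persist at letter 1 and read off $\omega$ at letter 0, so
  -- $p$ has to be named 1.
  let e : Equiv.Perm (Fin 2) := if p = 1 then 1 else Equiv.swap 0 1
  have he : e 0 = p + 1 ∧ e 1 = p := by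
    have : ∀ p : Fin 2, (if p = 1 then 1 else Equiv.swap 0 1 : Equiv.Perm (Fin 2)) 0 = p + 1 ∧
      (if p = 1 then 1 else Equiv.swap 0 1 : Equiv.Perm (Fin 2)) 1 = p := by decide
    exact this p
  have hinl : ∀ h : TreeAut, (∀ y, sec h y = 1) →
      h = ((sunicTransducer ρ ω).relabel e).aut (Sum.inl (permSign (root h))) := by
    intro h hs
    by_cases hr : root h = 1
    · rw [hr, show permSign 1 = 0 from rfl, aut_relabel_inl_zero]
      exact eq_one_of_root_of_sec hr hs
    · rw [permSign, if_neg hr]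
      refine ext_root_sec (perm_fin_two_eq hr (root_aut_relabel_inl_one ρ ω e)) fun y => ?_
      rw [hs, sec_aut_relabel_inl]
  have hinr : ∀ b, val b = ((sunicTransducer ρ ω).relabel e).aut (Sum.inr b) := by
    intro b
    refine ext_of_actW fun v => ?_
    induction v generalizing b with
    | nil => rfl
    | cons y v ih =>
      rw [actW_cons, actW_cons, hp.root_eq_one hG (hval b), root_aut_relabel_inr]
      by_cases hy : y = p
      · have h1 := sec_aut_relabel_inr_one ρ ω e b
        rw [he.2] at h1
        rw [hy, h1, ← ih, hρ]
      · obtain rfl := fin_two_eq_add_one hy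
        have h1 := sec_aut_relabel_inr_zero ρ ω e b
        rw [he.1] at h1
        rw [h1, hinl (sec (val b) (p + 1))
          (hp.sec_eq_one ⟨val b, nucleusAt_subset p (hval b), rfl⟩)]
        rfl
  have hsurj : ∀ g ∈ nucleusAt G p, ∃ b, val b = g := fun g hg =>
    ⟨φ.symm (Additive.ofMul ⟨g, hg⟩), by simp [val]⟩
  obtain ⟨s, hs, hsr⟩ := hne
  have hsnot : s ∉ nucleusAt G p := fun h => hsr (hp.root_eq_one hG h)
  have hs' : ∀ y, sec s y = 1 := by
    obtain ⟨y, hy⟩ := hG.exists_mem_nucleusAt hs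
    have hyp : y ≠ p := fun h => hsnot (h ▸ hy)
    rw [fin_two_eq_add_one hyp] at hy
    exact hp.sec_eq_one hy
  -- If $\omega=0$, every restriction at $p$ is trivial. The switching element $s$ is itself a
  -- restriction of a nucleus element, and all of these would then be trivial.
  have hω : ∃ b, ω b ≠ 0 := by
    by_contra! hcon
    have h1 : ∀ b, val b = 1 := by
      intro b
      refine ext_of_actW fun v => ?_
      rw [actW_one]
      induction v generalizing b with
      | nil => rfl
      | cons y v ih =>
        rw [actW_cons, hp.root_eq_one hG (hval b), Equiv.Perm.one_apply]
        by_cases hy : y = p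
        · rw [hy, ← hρ, ih]
        · obtain rfl := fin_two_eq_add_one hy
          rw [hinl (sec (val b) (p + 1))
            (hp.sec_eq_one ⟨val b, nucleusAt_subset p (hval b), rfl⟩)]
          rw [show permSign (root (sec (val b) (p + 1))) = 0 from hcon b, aut_relabel_inl_zero,
            actW_one]
    have hs1 : s ≠ 1 := fun h => hsr (by rw [h, root_one])
    obtain ⟨x, g, hg, hgs⟩ := hG.exists_mem_nucleusAt hs
    obtain ⟨y, hy⟩ := hG.exists_mem_nucleusAt hg
    by_cases hyp : y = p
    · obtain ⟨b, rfl⟩ := hsurj g (hyp ▸ hy)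
      rw [h1] at hgs
      exact hs1 (by rw [← hgs]; simp)
    · rw [fin_two_eq_add_one hyp] at hy
      exact hs1 (by rw [← hgs]; exact hp.sec_eq_one hy x)
  refine ⟨k, ρ, ω, e, ?_, Set.Subset.antisymm ?_ ?_⟩
  · obtain ⟨b, hb⟩ := hω
    intro c
    have hc : ∀ a c : ZMod 2, a ≠ 0 → c = 0 ∨ c = a := by decide
    rcases hc (ω b) c hb with h | h
    · exact ⟨0, by rw [map_zero, h]⟩
    · exact ⟨b, h.symm⟩
  · intro g hg
    obtain ⟨y, hy⟩ := hG.exists_mem_nucleusAt hg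
    by_cases hyp : y = p
    · obtain ⟨b, rfl⟩ := hsurj g (hyp ▸ hy)
      exact ⟨_, (hinr b).symm⟩
    · rw [fin_two_eq_add_one hyp] at hy
      exact ⟨_, (hinl g (hp.sec_eq_one hy)).symm⟩
  · rintro _ ⟨c | b, rfl⟩
    · have hc : ∀ c : ZMod 2, c = 0 ∨ c = 1 := by decide
      rcases hc c with rfl | rfl
      · rw [aut_relabel_inl_zero]; exact one_mem_nucleus
      · have h1 := hinl s hs'
        rw [permSign, if_neg hsr] at h1
        rwa [← h1]
    · rw [← hinr]
      exact nucleusAt_subset p (hval b)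

end FollowsConstant

/-! ### Classification of nuclei by active words of length two -/

/-- A group whose nucleus has at most two active words of length two. -/
theorem Contracting.nucleus_classification (hG : Contracting G)
    (hne : ∃ h ∈ nucleus G, root h ≠ 1)
    (hcard : {p : Fin 2 × Fin 2 | ∃ g ∈ nucleus G, sec (sec g p.1) p.2 ≠ 1}.ncard ≤ 2) :
    (∃ a : TreeAut, IsAddingMachine a.1 ∧ nucleus G = {a, a⁻¹, 1}) ∨
      ∃ (k : ℕ) (ρ : (Fin k → ZMod 2) ≃+ (Fin k → ZMod 2)) (ω : (Fin k → ZMod 2) →+ ZMod 2)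
        (e : Equiv.Perm (Fin 2)), Function.Surjective ω ∧
        nucleus G = Set.range ((sunicTransducer ρ ω).relabel e).aut := by
  classical
  let P : Finset (Fin 2 × Fin 2) :=
    Finset.univ.filter fun p => ∃ g ∈ nucleus G, sec (sec g p.1) p.2 ≠ 1
  have hPmem : ∀ p, p ∈ P ↔ ∃ g ∈ nucleus G, sec (sec g p.1) p.2 ≠ 1 := by simp [P]
  have hP2 : P.card ≤ 2 := by
    rw [← Set.ncard_coe_finset]
    simpa [P] using hcard
  -- Nucleus elements are restrictions of nucleus elements, so an active pair can be continued to
  -- the left.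
  have hback : ∀ p ∈ P, ∃ x, (x, p.1) ∈ P := by
    intro p hp
    obtain ⟨g, hg, hgp⟩ := (hPmem p).1 hp
    obtain ⟨x, h, hh, rfl⟩ := hG.exists_mem_nucleusAt hg
    refine ⟨x, (hPmem _).2 ⟨h, hh, fun h1 => hgp ?_⟩⟩
    simp only at h1 ⊢
    rw [h1, sec_one]
  -- The combinatorial core: sets of at most two pairs that can be continued to the left either
  -- advance letters by a constant or have a single first letter.
  have hdec : ∀ P : Finset (Fin 2 × Fin 2), P.card ≤ 2 → (∀ p ∈ P, ∃ x, (x, p.1) ∈ P) →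
      (∃ c : Fin 2, ∀ p ∈ P, p.2 = p.1 + c) ∨ ∃ q : Fin 2, ∀ p ∈ P, p.1 ≠ q + 1 := by
    decide
  rcases hdec P hP2 hback with ⟨c, hc⟩ | ⟨q, hq⟩
  · left
    have hν : FollowsLetterMap G fun x => x + c :=
      { equivariant := fun x => by rw [add_right_comm]
        sec_sec := fun g hg x y hy => by
          by_contra hcon
          exact hy (hc (x, y) ((hPmem _).2 ⟨g, hg, hcon⟩)) }
    obtain ⟨h, hh, hr⟩ := hne
    obtain ⟨x, a, ha, ha1, hN⟩ := hν.exists_nucleus_eq hG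
      ⟨h, hh, fun h1 => hr (by rw [h1, root_one])⟩
    exact ⟨a, hν.isAddingMachine hG ha ha1, hN⟩
  · right
    have hp : FollowsConstant G q := fun g hg y => by
      by_contra hcon
      exact hq (q + 1, y) ((hPmem _).2 ⟨g, hg, hcon⟩) rfl
    exact hp.exists_nucleus_eq hG hne

end TreeAut

/-! ### The Bernoulli measure, the shift and generic sequences -/

instance : IsProbabilityMeasure bernoulliMeasure := by
  unfold bernoulliMeasure; infer_instance

theorem measurable_consSeq_uncurry : Measurable fun p : Fin 2 × BinSeq => consSeq p.1 p.2 :=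
  measurable_pi_iff.2 fun n => by
    cases n with
    | zero => exact measurable_fst
    | succ n => exact (measurable_pi_apply n).comp measurable_snd

theorem measurable_tailSeq : Measurable tailSeq :=
  measurable_pi_iff.2 fun n => measurable_pi_apply (n + 1)

/-- A random sequence is an independent uniform letter followed by a random sequence. Invariance of
the shift and the transfer of null sets under adding letters both come from this. -/
theorem map_consSeq_prod :
    ((PMF.uniformOfFintype (Fin 2)).toMeasure.prod bernoulliMeasure).map
      (fun p => consSeq p.1 p.2) = bernoulliMeasure := by
  refine Measure.eq_infinitePi _ fun s t ht => ?_
  rw [Measure.map_apply measurable_consSeq_uncurry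
    (MeasurableSet.pi s.countable_toSet fun i _ => ht i)]
  let s' : Finset ℕ := s.preimage (· + 1) (add_left_injective 1).injOn
  have hset : (fun p : Fin 2 × BinSeq => consSeq p.1 p.2) ⁻¹' (s : Set ℕ).pi t =
      {x | 0 ∈ s → x ∈ t 0} ×ˢ (s' : Set ℕ).pi fun i => t (i + 1) := by
    ext ⟨x, u⟩
    simp only [Set.mem_preimage, Set.mem_pi, Set.mem_prod, Set.mem_ofPred_eq]
    constructor
    · exact fun h => ⟨fun h0 => h 0 h0, fun i hi => h (i + 1) (by simpa [s'] using hi)⟩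
    · rintro ⟨h0, h1⟩ (_ | i) hi
      · exact h0 hi
      · exact h1 i (by simpa [s'] using hi)
  rw [hset, Measure.prod_prod, bernoulliMeasure, Measure.infinitePi_pi _ fun i _ => ht (i + 1)]
  have hs' : ∏ i ∈ s', (PMF.uniformOfFintype (Fin 2)).toMeasure (t (i + 1)) =
      ∏ i ∈ s.erase 0, (PMF.uniformOfFintype (Fin 2)).toMeasure (t i) := by
    refine Finset.prod_bij (fun i _ => i + 1) ?_ ?_ ?_ ?_
    · intro i hi; simpa [s'] using hi
    · intro i _ j _ hij; simpa using hij
    · intro j hj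
      obtain ⟨h0, hj⟩ := Finset.mem_erase.1 hj
      exact ⟨j - 1, by simp [s', Nat.sub_add_cancel (Nat.pos_of_ne_zero h0), hj], by omega⟩
    · intro i _; rfl
  rw [hs']
  by_cases h0 : 0 ∈ s
  · simp only [h0, true_imp_iff]
    exact Finset.mul_prod_erase s (fun i => (PMF.uniformOfFintype (Fin 2)).toMeasure (t i)) h0
  · simp [h0]

theorem measurePreserving_consSeq :
    MeasurePreserving (fun p : Fin 2 × BinSeq => consSeq p.1 p.2)
      ((PMF.uniformOfFintype (Fin 2)).toMeasure.prod bernoulliMeasure) bernoulliMeasure :=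
  ⟨measurable_consSeq_uncurry, map_consSeq_prod⟩

theorem measurePreserving_tailSeq :
    MeasurePreserving tailSeq bernoulliMeasure bernoulliMeasure := by
  refine ⟨measurable_tailSeq, ?_⟩
  conv_lhs => rw [← map_consSeq_prod]
  rw [Measure.map_map measurable_tailSeq measurable_consSeq_uncurry]
  exact measurePreserving_snd.map_eq

theorem ae_consSeq {p : BinSeq → Prop} (h : ∀ᵐ w ∂bernoulliMeasure, p w) (x : Fin 2) :
    ∀ᵐ w ∂bernoulliMeasure, p (consSeq x w) := by
  have h1 := measurePreserving_consSeq.quasiMeasurePreserving.ae h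
  have h2 := Measure.ae_ae_of_ae_prod h1
  rw [ae_iff] at h2
  by_contra hcon
  have h3 : (PMF.uniformOfFintype (Fin 2)).toMeasure {x} = 0 :=
    measure_mono_null (by rintro _ rfl; exact hcon) h2
  rw [PMF.toMeasure_uniformOfFintype_apply _ (measurableSet_singleton x)] at h3
  simp at h3

theorem ae_prependWord {p : BinSeq → Prop} (h : ∀ᵐ w ∂bernoulliMeasure, p w)
    (v : List (Fin 2)) : ∀ᵐ w ∂bernoulliMeasure, p (prependWord v w) := by
  induction v generalizing p with
  | nil => exact h
  | cons x v ih => exact ih (ae_consSeq h x)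

theorem ae_tailSeq_iterate {p : BinSeq → Prop} (h : ∀ᵐ w ∂bernoulliMeasure, p w) (n : ℕ) :
    ∀ᵐ w ∂bernoulliMeasure, p (tailSeq^[n] w) :=
  (measurePreserving_tailSeq.iterate n).quasiMeasurePreserving.ae h

/-- Two sequences that differ in finitely many places. -/
def Cofinal (u v : BinSeq) : Prop := ∃ n, tailSeq^[n] u = tailSeq^[n] v

theorem tailSeq_iterate_eq_of_le {u v : BinSeq} {n m : ℕ} (h : tailSeq^[n] u = tailSeq^[n] v)
    (hnm : n ≤ m) : tailSeq^[m] u = tailSeq^[m] v := by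
  obtain ⟨k, rfl⟩ := Nat.exists_eq_add_of_le' hnm
  rw [Function.iterate_add_apply, Function.iterate_add_apply, h]

theorem Cofinal.refl (u : BinSeq) : Cofinal u u := ⟨0, rfl⟩

theorem Cofinal.symm {u v : BinSeq} : Cofinal u v → Cofinal v u := fun ⟨n, h⟩ => ⟨n, h.symm⟩

theorem Cofinal.trans {u v w : BinSeq} : Cofinal u v → Cofinal v w → Cofinal u w :=
  fun ⟨n, h⟩ ⟨m, h'⟩ => ⟨max n m, (tailSeq_iterate_eq_of_le h (le_max_left _ _)).trans
    (tailSeq_iterate_eq_of_le h' (le_max_right _ _))⟩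

theorem finite_tailSeq_iterate_eq (n : ℕ) (z : BinSeq) : {x | tailSeq^[n] x = z}.Finite := by
  refine ((List.finite_length_eq (Fin 2) n).image fun v => prependWord v z).subset ?_
  rintro x rfl
  exact ⟨prefixWord n x, length_prefixWord n x, prependWord_prefixWord n x⟩

theorem exists_tailSeq_iterate_eq_of_finite {s : Set BinSeq} (hs : s.Finite) {w : BinSeq}
    (h : ∀ x ∈ s, Cofinal x w) : ∃ n, ∀ m, n ≤ m → ∀ x ∈ s, tailSeq^[m] x = tailSeq^[m] w := by
  induction s, hs using Set.Finite.induction_on with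
  | empty => exact ⟨0, by simp⟩
  | insert _ _ ih =>
    obtain ⟨n, hn⟩ := ih fun x hx => h x (Set.mem_insert_of_mem _ hx)
    obtain ⟨k, hk⟩ := h _ (Set.mem_insert _ _)
    refine ⟨max n k, fun m hm x hx => ?_⟩
    rcases hx with rfl | hx
    · exact tailSeq_iterate_eq_of_le hk ((le_max_right _ _).trans hm)
    · exact hn m ((le_max_left _ _).trans hm) x hx

theorem ae_forall_cofinal {p : BinSeq → Prop} (h : ∀ᵐ w ∂bernoulliMeasure, p w) :
    ∀ᵐ w ∂bernoulliMeasure, ∀ u, Cofinal u w → p u := by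
  have h1 : ∀ᵐ w ∂bernoulliMeasure, ∀ (n : ℕ) (v : List (Fin 2)),
      p (prependWord v (tailSeq^[n] w)) :=
    ae_all_iff.2 fun n => ae_all_iff.2 fun v => ae_tailSeq_iterate (ae_prependWord h v) n
  filter_upwards [h1] with w hw u hu
  obtain ⟨n, hn⟩ := hu
  rw [← prependWord_prefixWord n u, hn]
  exact hw n _

theorem bernoulliMeasure_singleton (w : BinSeq) : bernoulliMeasure {w} = 0 := by
  have h1 : ∀ n : ℕ, bernoulliMeasure {w} ≤ 2⁻¹ ^ n := by
    intro n
    calc bernoulliMeasure {w} ≤ bernoulliMeasure (((Finset.range n : Finset ℕ) : Set ℕ).pi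
          fun i => {w i}) := measure_mono (by rintro _ rfl i _; rfl)
      _ = 2⁻¹ ^ n := by
        rw [bernoulliMeasure, Measure.infinitePi_pi _ fun i _ => measurableSet_singleton (w i)]
        rw [Finset.prod_congr rfl fun i _ =>
          PMF.toMeasure_uniformOfFintype_apply _ (measurableSet_singleton (w i))]
        simp
  refine le_antisymm (ge_of_tendsto' (ENNReal.tendsto_pow_atTop_nhds_zero_of_lt_one ?_) h1) bot_le
  exact ENNReal.inv_lt_one.2 ENNReal.one_lt_two

/-- A measurable property that holds eventually along almost all shift orbits holds almost
surely. -/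
theorem ae_of_ae_eventually_tailSeq {p : BinSeq → Prop} (hp : MeasurableSet {w | p w})
    (h : ∀ᵐ w ∂bernoulliMeasure, ∃ n, ∀ m, n ≤ m → p (tailSeq^[m] w)) :
    ∀ᵐ w ∂bernoulliMeasure, p w := by
  let B : ℕ → Set BinSeq := fun n => {w | ∀ m, n ≤ m → p (tailSeq^[m] w)}
  have hmono : Monotone B := fun i j hij w hw m hm => hw m (hij.trans hm)
  have hU : bernoulliMeasure (⋃ n, B n) = 1 := by
    rw [← measure_univ (μ := bernoulliMeasure)]
    refine measure_congr (Filter.eventuallyEq_univ.2 ?_)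
    filter_upwards [h] with w hw
    exact Set.mem_iUnion.2 hw
  -- $B_n$ lies in the preimage of the event under the $n$-th shift, and that preimage has the
  -- measure of the event itself.
  have hle : ∀ n, bernoulliMeasure (B n) ≤ bernoulliMeasure {w | p w} := fun n => by
    rw [← (measurePreserving_tailSeq.iterate n).measure_preimage hp.nullMeasurableSet]
    exact measure_mono fun w hw => hw n le_rfl
  have h1 : 1 ≤ bernoulliMeasure {w | p w} := by
    rw [← hU, hmono.measure_iUnion]
    exact iSup_le hle
  rw [ae_iff]
  exact (prob_compl_eq_zero_iff hp).2 (le_antisymm prob_le_one h1)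

namespace TreeAut

theorem measurable_smul (g : TreeAut) : Measurable fun w : BinSeq => g • w := by
  refine measurable_pi_iff.2 fun n => ?_
  have : Continuous fun w : BinSeq => (g • w) n := by
    refine IsLocallyConstant.continuous ((IsLocallyConstant.iff_exists_open _).2 fun w => ?_)
    refine ⟨((Finset.range (n + 1) : Finset ℕ) : Set ℕ).pi fun i => {w i},
      isOpen_set_pi (Finset.finite_toSet _) fun i _ => isOpen_discrete _, fun i _ => rfl, ?_⟩
    intro v hv
    exact agree g (n := n + 1) (fun i hi => hv i (by simpa using hi)) n (by omega)
  exact this.measurable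

/-- At most $C$ sequences stay active forever: $C+1$ of them would have distinct prefixes of some
common length, all of them active words. Finite sets are null. -/
theorem IsBdd.ae_exists_secW_eq_one {g : TreeAut} (hg : IsBdd g) :
    ∀ᵐ w ∂bernoulliMeasure, ∃ n, secW g (prefixWord n w) = 1 := by
  have hfin : {w | ¬ ∃ n, secW g (prefixWord n w) = 1}.Finite := by
    by_contra hinf
    obtain ⟨C, hC⟩ := hg
    obtain ⟨t, ht, htc⟩ := Set.Infinite.exists_subset_card_eq hinf (C + 1)
    have hsep : ∀ u v : BinSeq, ∃ n, u ≠ v → ∀ m, n ≤ m → prefixWord m u ≠ prefixWord m v := by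
      intro u v
      by_cases huv : u = v
      · exact ⟨0, fun h => absurd huv h⟩
      · obtain ⟨i, hi⟩ := Function.ne_iff.1 huv
        refine ⟨i + 1, fun _ m hm he => hi ?_⟩
        have h1 := prependWord_prefixWord m u
        have h2 := prependWord_prefixWord m v
        have key : ∀ (l : List (Fin 2)) (a b : BinSeq) (i : ℕ), i < l.length →
            prependWord l a i = prependWord l b i := by
          intro l a b
          induction l with
          | nil => intro i hi; simp at hi
          | cons x l ih =>
            rintro (_ | i) hi
            · rfl
            · exact ih i (by simpa using hi)
        rw [← h1, ← h2, he]
        exact key _ _ _ _ (by simp; omega)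
    choose N hN using hsep
    let M := t.sup fun u => t.sup fun v => N u v
    have hM : ∀ u ∈ t, ∀ v ∈ t, N u v ≤ M := fun u hu v hv =>
      (Finset.le_sup (f := fun v => N u v) hv).trans
        (Finset.le_sup (f := fun u => t.sup fun v => N u v) hu)
    have hinj : Set.InjOn (prefixWord M) (t : Set BinSeq) := by
      intro u hu v hv huv
      by_contra hne
      exact hN u v hne M (hM u hu v hv) huv
    have h2 := Set.ncard_le_ncard (s := prefixWord M '' (t : Set BinSeq)) (t := activeWords g M)
      (by
        rintro _ ⟨u, hu, rfl⟩
        exact ⟨length_prefixWord M u, fun h => ht hu ⟨M, h⟩⟩) (finite_activeWords g M)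
    rw [hinj.ncard_image, Set.ncard_coe_finset, htc] at h2
    exact absurd (h2.trans (hC M)) (by omega)
  rw [ae_iff, ← Set.biUnion_of_singleton {w | ¬ ∃ n, secW g (prefixWord n w) = 1}]
  exact (measure_biUnion_null_iff hfin.countable).2 fun w _ => bernoulliMeasure_singleton w

/-- All elements of the group act on the cofinality class of `w`. -/
def IsGeneric (G : Subgroup TreeAut) (w : BinSeq) : Prop :=
  ∀ u, Cofinal u w → ∀ g ∈ G, Cofinal (g • u) u

theorem cofinal_smul_of_secW_eq_one {g : TreeAut} {w : BinSeq} {n : ℕ}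
    (h : secW g (prefixWord n w) = 1) : Cofinal (g • w) w := by
  refine ⟨n, ?_⟩
  conv_lhs => rw [← prependWord_prefixWord n w, smul_prependWord, h, one_smul]
  have := tailSeq_iterate_prependWord (actW g (prefixWord n w)) (tailSeq^[n] w)
  rwa [length_actW, length_prefixWord] at this

variable {G : Subgroup TreeAut}

theorem IsGeneric.orbitSet_subset {w : BinSeq} (hw : IsGeneric G w) :
    ∀ u ∈ orbitSet G w, Cofinal u w := by
  rintro _ ⟨g, hg, rfl⟩
  exact hw w (Cofinal.refl w) g hg

end TreeAut

/-- Countably many null sets suffice to make a property hold on a whole cofinality class. On such a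
class every generator and its inverse changes only finitely many letters, and products remain in the
class. -/
theorem Transducer.IsBounded.ae_isGeneric {S : Type*} {A : Transducer S (Fin 2)}
    (hA : A.IsBounded) : ∀ᵐ w ∂bernoulliMeasure, TreeAut.IsGeneric A.treeGroup w := by
  have := hA.1
  have h1 : ∀ᵐ w ∂bernoulliMeasure, ∀ s, (∃ n, TreeAut.secW (A.aut s) (prefixWord n w) = 1) ∧
      ∃ n, TreeAut.secW (A.aut s)⁻¹ (prefixWord n w) = 1 :=
    ae_all_iff.2 fun s => (hA.isBdd s).ae_exists_secW_eq_one.and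
      (hA.isBdd s).inv.ae_exists_secW_eq_one
  filter_upwards [ae_forall_cofinal h1] with w hw
  have key : ∀ g ∈ A.treeGroup, (∀ u, Cofinal u w → Cofinal (g • u) u) ∧
      ∀ u, Cofinal u w → Cofinal (g⁻¹ • u) u := by
    intro g hg
    induction hg using Subgroup.closure_induction with
    | mem g hg =>
      obtain ⟨s, rfl⟩ := hg
      refine ⟨fun u hu => ?_, fun u hu => ?_⟩
      · obtain ⟨n, hn⟩ := (hw u hu s).1
        exact TreeAut.cofinal_smul_of_secW_eq_one hn
      · obtain ⟨n, hn⟩ := (hw u hu s).2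
        exact TreeAut.cofinal_smul_of_secW_eq_one hn
    | one => simp [Cofinal.refl]
    | mul g h _ _ ihg ihh =>
      refine ⟨fun u hu => ?_, fun u hu => ?_⟩
      · rw [mul_smul]
        have h2 := ihh.1 u hu
        exact (ihg.1 _ (h2.trans hu)).trans h2
      · rw [mul_inv_rev, mul_smul]
        have h2 := ihg.2 u hu
        exact (ihh.2 _ (h2.trans hu)).trans h2
    | inv g _ ih => rw [inv_inv]; exact ⟨ih.2, ih.1⟩
  exact fun u hu g hg => (key g hg).1 u hu

/-! ### Tiles and their connectedness -/

namespace TreeAut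

variable {G : Subgroup TreeAut}

theorem exists_secW_root_ne_one {g : TreeAut} (hg : g ≠ 1) : ∃ v, root (secW g v) ≠ 1 := by
  by_contra! hcon
  refine hg (ext_of_actW fun v => ?_)
  rw [actW_one]
  induction v generalizing g with
  | nil => rfl
  | cons x v ih =>
    rw [actW_cons, show root g = 1 from hcon [], Equiv.Perm.one_apply]
    by_cases h : sec g x = 1
    · rw [h, actW_one]
    · rw [ih h fun u => hcon (x :: u)]

theorem exists_activeWords_append {g : TreeAut} (h : ∀ v, secW g v ≠ 1 → ∃ x, sec (secW g v) x ≠ 1)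
    (n : ℕ) {v : List (Fin 2)} (hv : secW g v ≠ 1) :
    ∃ u : List (Fin 2), u.length = n ∧ secW g (v ++ u) ≠ 1 := by
  induction n with
  | zero => exact ⟨[], rfl, by rwa [List.append_nil]⟩
  | succ n ih =>
    obtain ⟨u, hu, hvu⟩ := ih
    obtain ⟨x, hx⟩ := h _ hvu
    refine ⟨u ++ [x], by simp [hu], ?_⟩
    rw [← List.append_assoc, secW_append]
    exact hx

/-- Some element of the nucleus switches letters and has a trivial restriction. -/
theorem exists_swap_with_trivial_sec (hbdd : ∀ g ∈ nucleus G, IsBdd g)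
    (hne : ∃ h ∈ nucleus G, root h ≠ 1) : ∃ g ∈ nucleus G, root g ≠ 1 ∧ ∃ x, sec g x = 1 := by
  by_contra! hcon
  obtain ⟨h, hh, hr⟩ := hne
  -- Under the contrary assumption switching elements branch into two nontrivial restrictions, and
  -- so no nontrivial restriction can die out.
  have hchild : ∀ v, secW h v ≠ 1 → ∃ x, sec (secW h v) x ≠ 1 := by
    intro v hv
    by_contra! hall
    by_cases hrv : root (secW h v) = 1
    · exact hv (eq_one_of_root_of_sec hrv hall)
    · exact hcon _ (secW_mem_nucleus hh v) hrv 0 (hall 0)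
  obtain ⟨C, hC⟩ := hbdd h hh
  -- Each active word is continued to an active word of a common greater length. Below one of them,
  -- $v$, a switching restriction occurs at $vu$, so $vu0$ and $vu1$ are both active and the count
  -- increases.
  have hgrow : ∀ n, ∃ m, (activeWords h n).ncard + 1 ≤ (activeWords h m).ncard := by
    intro n
    have h1 : h ≠ 1 := fun he => hr (by rw [he, root_one])
    obtain ⟨v, hvn, hv⟩ := exists_activeWords_append hchild n (v := []) h1
    rw [List.nil_append] at hv
    obtain ⟨u, hu⟩ := exists_secW_root_ne_one hv
    have hvu := hcon _ (secW_mem_nucleus (secW_mem_nucleus hh v) u) hu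
    choose ext hextl hext using fun (v : List (Fin 2)) (hv : secW h v ≠ 1) =>
      exists_activeWords_append hchild (u.length + 1) hv
    classical
    let f : List (Fin 2) → List (Fin 2) := fun v' =>
      if v' = v then v ++ (u ++ [0]) else
        if hv' : secW h v' ≠ 1 then v' ++ ext v' hv' else []
    have hact : ∀ x, v ++ (u ++ [x]) ∈ activeWords h (n + (u.length + 1)) := fun x =>
      ⟨by simp [hvn], by rw [secW_append, secW_append]; exact hvu x⟩
    have hf : ∀ v' ∈ activeWords h n, f v' ∈ activeWords h (n + (u.length + 1)) ∧
        (f v').take n = v' := by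
      rintro v' ⟨hvl, hv'⟩
      simp only [f]
      split_ifs with he
      · subst he
        exact ⟨hact 0, by rw [← hvl, List.take_left']; rfl⟩
      · exact ⟨⟨by simp [hvl, hextl], hext v' hv'⟩, by rw [← hvl, List.take_left']; rfl⟩
    have hinj : Set.InjOn f (activeWords h n) := fun a ha b hb hab => by
      rw [← (hf a ha).2, ← (hf b hb).2, hab]
    have hnot : v ++ (u ++ [1]) ∉ f '' activeWords h n := by
      rintro ⟨v', hv', he⟩
      have h2 := (hf v' hv').2
      rw [he, ← hvn, List.take_left' rfl] at h2
      subst h2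
      simp [f] at he
    refine ⟨n + (u.length + 1), ?_⟩
    rw [← hinj.ncard_image, ← Set.ncard_insert_of_notMem hnot
      ((finite_activeWords h n).image f)]
    refine Set.ncard_le_ncard ?_ (finite_activeWords h _)
    rintro w (rfl | ⟨v', hv', rfl⟩)
    · exact hact 1
    · exact (hf v' hv').1
  have hunb : ∀ k, ∃ n, k ≤ (activeWords h n).ncard := by
    intro k
    induction k with
    | zero => exact ⟨0, Nat.zero_le _⟩
    | succ k ih =>
      obtain ⟨n, hn⟩ := ih
      obtain ⟨m, hm⟩ := hgrow n
      exact ⟨m, by omega⟩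
  obtain ⟨n, hn⟩ := hunb (C + 1)
  exact absurd (hn.trans (hC n)) (by omega)

/-- One step inside the tiles: an element of the nucleus maps `u` to `v` with trivial
restriction. -/
def TileStep (G : Subgroup TreeAut) (u v : List (Fin 2)) : Prop :=
  ∃ g ∈ nucleus G, actW g u = v ∧ secW g u = 1

theorem TileStep.append {u v : List (Fin 2)} (h : TileStep G u v) (r : List (Fin 2)) :
    TileStep G (u ++ r) (v ++ r) := by
  obtain ⟨g, hg, rfl, h1⟩ := h
  exact ⟨g, hg, by rw [actW_append, h1, actW_one], by rw [secW_append, h1, secW_one]⟩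

theorem TileStep.smul {u v : List (Fin 2)} (h : TileStep G u v) :
    ∃ g ∈ nucleus G, ∀ z, g • prependWord u z = prependWord v z := by
  obtain ⟨g, hg, rfl, h1⟩ := h
  exact ⟨g, hg, fun z => by rw [smul_prependWord, h1, one_smul]⟩

theorem TileStep.symm {u v : List (Fin 2)} (h : TileStep G u v) : TileStep G v u := by
  obtain ⟨g, hg, rfl, h1⟩ := h
  exact ⟨g⁻¹, inv_mem_nucleus hg, actW_inv_actW g u, by rw [secW_inv_actW, h1, inv_one]⟩

/-- A contracting group whose tiles are connected. -/
structure TileConnected (G : Subgroup TreeAut) : Prop extends Contracting G where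
  exists_swap : ∃ g ∈ nucleus G, root g ≠ 1 ∧ ∃ x, sec g x = 1

/-- The switching element with a trivial restriction is lifted $n$ levels back inside the nucleus.
This produces an edge of the tile between the two halves given by the last letter. -/
theorem TileConnected.exists_tileStep (hG : TileConnected G) (n : ℕ) (x : Fin 2) :
    ∃ u v : List (Fin 2), u.length = n ∧ v.length = n ∧ TileStep G (u ++ [x]) (v ++ [x + 1]) := by
  obtain ⟨h, hh, hr, y, hy⟩ := hG.exists_swap
  obtain ⟨g, hg, u, hu, hgu⟩ := hG.exists_secW_eq hh n
  have hstep : TileStep G (u ++ [y]) (actW g u ++ [y + 1]) :=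
    ⟨g, hg, by simp [actW_append, hgu, perm_fin_two_apply hr], by simp [secW_append, hgu, hy]⟩
  by_cases hx : x = y
  · exact ⟨u, actW g u, hu, by simpa using hu, hx ▸ hstep⟩
  · obtain rfl := fin_two_eq_add_one hx
    exact ⟨actW g u, u, by simpa using hu, hu, by
      rw [fin_two_add_one_add_one]; exact hstep.symm⟩

/-- A tile of level $n+1$ is two copies of the tile of level $n$ joined by at least one edge. -/
theorem TileConnected.reflTransGen (hG : TileConnected G) {n : ℕ} {u v : List (Fin 2)}
    (hu : u.length = n) (hv : v.length = n) : ReflTransGen (TileStep G) u v := by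
  induction n generalizing u v with
  | zero =>
    rw [List.length_eq_zero_iff.1 hu, List.length_eq_zero_iff.1 hv]
  | succ n ih =>
    have happ : ∀ {u v : List (Fin 2)} (x : Fin 2), u.length = n → v.length = n →
        ReflTransGen (TileStep G) (u ++ [x]) (v ++ [x]) := fun x hu hv =>
      (ih hu hv).lift (· ++ [x]) fun _ _ h => h.append [x]
    obtain ⟨u', x, rfl⟩ := (List.eq_nil_or_concat' u).resolve_left (by rintro rfl; simp at hu)
    obtain ⟨v', y, rfl⟩ := (List.eq_nil_or_concat' v).resolve_left (by rintro rfl; simp at hv)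
    simp only [List.length_append, List.length_singleton, Nat.add_right_cancel_iff] at hu hv
    by_cases hxy : y = x
    · rw [hxy]; exact happ x hu hv
    · obtain rfl := fin_two_eq_add_one hxy
      obtain ⟨a, b, ha, hb, hab⟩ := hG.exists_tileStep n x
      exact ((happ x hu ha).tail hab).trans (happ (x + 1) hb hv)

/-- A step of the Schreier graph of the nucleus. -/
def NucleusStep (G : Subgroup TreeAut) (x y : BinSeq) : Prop := ∃ g ∈ nucleus G, g • x = y

theorem NucleusStep.symm {x y : BinSeq} (h : NucleusStep G x y) : NucleusStep G y x := by
  obtain ⟨g, hg, rfl⟩ := h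
  exact ⟨g⁻¹, inv_mem_nucleus hg, inv_smul_smul g x⟩

theorem TileConnected.reflTransGen_of_cofinal (hG : TileConnected G) {x y : BinSeq}
    (h : Cofinal x y) : ReflTransGen (NucleusStep G) x y := by
  obtain ⟨n, hn⟩ := h
  rw [← prependWord_prefixWord n x, ← prependWord_prefixWord n y, hn]
  exact (hG.reflTransGen (length_prefixWord n x) (length_prefixWord n y)).lift
    (fun v => prependWord v (tailSeq^[n] y)) fun _ _ h =>
      let ⟨g, hg, hz⟩ := h.smul; ⟨g, hg, hz _⟩

theorem TileConnected.mem_orbitSet_of_cofinal (hG : TileConnected G) {x y : BinSeq}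
    (h : Cofinal x y) : x ∈ orbitSet G y := by
  have hr := hG.reflTransGen_of_cofinal h.symm
  clear h
  induction hr with
  | refl => exact ⟨1, G.one_mem, one_smul _ _⟩
  | tail _ hbc ih =>
    obtain ⟨g, hg, rfl⟩ := hbc
    exact smul_mem_orbitSet ih (hG.nucleus_subset hg)

/-- The points of `U` that some element of the nucleus moves out of `U`. -/
def escapeSet (G : Subgroup TreeAut) (U : Set BinSeq) : Set BinSeq :=
  {x ∈ U | ∃ g ∈ nucleus G, g • x ∉ U}

theorem AlmostInvariant.finite_escapeSet (hG : Contracting G) {U : Set BinSeq}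
    (hU : AlmostInvariant G U) : (escapeSet G U).Finite := by
  refine (hG.finite_nucleus.biUnion fun g hg => hU g (hG.nucleus_subset hg)).subset ?_
  rintro x ⟨hx, g, hg, hgx⟩
  exact Set.mem_biUnion hg ⟨hx, hgx⟩

/-- A tile containing no escaping points of `U` is contained in `U` or disjoint from it. -/
theorem TileConnected.prependWord_mem (hG : TileConnected G) {U : Set BinSeq} {n : ℕ} {z : BinSeq}
    (hz : ∀ x ∈ escapeSet G U, tailSeq^[n] x ≠ z) {u v : List (Fin 2)} (hu : u.length = n)
    (hv : v.length = n) (h : prependWord u z ∈ U) : prependWord v z ∈ U := by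
  have hr := hG.reflTransGen hu hv
  clear hv
  have key : prependWord v z ∈ U ∧ v.length = n := by
    induction hr with
    | refl => exact ⟨h, hu⟩
    | tail _ hbc ih =>
      obtain ⟨ihU, ihl⟩ := ih
      obtain ⟨g, hg, rfl, h1⟩ := hbc
      refine ⟨?_, by simpa using ihl⟩
      by_contra hcon
      refine hz _ ⟨ihU, g, hg, ?_⟩ (by rw [← ihl]; exact tailSeq_iterate_prependWord _ _)
      rwa [smul_prependWord, h1, one_smul]
  exact key.1

/-- Elements of the nucleus do not leave the set of tiles contained in `U` except from tiles
containing escaping points. -/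
theorem TileConnected.prependWord_smul_mem (hG : TileConnected G) {U : Set BinSeq} {n : ℕ}
    {z : BinSeq} (hz : ∀ x ∈ escapeSet G U, tailSeq^[n] x ≠ z) {u v : List (Fin 2)}
    (hu : u.length = n) {h : TreeAut} (hh : h ∈ nucleus G)
    (hz' : ∀ x ∈ escapeSet G U, tailSeq^[n] x ≠ h • z) (hv : v.length = n)
    (hU : prependWord u z ∈ U) : prependWord v (h • z) ∈ U := by
  obtain ⟨g, hg, r, hr, rfl⟩ := hG.exists_secW_eq hh n
  refine hG.prependWord_mem hz' (u := actW g r) (by simpa using hr) hv ?_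
  by_contra hcon
  refine hz _ ⟨hG.prependWord_mem hz hu hr hU, g, hg, ?_⟩
    (by rw [← hr]; exact tailSeq_iterate_prependWord _ _)
  rwa [smul_prependWord]

/-- At a suitable level $n$ all restrictions of $g$ lie in the nucleus. Then $g$ can leave $U$ only
from a tile that contains an escaping point or is carried by the nucleus to one that does; these
tiles are finite in number. -/
theorem TileConnected.almostInvariant (hG : TileConnected G) {U : Set BinSeq}
    (hU : (escapeSet G U).Finite) : AlmostInvariant G U := by
  intro g hg
  obtain ⟨n, hn⟩ := hG.exists_secW_mem_nucleus hg
  let E := tailSeq^[n] '' escapeSet G U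
  have hE : E.Finite := hU.image _
  have hfin : (⋃ h ∈ nucleus G, ⋃ z ∈ E, {x | tailSeq^[n] x = h⁻¹ • z}).Finite :=
    hG.finite_nucleus.biUnion fun h _ => hE.biUnion fun z _ => finite_tailSeq_iterate_eq n _
  refine hfin.subset ?_
  rintro x ⟨hx, hgx⟩
  by_contra hcon
  have hnot : ∀ h ∈ nucleus G, ∀ y ∈ escapeSet G U, tailSeq^[n] y ≠ h • tailSeq^[n] x := by
    intro h hh y hy he
    refine hcon (Set.mem_biUnion hh (Set.mem_biUnion ⟨y, hy, rfl⟩ ?_))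
    rw [Set.mem_ofPred_eq, he, inv_smul_smul]
  refine hgx ?_
  rw [← prependWord_prefixWord n x, smul_prependWord]
  have hN := hn (prefixWord n x) (by simp)
  refine hG.prependWord_smul_mem (n := n) ?_ (length_prefixWord n x) hN (hnot _ hN) (by simp) ?_
  · have := hnot 1 one_mem_nucleus
    simpa using this
  · rwa [prependWord_prefixWord]

end TreeAut

/-! ### Cut points and the bound on degrees -/

namespace TreeAut

variable {G : Subgroup TreeAut}

/-- Reachability in the Schreier graph of the nucleus without entering `z`. -/
def ReachAvoiding (G : Subgroup TreeAut) (z : BinSeq) : BinSeq → BinSeq → Prop :=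
  ReflTransGen fun x y => NucleusStep G x y ∧ y ≠ z

theorem ReachAvoiding.ne {z u v : BinSeq} (h : ReachAvoiding G z u v) (hu : u ≠ z) : v ≠ z := by
  cases h with
  | refl => exact hu
  | tail _ h => exact h.2

theorem ReachAvoiding.symm {z u v : BinSeq} (h : ReachAvoiding G z u v) (hu : u ≠ z) :
    ReachAvoiding G z v u := by
  induction h with
  | refl => exact ReflTransGen.refl
  | tail hab hbc ih => exact ih.head ⟨hbc.1.symm, ReachAvoiding.ne hab hu⟩

theorem IsGeneric.cofinal_of_nucleusStep (hG : Contracting G) {w x y : BinSeq}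
    (hw : IsGeneric G w) (hx : Cofinal x w) (h : NucleusStep G x y) : Cofinal y w := by
  obtain ⟨g, hg, rfl⟩ := h
  exact (hw x hx g (hG.nucleus_subset hg)).trans hx

theorem IsGeneric.cofinal_of_reachAvoiding (hG : Contracting G) {w z x y : BinSeq}
    (hw : IsGeneric G w) (hx : Cofinal x w) (h : ReachAvoiding G z x y) : Cofinal y w := by
  induction h with
  | refl => exact hx
  | tail _ h ih => exact hw.cofinal_of_nucleusStep hG ih h.1

theorem exists_reachAvoiding_of_reflTransGen {z y : BinSeq}
    (h : ReflTransGen (NucleusStep G) z y) (hy : y ≠ z) :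
    ∃ g ∈ nucleus G, g • z ≠ z ∧ ReachAvoiding G z (g • z) y := by
  induction h with
  | refl => exact absurd rfl hy
  | @tail b c _ hbc ih =>
    by_cases hb : b = z
    · subst hb
      obtain ⟨g, hg, rfl⟩ := hbc
      exact ⟨g, hg, hy, ReflTransGen.refl⟩
    · obtain ⟨g, hg, hgz, hr⟩ := ih hb
      exact ⟨g, hg, hgz, hr.tail ⟨hbc, hy⟩⟩

/-- The component of `u` after removal of `z` is not contained in any tile. -/
def UnboundedAvoiding (G : Subgroup TreeAut) (z u : BinSeq) : Prop :=
  ∀ n : ℕ, ∃ v, ReachAvoiding G z u v ∧ tailSeq^[n] v ≠ tailSeq^[n] z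

/-- Removing the vertex `z` from its Schreier graph leaves at least two unbounded components. -/
def IsCutPoint (G : Subgroup TreeAut) (z : BinSeq) : Prop :=
  ∃ g ∈ nucleus G, ∃ h ∈ nucleus G, g • z ≠ z ∧ h • z ≠ z ∧ ¬ ReachAvoiding G z (g • z) (h • z) ∧
    UnboundedAvoiding G z (g • z) ∧ UnboundedAvoiding G z (h • z)

/-- Away from the tile of $z$ nothing escapes from $U$, so the tiles inside $U$ form whole
components of the shifted graph with $z$ removed. Every such component starts at one of the finitely
many neighbours of $z$; if all were bounded, $U$ would be finite. -/
theorem TileConnected.exists_unboundedAvoiding (hG : TileConnected G) {w : BinSeq} {n : ℕ}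
    {U : Set BinSeq} (hUw : ∀ x ∈ U, Cofinal x w) (hinf : U.Infinite)
    (hesc : ∀ x ∈ escapeSet G U, tailSeq^[n] x = tailSeq^[n] w) {u : List (Fin 2)}
    (hu : u.length = n) :
    ∃ g ∈ nucleus G, g • tailSeq^[n] w ≠ tailSeq^[n] w ∧
      UnboundedAvoiding G (tailSeq^[n] w) (g • tailSeq^[n] w) ∧
      ∀ y, ReachAvoiding G (tailSeq^[n] w) (g • tailSeq^[n] w) y → prependWord u y ∈ U := by
  set z := tailSeq^[n] w with hz
  have hstep : ∀ {x y : BinSeq}, x ≠ z → ReachAvoiding G z x y → prependWord u x ∈ U →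
      prependWord u y ∈ U := by
    intro x y hx h hxU
    induction h with
    | refl => exact hxU
    | @tail b c hab hbc ih =>
      have hb : b ≠ z := ReachAvoiding.ne hab hx
      obtain ⟨⟨g, hg, rfl⟩, hc⟩ := hbc
      exact hG.prependWord_smul_mem (fun x hx he => hb (by rw [← he, hesc x hx])) hu hg
        (fun x hx he => hc (by rw [← he, hesc x hx])) hu ih
  by_contra! hcon
  -- For a relevant neighbour, $m$ is a level at which its component lies in the tile of $z$; other
  -- elements receive the default 0.
  have hb : ∀ g : TreeAut, ∃ m, g ∈ nucleus G → g • z ≠ z → prependWord u (g • z) ∈ U →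
      ∀ y, ReachAvoiding G z (g • z) y → tailSeq^[m] y = tailSeq^[m] z := by
    intro g
    by_cases hg : g ∈ nucleus G ∧ g • z ≠ z ∧ prependWord u (g • z) ∈ U
    · by_cases hunb : UnboundedAvoiding G z (g • z)
      · obtain ⟨y, hy, hyU⟩ := hcon g hg.1 hg.2.1 hunb
        exact absurd (hstep hg.2.1 hy hg.2.2) hyU
      · unfold UnboundedAvoiding at hunb
        push Not at hunb
        obtain ⟨m, hm⟩ := hunb
        exact ⟨m, fun _ _ _ => hm⟩
    · exact ⟨0, fun h1 h2 h3 => absurd ⟨h1, h2, h3⟩ hg⟩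
  choose m hm using hb
  let M := hG.finite_nucleus.toFinset.sup m
  refine hinf ((finite_tailSeq_iterate_eq (M + n) (tailSeq^[M] z)).subset fun x hx => ?_)
  rw [Set.mem_ofPred_eq, Function.iterate_add_apply]
  by_cases hxz : tailSeq^[n] x = z
  · rw [hxz]
  have hcof : Cofinal z (tailSeq^[n] x) := by
    obtain ⟨k, hk⟩ := hUw x hx
    refine ⟨k, ?_⟩
    rw [hz, ← Function.iterate_add_apply, ← Function.iterate_add_apply, add_comm,
      Function.iterate_add_apply, Function.iterate_add_apply, hk]
  obtain ⟨g, hg, hgz, hr⟩ := exists_reachAvoiding_of_reflTransGen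
    (hG.reflTransGen_of_cofinal hcof) hxz
  have hxU : prependWord u (tailSeq^[n] x) ∈ U := by
    refine hG.prependWord_mem (fun y hy he => hxz (by rw [← he, hesc y hy]))
      (length_prefixWord n x) hu ?_
    rwa [prependWord_prefixWord]
  have hgU := hstep (ReachAvoiding.ne hr hgz) (hr.symm hgz) hxU
  exact tailSeq_iterate_eq_of_le (hm g hg hgz hgU _ hr)
    (Finset.le_sup (f := m) (by simpa using hg))

/-- Each of the two pieces supplies an unbounded component, and disjointness of the pieces keeps the
components apart. The word of zeros is just one fixed position within the tiles. -/
theorem TileConnected.eventually_isCutPoint (hG : TileConnected G) {w : BinSeq}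
    (hw : IsGeneric G w) (h2 : HasPieces G w 2) : ∃ n, ∀ m, n ≤ m → IsCutPoint G (tailSeq^[m] w) := by
  obtain ⟨U, hd, hU⟩ := h2
  have hcof : ∀ i, ∀ x ∈ U i, Cofinal x w := fun i x hx => hw.orbitSet_subset x ((hU i).1 hx)
  have hfin : ∀ i, (escapeSet G (U i)).Finite := fun i =>
    (hU i).2.2.finite_escapeSet hG.toContracting
  choose n hn using fun i => exists_tailSeq_iterate_eq_of_finite (hfin i)
    fun x hx => hcof i x hx.1
  refine ⟨max (n 0) (n 1), fun m hm => ?_⟩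
  have key := fun i => hG.exists_unboundedAvoiding (n := m) (u := List.replicate m 0) (hcof i)
    (hU i).2.1 (hn i m (by fin_cases i <;> simp at * <;> omega)) (by simp)
  obtain ⟨g, hg, hgz, hgu, hgU⟩ := key 0
  obtain ⟨h, hh, hhz, hhu, hhU⟩ := key 1
  refine ⟨g, hg, h, hh, hgz, hhz, fun hr => ?_, hgu, hhu⟩
  exact Set.disjoint_left.1 (hd (show (0 : Fin 2) ≠ 1 by decide)) (hgU _ hr)
    (hhU _ ReflTransGen.refl)

/-- The path starting at `x` and applying the elements of `l` from right to left stays away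
from `z`. -/
def PathAvoids (z x : BinSeq) : List TreeAut → Prop
  | [] => True
  | g :: l => PathAvoids z x l ∧ (g :: l).prod • x ≠ z

theorem reachAvoiding_iff {z u v : BinSeq} : ReachAvoiding G z u v ↔
    ∃ l : List (nucleus G), PathAvoids z u (l.map Subtype.val) ∧
      (l.map Subtype.val).prod • u = v := by
  constructor
  · intro h
    induction h with
    | refl => exact ⟨[], trivial, one_smul _ _⟩
    | tail _ hbc ih =>
      obtain ⟨l, hl, rfl⟩ := ih
      obtain ⟨⟨g, hg, rfl⟩, hc⟩ := hbc
      refine ⟨⟨g, hg⟩ :: l, ⟨hl, ?_⟩, ?_⟩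
      · simpa [mul_smul] using hc
      · simp [mul_smul]
  · rintro ⟨l, hl, rfl⟩
    induction l with
    | nil => rw [List.map_nil, List.prod_nil, one_smul]; exact ReflTransGen.refl
    | cons g l ih =>
      obtain ⟨hl, hne⟩ := hl
      refine (ih hl).tail ⟨⟨g, g.2, ?_⟩, hne⟩
      simp [mul_smul]

theorem measurableSet_pathAvoids (g : TreeAut) (l : List TreeAut) :
    MeasurableSet {z : BinSeq | PathAvoids z (g • z) l} := by
  induction l with
  | nil => simp [PathAvoids]
  | cons h l ih =>
    refine ih.inter (MeasurableSet.compl ?_)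
    exact measurableSet_eq_fun ((measurable_smul _).comp (measurable_smul g)) measurable_id

/-- Reachability is a countable union over finite lists from the nucleus, which makes the
shift-invariance argument applicable to cut points. -/
theorem measurableSet_isCutPoint (hG : Contracting G) :
    MeasurableSet {z : BinSeq | IsCutPoint G z} := by
  have := hG.finite_nucleus.countable.to_subtype
  have hreach : ∀ g h : TreeAut, MeasurableSet {z : BinSeq | ReachAvoiding G z (g • z) (h • z)} := by
    intro g h
    simp only [reachAvoiding_iff, Set.ofPred_exists]
    refine MeasurableSet.iUnion fun l => (measurableSet_pathAvoids g _).inter ?_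
    exact measurableSet_eq_fun ((measurable_smul _).comp (measurable_smul g)) (measurable_smul h)
  have hunb : ∀ g : TreeAut, MeasurableSet {z : BinSeq | UnboundedAvoiding G z (g • z)} := by
    intro g
    have heq : {z : BinSeq | UnboundedAvoiding G z (g • z)} = ⋂ n : ℕ, ⋃ l : List (nucleus G),
        {z : BinSeq | PathAvoids z (g • z) (l.map Subtype.val)} ∩
        {z : BinSeq | tailSeq^[n] ((l.map Subtype.val).prod • g • z) = tailSeq^[n] z}ᶜ := by
      ext z
      simp only [UnboundedAvoiding, reachAvoiding_iff, Set.mem_iInter, Set.mem_iUnion,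
        Set.mem_ofPred_eq, Set.mem_inter_iff, Set.mem_compl_iff]
      refine forall_congr' fun n => ⟨?_, ?_⟩
      · rintro ⟨v, ⟨l, hl, rfl⟩, hv⟩
        exact ⟨l, hl, hv⟩
      · rintro ⟨l, hl, hv⟩
        exact ⟨_, ⟨l, hl, rfl⟩, hv⟩
    rw [heq]
    refine MeasurableSet.iInter fun n => MeasurableSet.iUnion fun l =>
      (measurableSet_pathAvoids g _).inter (MeasurableSet.compl ?_)
    exact measurableSet_eq_fun ((measurable_tailSeq.iterate n).comp
      ((measurable_smul _).comp (measurable_smul g))) (measurable_tailSeq.iterate n)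
  have heq : {z : BinSeq | IsCutPoint G z} = ⋃ g ∈ nucleus G, ⋃ h ∈ nucleus G,
      {z : BinSeq | g • z = z}ᶜ ∩ ({z : BinSeq | h • z = z}ᶜ ∩
        ({z : BinSeq | ReachAvoiding G z (g • z) (h • z)}ᶜ ∩
        ({z : BinSeq | UnboundedAvoiding G z (g • z)} ∩
          {z : BinSeq | UnboundedAvoiding G z (h • z)}))) := by
    ext z
    simp only [IsCutPoint, Set.mem_iUnion, Set.mem_inter_iff, Set.mem_compl_iff,
      Set.mem_ofPred_eq, exists_prop, Ne]
  rw [heq]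
  refine MeasurableSet.biUnion hG.finite_nucleus.countable fun g _ =>
    MeasurableSet.biUnion hG.finite_nucleus.countable fun h _ => ?_
  exact (measurableSet_eq_fun (measurable_smul g) measurable_id).compl.inter
    ((measurableSet_eq_fun (measurable_smul h) measurable_id).compl.inter
      ((hreach g h).compl.inter ((hunb g).inter (hunb h))))

/-- In an almost surely two-ended Schreier graph almost all vertices are cut points. -/
theorem TileConnected.ae_isCutPoint (hG : TileConnected G)
    (hgen : ∀ᵐ w ∂bernoulliMeasure, IsGeneric G w)
    (h2 : ∀ᵐ w ∂bernoulliMeasure, HasPieces G w 2) :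
    ∀ᵐ w ∂bernoulliMeasure, IsCutPoint G w := by
  refine ae_of_ae_eventually_tailSeq (measurableSet_isCutPoint hG.toContracting) ?_
  filter_upwards [hgen, h2] with w hw hw2
  exact hG.eventually_isCutPoint hw hw2

/-- Each neighbour $v_i$ is a cut point, so some unbounded component behind it misses $u$. The three
components obtained are infinite, pairwise disjoint and leak only towards their $v_i$. -/
theorem TileConnected.not_three_neighbors (hG : TileConnected G) {w : BinSeq}
    (hw : IsGeneric G w) (hcut : ∀ u, Cofinal u w → IsCutPoint G u) (h3 : ¬ HasPieces G w 3)
    {u : BinSeq} (hu : Cofinal u w) (v : Fin 3 → BinSeq) (hv : Function.Injective v)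
    (huv : ∀ i, NucleusStep G u (v i)) (hne : ∀ i, v i ≠ u) : False := by
  have hvw : ∀ i, Cofinal (v i) w := fun i => hw.cofinal_of_nucleusStep hG.toContracting hu (huv i)
  have h1 : ∀ i, ∃ a, NucleusStep G (v i) a ∧ a ≠ v i ∧ UnboundedAvoiding G (v i) a ∧
      ¬ ReachAvoiding G (v i) a u := by
    intro i
    obtain ⟨g, hg, h, hh, hgz, hhz, hr, hgu, hhu⟩ := hcut (v i) (hvw i)
    by_cases hga : ReachAvoiding G (v i) (g • v i) u
    · refine ⟨h • v i, ⟨h, hh, rfl⟩, hhz, hhu, fun hha => hr ?_⟩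
      exact ReflTransGen.trans hga (hha.symm hhz)
    · exact ⟨g • v i, ⟨g, hg, rfl⟩, hgz, hgu, hga⟩
  choose a ha hane hunb hnot using h1
  let W : Fin 3 → Set BinSeq := fun i => {y | ReachAvoiding G (v i) (a i) y}
  have hWw : ∀ i, ∀ y ∈ W i, Cofinal y w := fun i y hy =>
    hw.cofinal_of_reachAvoiding hG.toContracting
      (hw.cofinal_of_nucleusStep hG.toContracting (hvw i) (ha i)) hy
  have hvW : ∀ i j, v j ∉ W i := by
    intro i j hj
    by_cases hij : j = i
    · subst hij
      exact ReachAvoiding.ne hj (hane j) rfl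
    · exact hnot i (ReflTransGen.tail hj ⟨(huv j).symm, (hne i).symm⟩)
  -- From a common point one can walk within $W_i$ to $a_i$ without meeting $v_j$, hence within
  -- $W_j$. One more step puts $v_i$ into $W_j$, which contains no $v$.
  have hdisj : ∀ i j, i ≠ j → ∀ x ∈ W i, x ∉ W j := by
    intro i j hij x hxi hxj
    have hback : ReachAvoiding G (v i) x (a i) := hxi.symm (hane i)
    have key : ∀ b, ReachAvoiding G (v i) x b → b ∈ W i ∧ b ∈ W j := by
      intro b hb
      induction hb with
      | refl => exact ⟨hxi, hxj⟩
      | @tail b c _ hbc ih =>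
        have hc : c ∈ W i := ReflTransGen.tail ih.1 hbc
        exact ⟨hc, ReflTransGen.tail ih.2 ⟨hbc.1, fun he => hvW i j (he ▸ hc)⟩⟩
    exact hvW j i (ReflTransGen.tail (key _ hback).2 ⟨(ha i).symm, fun he => hij (hv he)⟩)
  refine h3 ⟨W, fun i j hij => Set.disjoint_left.2 (hdisj i j hij), fun i => ⟨?_, ?_, ?_⟩⟩
  · exact fun y hy => hG.mem_orbitSet_of_cofinal (hWw i y hy)
  · intro hfin
    obtain ⟨n, hn⟩ := exists_tailSeq_iterate_eq_of_finite hfin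
      fun y hy => (hWw i y hy).trans (hvw i).symm
    obtain ⟨y, hy, hyn⟩ := hunb i n
    exact hyn (hn n le_rfl y hy)
  · refine hG.almostInvariant ((hG.finite_nucleus.image fun g => g⁻¹ • v i).subset ?_)
    rintro x ⟨hx, g, hg, hgx⟩
    refine ⟨g, hg, ?_⟩
    by_contra hcon
    refine hgx (ReflTransGen.tail hx ⟨⟨g, hg, rfl⟩, fun he => hcon ?_⟩)
    simp only [← he, inv_smul_smul]

end TreeAut

/-! ### Degree count on words of length two, and necessity -/

/-- Connectedness gives $2(|V|-1)\le 2|E|$, while the degree sum $2|E|$ is at most $2|V|-|P|$. -/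
theorem SimpleGraph.Connected.card_degree_le_one {V : Type*} [Fintype V] {Γ : SimpleGraph V}
    [DecidableRel Γ.Adj] (hΓ : Γ.Connected) (h2 : ∀ v, Γ.degree v ≤ 2) (P : Finset V)
    (hP : ∀ v ∈ P, Γ.degree v ≤ 1) : P.card ≤ 2 := by
  classical
  have h1 := hΓ.card_vert_le_card_edgeSet_add_one
  rw [Nat.card_eq_fintype_card, Nat.card_eq_fintype_card, ← SimpleGraph.edgeFinset_card] at h1
  have h3 := Γ.sum_degrees_eq_twice_card_edges
  have h4 : ∑ v, Γ.degree v + P.card ≤ 2 * Fintype.card V := by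
    have : P.card = ∑ v, if v ∈ P then 1 else 0 := by simp
    rw [this, ← Finset.sum_add_distrib]
    calc ∑ v, (Γ.degree v + if v ∈ P then 1 else 0) ≤ ∑ _v : V, 2 := by
          refine Finset.sum_le_sum fun v _ => ?_
          split_ifs with hv
          · have := hP v hv; omega
          · exact h2 v
      _ = 2 * Fintype.card V := by simp [mul_comm]
  omega

namespace TreeAut

variable {G : Subgroup TreeAut}

/-- The tile graph on the words of length two. -/
def tileGraph (G : Subgroup TreeAut) : SimpleGraph (Fin 2 × Fin 2) where
  Adj p q := p ≠ q ∧ TileStep G [p.1, p.2] [q.1, q.2]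
  symm := ⟨fun _ _ h => ⟨h.1.symm, h.2.symm⟩⟩
  loopless := ⟨fun _ h => h.1 rfl⟩

theorem TileConnected.connected_tileGraph (hG : TileConnected G) : (tileGraph G).Connected := by
  have key : ∀ (p : Fin 2 × Fin 2) (v : List (Fin 2)), ReflTransGen (TileStep G) [p.1, p.2] v →
      ∃ q : Fin 2 × Fin 2, v = [q.1, q.2] ∧ (tileGraph G).Reachable p q := by
    intro p v h
    induction h with
    | refl => exact ⟨p, rfl, SimpleGraph.Reachable.refl p⟩
    | @tail b c _ hbc ih =>
      obtain ⟨q, rfl, hq⟩ := ih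
      have hl : c.length = 2 := by
        obtain ⟨g, -, rfl, -⟩ := hbc
        simp
      obtain ⟨x, y, rfl⟩ := List.length_eq_two.1 hl
      refine ⟨(x, y), rfl, ?_⟩
      by_cases hxy : q = (x, y)
      · exact hxy ▸ hq
      · exact hq.trans (SimpleGraph.Adj.reachable (show (tileGraph G).Adj q (x, y) from ⟨hxy, hbc⟩))
  have : Nonempty (Fin 2 × Fin 2) := ⟨(0, 0)⟩
  refine ⟨fun p q => ?_⟩
  obtain ⟨q', hq, hr⟩ := key p _ (hG.reflTransGen (n := 2) (v := [q.1, q.2]) rfl rfl)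
  have : q = q' := by
    simp only [List.cons.injEq, and_true] at hq
    exact Prod.ext hq.1 hq.2
  exact this ▸ hr

/-- For almost every tail $z$ all Schreier degrees are at most two. A word with a nontrivial
restriction has, over a suitable tail, a neighbour outside its tile, which leaves at most one
neighbour inside. -/
theorem TileConnected.ncard_active_le_two (hG : TileConnected G)
    (hgen : ∀ᵐ w ∂bernoulliMeasure, IsGeneric G w)
    (h2 : ∀ᵐ w ∂bernoulliMeasure, HasPieces G w 2)
    (h3 : ∀ᵐ w ∂bernoulliMeasure, ¬ HasPieces G w 3) :
    {p : Fin 2 × Fin 2 | ∃ g ∈ nucleus G, sec (sec g p.1) p.2 ≠ 1}.ncard ≤ 2 := by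
  classical
  have hcut := hG.ae_isCutPoint hgen h2
  have hdeg : ∀ᵐ w ∂bernoulliMeasure, ∀ u, Cofinal u w → ∀ v : Fin 3 → BinSeq,
      Function.Injective v → (∀ i, NucleusStep G u (v i)) → (∀ i, v i ≠ u) → False := by
    filter_upwards [hgen, h3, ae_forall_cofinal hcut] with w hw hw3 hwc u hu
    exact hG.not_three_neighbors hw hwc hw3 hu
  let word : Fin 2 × Fin 2 → BinSeq → BinSeq := fun p z => prependWord [p.1, p.2] z
  have hword : ∀ {p q : Fin 2 × Fin 2} {z z' : BinSeq}, word p z = word q z' → p = q := by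
    intro p q z z' h
    have h' := ((prependWord_inj (u := [p.1, p.2]) (v := [q.1, q.2]) rfl).1 h).1
    simp only [List.cons.injEq, and_true] at h'
    exact Prod.ext h'.1 h'.2
  have hnbr : ∀ {p q : Fin 2 × Fin 2} (z), (tileGraph G).Adj p q →
      NucleusStep G (word p z) (word q z) := by
    rintro p q z ⟨-, h⟩
    obtain ⟨g, hg, hz⟩ := h.smul
    exact ⟨g, hg, hz z⟩
  have hdegW : ∀ p : Fin 2 × Fin 2, ∀ᵐ z ∂bernoulliMeasure, ∀ v : Fin 3 → BinSeq,
      Function.Injective v → (∀ i, NucleusStep G (word p z) (v i)) →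
      (∀ i, v i ≠ word p z) → False := by
    intro p
    filter_upwards [ae_prependWord hdeg [p.1, p.2]] with z hz
    exact hz _ (Cofinal.refl _)
  have hemb : ∀ (p : Fin 2 × Fin 2) (k : ℕ), k ≤ (tileGraph G).degree p →
      ∃ q : Fin k → Fin 2 × Fin 2, Function.Injective q ∧ ∀ i, (tileGraph G).Adj p (q i) := by
    intro p k hk
    obtain ⟨f⟩ := Function.Embedding.nonempty_of_card_le
      (α := Fin k) (β := (tileGraph G).neighborFinset p)
      (by rw [Fintype.card_fin, Fintype.card_coe]; exact hk)
    exact ⟨fun i => f i, fun i j hij => f.injective (Subtype.ext hij),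
      fun i => (SimpleGraph.mem_neighborFinset _ _ _).1 (f i).2⟩
  let P : Finset (Fin 2 × Fin 2) :=
    Finset.univ.filter fun p => ∃ g ∈ nucleus G, sec (sec g p.1) p.2 ≠ 1
  have hP : P.card ≤ 2 := by
    refine hG.connected_tileGraph.card_degree_le_one (fun p => ?_) P fun p hp => ?_
    · by_contra! hcon
      obtain ⟨q, hq, hpq⟩ := hemb p 3 hcon
      obtain ⟨z, hz⟩ := (hdegW p).exists
      refine hz (fun i => word (q i) z) (fun i j hij => hq (hword hij)) (fun i => hnbr z (hpq i))
        fun i he => (hpq i).1 (hword he).symm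
    · by_contra! hcon
      obtain ⟨q, hq, hpq⟩ := hemb p 2 hcon
      obtain ⟨g, hg, hgp⟩ := (Finset.mem_filter.1 hp).2
      obtain ⟨v, hv⟩ := exists_secW_root_ne_one hgp
      -- The tail is made to start with $v0$, where the restriction switches the letter after $v$;
      -- it is then certainly moved, so the extra neighbour lies in another tile.
      obtain ⟨z, hz⟩ := (ae_prependWord (hdegW p) (v ++ [0])).exists
      set z' := prependWord (v ++ [0]) z
      have hmove : sec (sec g p.1) p.2 • z' ≠ z' := by
        intro he
        rw [smul_prependWord, prependWord_inj (by simp)] at he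
        have h1 := he.1
        rw [actW_append] at h1
        have h2 := List.append_inj_right' h1 (by simp)
        simp only [actW_cons, actW_nil, List.cons.injEq, and_true] at h2
        rw [perm_fin_two_apply hv] at h2
        exact absurd h2 (by decide)
      have hg' : g • word p z' = prependWord (actW g [p.1, p.2]) (sec (sec g p.1) p.2 • z') :=
        smul_prependWord g [p.1, p.2] z'
      have htail : ∀ q : Fin 2 × Fin 2, g • word p z' ≠ word q z' := by
        intro q he
        rw [hg', prependWord_inj (by simp)] at he
        exact hmove he.2
      refine hz (Fin.cons (g • word p z') fun i => word (q i) z')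
        (Fin.cons_injective_iff.2 ⟨?_, fun i j hij => hq (hword hij)⟩) (fun i => ?_) fun i => ?_
      · rintro ⟨i, hi⟩
        exact htail (q i) hi.symm
      · refine Fin.cases ?_ (fun i => ?_) i
        · exact ⟨g, hg, rfl⟩
        · exact hnbr z' (hpq i)
      · refine Fin.cases ?_ (fun i => ?_) i
        · exact htail p
        · exact fun he => (hpq i).1 (hword he).symm
  rw [← Set.ncard_coe_finset] at hP
  simpa [P] using hP

end TreeAut

namespace Transducer

open TreeAut

variable {S : Type*} {A : Transducer S (Fin 2)}

/-- Without a switching element the nucleus is trivial, so all group elements have one common depth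
bound and orbits are finite. -/
theorem IsBounded.exists_root_ne_one (hA : A.IsBounded) {w : BinSeq}
    (h2 : HasPieces A.treeGroup w 2) : ∃ h ∈ nucleus A.treeGroup, root h ≠ 1 := by
  have := hA.1
  by_contra! hcon
  have hN : ∀ h ∈ nucleus A.treeGroup, h = 1 := by
    intro h hh
    by_contra h1
    obtain ⟨v, hv⟩ := exists_secW_root_ne_one h1
    exact hv (hcon _ (secW_mem_nucleus hh v))
  choose n hn using fun s => hA.contracting.exists_secW_mem_nucleus (A.aut_mem_treeGroup s)
  obtain ⟨m, hm⟩ := (Set.finite_range n).bddAbove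
  have hG : ∀ g ∈ A.treeGroup, g ∈ depthLE m := by
    intro g hg
    induction hg using Subgroup.closure_induction with
    | mem g hg =>
      obtain ⟨s, rfl⟩ := hg
      intro v hv
      exact hN _ (hn s v (by rw [hv]; exact hm ⟨s, rfl⟩))
    | one => exact one_mem_depthLE m
    | mul g h _ _ ihg ihh => exact mul_mem_depthLE ihg ihh
    | inv g _ ih => exact inv_mem_depthLE ih
  obtain ⟨U, -, hU⟩ := h2
  refine (hU 0).2.1 ((finite_tailSeq_iterate_eq m (tailSeq^[m] w)).subset fun x hx => ?_)
  obtain ⟨g, hg, rfl⟩ := (hU 0).1 hx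
  have h1 : secW g (prefixWord m w) = 1 := hG g hg _ (length_prefixWord m w)
  rw [Set.mem_ofPred_eq]
  conv_lhs => rw [← prependWord_prefixWord m w, smul_prependWord, h1, one_smul]
  have := tailSeq_iterate_prependWord (actW g (prefixWord m w)) (tailSeq^[m] w)
  rwa [length_actW, length_prefixWord] at this

theorem IsBounded.nucleus_of_ae_hasTwoEnds (hA : A.IsBounded)
    (h : ∀ᵐ w ∂bernoulliMeasure, HasTwoEnds (A.schreierGraph w)) :
    (∃ a : TreeAut, IsAddingMachine a.1 ∧ nucleus A.treeGroup = {a, a⁻¹, 1}) ∨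
      ∃ (k : ℕ) (ρ : (Fin k → ZMod 2) ≃+ (Fin k → ZMod 2)) (ω : (Fin k → ZMod 2) →+ ZMod 2)
        (e : Equiv.Perm (Fin 2)), Function.Surjective ω ∧
        nucleus A.treeGroup = Set.range ((sunicTransducer ρ ω).relabel e).aut := by
  have := hA.1
  have h2 : ∀ᵐ w ∂bernoulliMeasure, HasPieces A.treeGroup w 2 :=
    h.mono fun w hw => ((hasTwoEnds_iff w).1 hw).1
  have h3 : ∀ᵐ w ∂bernoulliMeasure, ¬ HasPieces A.treeGroup w 3 :=
    h.mono fun w hw => ((hasTwoEnds_iff w).1 hw).2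
  obtain ⟨w, hw⟩ := h2.exists
  have hne := hA.exists_root_ne_one hw
  have hG : TileConnected A.treeGroup :=
    { hA.contracting with
      exists_swap := exists_swap_with_trivial_sec
        (fun g hg => hA.isBdd_of_mem (hA.contracting.nucleus_subset hg)) hne }
  exact hA.contracting.nucleus_classification hne
    (hG.ncard_active_le_two hA.ae_isGeneric h2 h3)

end Transducer

/-! ### Sufficiency: groups moving points boundedly along a line -/

namespace TreeAut

variable {G : Subgroup TreeAut}

/-- The element `g` moves the points of the line `φ` along the line, by a bounded amount. -/
def MovesBoundedly (φ : ℤ → BinSeq) (g : TreeAut) : Prop :=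
  ∃ C : ℤ, ∀ i, ∃ j, |i - j| ≤ C ∧ g • φ i = φ j

theorem MovesBoundedly.mul {φ : ℤ → BinSeq} {g h : TreeAut} (hg : MovesBoundedly φ g)
    (hh : MovesBoundedly φ h) : MovesBoundedly φ (g * h) := by
  obtain ⟨C, hC⟩ := hg
  obtain ⟨C', hC'⟩ := hh
  refine ⟨C + C', fun i => ?_⟩
  obtain ⟨j, hj, hij⟩ := hC' i
  obtain ⟨k, hk, hjk⟩ := hC j
  exact ⟨k, by have := abs_sub_le i j k; omega, by rw [mul_smul, hij, hjk]⟩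

theorem orbitSet_eq_range {w : BinSeq} {φ : ℤ → BinSeq} (hw : φ 0 = w)
    (hmove : ∀ g ∈ G, MovesBoundedly φ g) (hstep : ∀ i, ∃ g ∈ G, g • φ i = φ (i + 1)) :
    orbitSet G w = Set.range φ := by
  refine Set.Subset.antisymm ?_ ?_
  · rintro _ ⟨g, hg, rfl⟩
    obtain ⟨C, hC⟩ := hmove g hg
    obtain ⟨j, -, hj⟩ := hC 0
    exact ⟨j, by rw [← hj, hw]⟩
  · rintro _ ⟨i, rfl⟩
    induction i using Int.induction_on with
    | zero => exact ⟨1, one_mem G, by rw [one_smul, hw]⟩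
    | succ i ih =>
      obtain ⟨g, hg, hgi⟩ := hstep i
      exact hgi ▸ smul_mem_orbitSet ih hg
    | pred i ih =>
      obtain ⟨g, hg, hgi⟩ := hstep (-i - 1)
      rw [sub_add_cancel] at hgi
      rw [← inv_smul_eq_iff.2 hgi.symm]
      exact smul_mem_orbitSet ih (inv_mem hg)

theorem almostInvariant_image {φ : ℤ → BinSeq} (hmove : ∀ g ∈ G, MovesBoundedly φ g) {I : Set ℤ}
    (hI : ∀ C : ℤ, {i ∈ I | ∃ j ∉ I, |i - j| ≤ C}.Finite) : AlmostInvariant G (φ '' I) := by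
  intro g hg
  obtain ⟨C, hC⟩ := hmove g hg
  refine ((hI C).image φ).subset ?_
  rintro _ ⟨⟨i, hi, rfl⟩, hgi⟩
  obtain ⟨j, hj, hij⟩ := hC i
  refine ⟨i, ⟨hi, j, fun hjI => hgi ⟨j, hjI, hij.symm⟩, hj⟩, rfl⟩

theorem hasPieces_two_of_line {w : BinSeq} {φ : ℤ → BinSeq} (hφ : Function.Injective φ)
    (hw : φ 0 = w) (hmove : ∀ g ∈ G, MovesBoundedly φ g)
    (hstep : ∀ i, ∃ g ∈ G, g • φ i = φ (i + 1)) : HasPieces G w 2 := by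
  have hsub : ∀ I : Set ℤ, φ '' I ⊆ orbitSet G w := fun I => by
    rw [orbitSet_eq_range hw hmove hstep]
    exact Set.image_subset_range φ I
  have hd : Disjoint (φ '' Set.Ici 0) (φ '' Set.Iio 0) := by
    rw [Set.disjoint_image_iff hφ, Set.disjoint_left]
    exact fun i hi hi' => absurd (Set.mem_Ici.1 hi) (not_le.2 (Set.mem_Iio.1 hi'))
  refine ⟨![φ '' Set.Ici 0, φ '' Set.Iio 0], ?_, ?_⟩
  · intro i j hij
    fin_cases i <;> fin_cases j
    · exact absurd rfl hij
    · exact hd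
    · exact hd.symm
    · exact absurd rfl hij
  · intro i
    fin_cases i
    · refine ⟨hsub _, (Set.Ici_infinite 0).image hφ.injOn, almostInvariant_image hmove fun C =>
        (Set.finite_Icc (-C) C).subset ?_⟩
      rintro i ⟨hi, j, hj, hij⟩
      rw [Set.mem_Ici] at hi hj
      rw [abs_le] at hij
      exact ⟨by omega, by omega⟩
    · refine ⟨hsub _, (Set.Iio_infinite 0).image hφ.injOn, almostInvariant_image hmove fun C =>
        (Set.finite_Icc (-C) C).subset ?_⟩
      rintro i ⟨hi, j, hj, hij⟩
      rw [Set.mem_Iio] at hi hj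
      rw [abs_le] at hij
      exact ⟨by omega, by omega⟩

theorem AlmostInvariant.mem_iff_of_line {U : Set BinSeq} (hU : AlmostInvariant G U)
    {φ : ℤ → BinSeq} (hφ : Function.Injective φ) {F : Set TreeAut} (hF : F.Finite)
    (hFG : ∀ g ∈ F, g ∈ G) (hstep : ∀ i, ∃ g ∈ F, g • φ i = φ (i + 1)) :
    ∃ M : ℤ, ∀ i, M ≤ |i| → (φ i ∈ U ↔ φ (i + 1) ∈ U) := by
  have h1 : {i : ℤ | ¬ (φ i ∈ U ↔ φ (i + 1) ∈ U)}.Finite := by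
    have h2 : (⋃ g ∈ F, {x ∈ U | g • x ∉ U}).Finite := hF.biUnion fun g hg => hU g (hFG g hg)
    have h3 : (⋃ g ∈ F, {x ∈ U | g⁻¹ • x ∉ U}).Finite :=
      hF.biUnion fun g hg => hU _ (inv_mem (hFG g hg))
    refine ((h2.preimage hφ.injOn).union
      (h3.preimage (f := fun i => φ (i + 1)) fun i _ j _ hij => by
        have := hφ hij; omega)).subset fun i hi => ?_
    obtain ⟨g, hg, hgi⟩ := hstep i
    rw [Set.mem_ofPred_eq, not_iff] at hi
    by_cases h : φ i ∈ U
    · refine Or.inl (Set.mem_biUnion hg ⟨h, ?_⟩)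
      rw [hgi]
      exact fun h' => hi.2 h' h
    · refine Or.inr (Set.mem_biUnion hg ⟨hi.1 h, ?_⟩)
      rwa [inv_smul_eq_iff.2 hgi.symm]
  obtain ⟨M, hM⟩ := (h1.image abs).bddAbove
  refine ⟨M + 1, fun i hi => ?_⟩
  by_contra h
  have := hM ⟨i, h, rfl⟩
  omega

/-- Membership in $U$ is eventually constant in each direction of the line. If it were eventually
false in both, $U$ would be finite; `ε` records a direction in which it is true. -/
theorem AlmostInvariant.eventually_mem_of_line {U : Set BinSeq} (hU : AlmostInvariant G U)
    (hinf : U.Infinite) {φ : ℤ → BinSeq} (hφ : Function.Injective φ) (hUφ : U ⊆ Set.range φ)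
    {F : Set TreeAut} (hF : F.Finite) (hFG : ∀ g ∈ F, g ∈ G)
    (hstep : ∀ i, ∃ g ∈ F, g • φ i = φ (i + 1)) :
    ∃ ε : Bool, ∃ M : ℤ, ∀ i, M ≤ i → φ (if ε then i else -i) ∈ U := by
  obtain ⟨M, hM⟩ := hU.mem_iff_of_line hφ hF hFG hstep
  have hpos : ∀ i, |M| ≤ i → (φ i ∈ U ↔ φ |M| ∈ U) := fun i hi => by
    induction i, hi using Int.leInduction with
    | base => rfl
    | succ i hi ih =>
      rw [← hM i (le_trans (le_abs_self M) (hi.trans (le_abs_self i))), ih]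
  have hneg : ∀ i, |M| ≤ i → (φ (-i) ∈ U ↔ φ (-|M|) ∈ U) := fun i hi => by
    induction i, hi using Int.leInduction with
    | base => rfl
    | succ i hi ih =>
      have h := hM (-(i + 1)) (by
        rw [abs_neg]; exact le_trans (le_abs_self M) (by have := le_abs_self (i + 1); omega))
      rw [h, show -(i + 1) + 1 = -i by ring, ih]
  by_contra! hcon
  refine hinf (((Set.finite_Icc (-|M|) |M|).image φ).subset fun x hx => ?_)
  obtain ⟨i, rfl⟩ := hUφ hx
  refine ⟨i, ?_, rfl⟩
  by_contra hi
  rw [Set.mem_Icc, not_and_or, not_le, not_le] at hi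
  rcases hi with hi | hi
  · obtain ⟨j, hj, hj'⟩ := hcon false |M|
    refine hj' ?_
    have h1 := (hneg (-i) (by omega)).1 (by rwa [neg_neg])
    simpa using (hneg j hj).2 h1
  · obtain ⟨j, hj, hj'⟩ := hcon true |M|
    refine hj' ?_
    have h1 := (hpos i (by omega)).1 hx
    simpa using (hpos j hj).2 h1

/-- Each piece contains a ray and there are only two directions, so two of three pieces meet. -/
theorem not_hasPieces_three_of_line {w : BinSeq} {φ : ℤ → BinSeq} (hφ : Function.Injective φ)
    (hw : φ 0 = w) (hmove : ∀ g ∈ G, MovesBoundedly φ g) {F : Set TreeAut} (hF : F.Finite)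
    (hFG : ∀ g ∈ F, g ∈ G) (hstep : ∀ i, ∃ g ∈ F, g • φ i = φ (i + 1)) : ¬ HasPieces G w 3 := by
  rintro ⟨U, hd, hU⟩
  have horb : orbitSet G w = Set.range φ := orbitSet_eq_range hw hmove fun i =>
    let ⟨g, hg, h⟩ := hstep i
    ⟨g, hFG g hg, h⟩
  choose ε M hM using fun k => (hU k).2.2.eventually_mem_of_line (hU k).2.1 hφ
    (horb ▸ (hU k).1) hF hFG hstep
  obtain ⟨k, l, hkl, he⟩ := Fintype.exists_ne_map_eq_of_card_lt ε (by simp)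
  refine Set.disjoint_left.1 (hd hkl) (hM k _ (le_max_left (M k) (M l))) ?_
  rw [he]
  exact hM l _ (le_max_right (M k) (M l))

/-- The group `D` contains elements with arbitrary restrictions in `D` between any two words
of length `m`. -/
def IsSelfReplicating (D : Subgroup TreeAut) (m : ℕ) : Prop :=
  ∀ v u : List (Fin 2), v.length = m → u.length = m → ∀ c ∈ D, ∃ d ∈ D, actW d v = u ∧ secW d v = c

theorem IsSelfReplicating.mul {D : Subgroup TreeAut} {m : ℕ} (hD : IsSelfReplicating D m) (j : ℕ) :
    IsSelfReplicating D (j * m) := by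
  induction j with
  | zero =>
    intro v u hv hu c hc
    rw [zero_mul, List.length_eq_zero_iff] at hv hu
    exact ⟨c, hc, by simp [hv, hu]⟩
  | succ j ih =>
    intro v u hv hu c hc
    rw [add_mul, one_mul] at hv hu
    obtain ⟨d, hd, h1, h2⟩ := hD (v.drop (j * m)) (u.drop (j * m)) (by simp [hv]) (by simp [hu]) c hc
    obtain ⟨d', hd', h3, h4⟩ := ih (v.take (j * m)) (u.take (j * m)) (by simp [hv]) (by simp [hu]) d hd
    refine ⟨d', hd', ?_, ?_⟩
    · rw [← List.take_append_drop (j * m) v, actW_append, h3, h4, h1, List.take_append_drop]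
    · rw [← List.take_append_drop (j * m) v, secW_append, h4, h2]

/-- After reading $nm$ letters $v$ of a point, $g$ acts on the tail like some $d\in E$.
Self-replication gives $d'\in D$ with the same effect on $v$ and restriction $d$, so $g$ and $d'$
agree at the point. Only finitely many pairs $(v,d)$ occur, which bounds the displacement uniformly.
-/
theorem Contracting.movesBoundedly (hG : Contracting G) {D : Subgroup TreeAut} {m : ℕ} (hm : 0 < m)
    (hD : IsSelfReplicating D m) {φ : ℤ → BinSeq} (hDφ : ∀ d ∈ D, MovesBoundedly φ d)
    {E : Set TreeAut} (hE : E.Finite) (hED : ∀ d ∈ E, d ∈ D)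
    (hN : ∀ h ∈ nucleus G, ∀ x : BinSeq, ∃ d ∈ E, h • x = d • x) {g : TreeAut} (hg : g ∈ G) :
    MovesBoundedly φ g := by
  obtain ⟨n, hn⟩ := hG.exists_secW_mem_nucleus hg
  have key : ∀ (v : List (Fin 2)) (d : TreeAut), ∃ C : ℤ, v.length = n * m → d ∈ E →
      ∃ d' : TreeAut, actW d' v = actW g v ∧ secW d' v = d ∧
        ∀ i, ∃ j, |i - j| ≤ C ∧ d' • φ i = φ j := by
    intro v d
    by_cases h : v.length = n * m ∧ d ∈ E
    · obtain ⟨d', hd', h1, h2⟩ := hD.mul n v (actW g v) h.1 (by simp [h.1]) d (hED d h.2)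
      obtain ⟨C, hC⟩ := hDφ d' hd'
      exact ⟨C, fun _ _ => ⟨d', h1, h2, hC⟩⟩
    · exact ⟨0, fun h1 h2 => absurd ⟨h1, h2⟩ h⟩
  choose C hC using key
  have hfin : ({v : List (Fin 2) | v.length = n * m} ×ˢ E).Finite :=
    (List.finite_length_eq (Fin 2) (n * m)).prod hE
  obtain ⟨M, hM⟩ := (hfin.image fun p => C p.1 p.2).bddAbove
  refine ⟨M, fun i => ?_⟩
  obtain ⟨v, hv, hi⟩ := exists_eq_prependWord (n * m) (φ i)
  obtain ⟨d, hd, hdx⟩ := hN (secW g v) (hn v (by rw [hv]; exact Nat.le_mul_of_pos_right n hm))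
    (tailSeq^[n * m] (φ i))
  obtain ⟨d', h1, h2, h3⟩ := hC v d hv hd
  obtain ⟨j, hj, hij⟩ := h3 i
  refine ⟨j, hj.trans (hM ⟨(v, d), ⟨hv, hd⟩, rfl⟩), ?_⟩
  rw [← hij]
  rw [hi, smul_prependWord, smul_prependWord, h1, h2, hdx]

theorem Contracting.pieces_of_line (hG : Contracting G) {D : Subgroup TreeAut} {m : ℕ} (hm : 0 < m)
    (hD : IsSelfReplicating D m) {w : BinSeq} {φ : ℤ → BinSeq} (hφ : Function.Injective φ)
    (hw : φ 0 = w) (hDφ : ∀ d ∈ D, MovesBoundedly φ d)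
    {E : Set TreeAut} (hE : E.Finite) (hED : ∀ d ∈ E, d ∈ D)
    (hN : ∀ h ∈ nucleus G, ∀ x : BinSeq, ∃ d ∈ E, h • x = d • x)
    (hstep : ∀ i, ∃ g ∈ nucleus G, g • φ i = φ (i + 1)) :
    HasPieces G w 2 ∧ ¬ HasPieces G w 3 := by
  have hmove : ∀ g ∈ G, MovesBoundedly φ g := fun g hg =>
    hG.movesBoundedly hm hD hDφ hE hED hN hg
  refine ⟨hasPieces_two_of_line hφ hw hmove fun i => ?_,
    not_hasPieces_three_of_line hφ hw hmove hG.finite_nucleus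
      (fun g hg => hG.nucleus_subset hg) hstep⟩
  obtain ⟨g, hg, h⟩ := hstep i
  exact ⟨g, hG.nucleus_subset hg, h⟩

end TreeAut

/-! ### Orbits of adding machines -/

namespace TreeAut

/-- The structure of an adding machine: over the words of length `m` the cyclic group acts
transitively with period `p`, and the first return to a word restricts to the machine itself. -/
structure AddingMachineData (a : TreeAut) (m p : ℕ) : Prop where
  pos : 0 < m
  two_le : 2 ≤ p
  exists_pow : ∀ v u : List (Fin 2), v.length = m → u.length = m →
    ∃ k e : ℤ, actW (a ^ k) v = u ∧ secW (a ^ k) v = a ^ e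
  actW_period : ∀ v : List (Fin 2), v.length = m → actW (a ^ (p : ℤ)) v = v
  secW_period : ∀ v : List (Fin 2), v.length = m → secW (a ^ (p : ℤ)) v = a
  dvd_of_fixed : ∀ v : List (Fin 2), v.length = m → ∀ i : ℤ, actW (a ^ i) v = v → (p : ℤ) ∣ i

theorem actW_zpow_eq {g : TreeAut} {v : List (Fin 2)} (h : actW g v = v) (j : ℤ) :
    actW (g ^ j) v = v ∧ secW (g ^ j) v = secW g v ^ j := by
  have hinv : actW g⁻¹ v = v := by
    conv_lhs => rw [← h]
    exact actW_inv_actW g v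
  induction j using Int.induction_on with
  | zero => simp
  | succ j ih =>
    rw [zpow_add_one, zpow_add_one, actW_mul, secW_mul, h, ih.1, ih.2]
    exact ⟨rfl, rfl⟩
  | pred j ih =>
    rw [zpow_sub_one, zpow_sub_one, actW_mul, secW_mul, hinv, ih.1, ih.2, secW_inv, hinv]
    exact ⟨rfl, rfl⟩

theorem secW_zpow_mem_zpowers {a : TreeAut} {m : ℕ}
    (h : ∀ v : List (Fin 2), v.length = m → secW a v = a ∨ secW a v = 1) (k : ℤ) :
    ∀ v : List (Fin 2), v.length = m → ∃ e : ℤ, secW (a ^ k) v = a ^ e := by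
  have h1 : ∀ v : List (Fin 2), v.length = m → ∃ e : ℤ, secW a v = a ^ e := fun v hv =>
    (h v hv).elim (fun h => ⟨1, by rw [h, zpow_one]⟩) fun h => ⟨0, by rw [h, zpow_zero]⟩
  induction k using Int.induction_on with
  | zero => exact fun v _ => ⟨0, by simp⟩
  | succ k ih =>
    intro v hv
    obtain ⟨e, he⟩ := ih (actW a v) (by simp [hv])
    obtain ⟨f, hf⟩ := h1 v hv
    exact ⟨e + f, by rw [zpow_add_one, secW_mul, he, hf, zpow_add]⟩
  | pred k ih =>
    intro v hv
    obtain ⟨e, he⟩ := ih (actW a⁻¹ v) (by simp [hv])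
    obtain ⟨f, hf⟩ := h1 (actW a⁻¹ v) (by simp [hv])
    exact ⟨e - f, by rw [zpow_sub_one, secW_mul, he, secW_inv, hf, zpow_sub]⟩

/-- Starting from $y=a(x)$, the cycle of $a$ reaches $x$ only at its last step, so exactly one
factor in the restriction of $a^p$ at $y$ is nontrivial, and it is $a$. -/
theorem exists_addingMachineData {a : TreeAut} (ha : IsAddingMachine a.1) :
    ∃ m p, AddingMachineData a m p := by
  obtain ⟨m, hm, htrans, x, y, hx, hxy, hxa, htriv⟩ := ha
  rw [hasRestriction_iff] at hxa
  obtain ⟨hax, hsx⟩ := hxa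
  replace hsx : secW a x = a := Subtype.ext hsx
  have hy : y.length = m := by rw [← hax, length_actW, hx]
  have htriv' : ∀ v : List (Fin 2), v.length = m → v ≠ x → secW a v = 1 := by
    intro v hv hvx
    obtain ⟨u, hu⟩ := htriv v hv hvx
    exact Subtype.ext ((hasRestriction_iff a v u 1).1 hu).2
  have hsec := secW_zpow_mem_zpowers (a := a) (m := m) fun v hv => by
    by_cases h : v = x
    · exact Or.inl (h ▸ hsx)
    · exact Or.inr (htriv' v hv h)
  have hpow : ∀ v u : List (Fin 2), v.length = m → u.length = m →
      ∃ k e : ℤ, actW (a ^ k) v = u ∧ secW (a ^ k) v = a ^ e := by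
    intro v u hv hu
    obtain ⟨k, h, hk⟩ := htrans v u hv hu
    obtain ⟨e, he⟩ := hsec k v hv
    exact ⟨k, e, ((hasRestriction_iff (a ^ k) v u h).1 hk).1, he⟩
  have hper : ∃ p : ℕ, 0 < p ∧ actW (a ^ p) y = y := by
    obtain ⟨i, j, hij, h⟩ := Set.Finite.exists_lt_map_eq_of_forall_mem
      (f := fun i : ℕ => actW (a ^ i) y) (t := {v | v.length = m})
      (fun i => by simp [hy]) (List.finite_length_eq (Fin 2) m)
    refine ⟨j - i, by omega, actW_injective (a ^ i) ?_⟩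
    rw [← actW_mul, ← pow_add, show i + (j - i) = j by omega]
    exact h.symm
  classical
  set p := Nat.find hper with hp
  obtain ⟨hp0, hpy⟩ := Nat.find_spec hper
  rw [← hp] at hp0 hpy
  have hmin : ∀ i : ℕ, 0 < i → i < p → actW (a ^ i) y ≠ y := fun i hi hip h =>
    Nat.find_min hper hip ⟨hi, h⟩
  have hne : ∀ i : ℕ, i + 1 < p → actW (a ^ i) y ≠ x := by
    intro i hi h
    refine hmin (i + 1) (by omega) hi ?_
    rw [pow_succ', actW_mul, h, hax]
  have hlast : actW (a ^ (p - 1)) y = x := by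
    refine actW_injective a ?_
    rw [hax, ← actW_mul, ← pow_succ', show p - 1 + 1 = p by omega, hpy]
  have hone : ∀ i : ℕ, i + 1 ≤ p → secW (a ^ i) y = 1 := by
    intro i
    induction i with
    | zero => intro; simp
    | succ i ih =>
      intro hi
      rw [pow_succ', secW_mul, ih (by omega), htriv' _ (by simp [hy]) (hne i (by omega)), one_mul]
  have hsy : secW (a ^ p) y = a := by
    rw [show p = p - 1 + 1 by omega, pow_succ', secW_mul, hlast, hsx, hone _ (by omega), mul_one]
  refine ⟨m, p, hm, ?_, hpow, fun v hv => ?_, fun v hv => ?_, fun v hv i hi => ?_⟩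
  -- With period one the last point of the cycle starting at $y$ would be $y$ itself, forcing $x=y$.
  · by_contra hlt
    have h1 : p = 1 := by omega
    rw [h1] at hlast
    simp only [Nat.sub_self, pow_zero, actW_one] at hlast
    exact hxy hlast.symm
  · obtain ⟨k, e, hk, -⟩ := hpow y v hy hv
    rw [← hk, ← actW_mul, ← zpow_add, add_comm, zpow_add, actW_mul, zpow_natCast, hpy]
  · obtain ⟨k, e, hk, he⟩ := hpow y v hy hv
    -- Since $a^p$ and $a^k$ commute, comparing both products at $y$ transports the return value $a$
    -- from $y$ to $v$.
    have h1 : secW (a ^ (p : ℤ) * a ^ k) y = secW (a ^ k * a ^ (p : ℤ)) y := by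
      rw [← zpow_add, add_comm, zpow_add]
    rw [secW_mul, secW_mul, hk, he, zpow_natCast, hpy, hsy, he, ← zpow_add_one, add_comm,
      zpow_one_add] at h1
    rw [zpow_natCast]
    exact mul_right_cancel h1
  · obtain ⟨k, e, hk, -⟩ := hpow y v hy hv
    have h1 : actW (a ^ i) y = y := by
      refine actW_injective (a ^ k) ?_
      rw [← actW_mul, ← zpow_add, add_comm, zpow_add, actW_mul, hk, hi]
    have hp0' : (0 : ℤ) < p := by exact_mod_cast hp0
    obtain ⟨r, hr⟩ := Int.eq_ofNat_of_zero_le (Int.emod_nonneg i hp0'.ne')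
    have hr' : r < p := by have := Int.emod_lt_of_pos i hp0'; omega
    have h2 : actW (a ^ r) y = y := by
      have h3 : a ^ i = a ^ r * (a ^ (p : ℤ)) ^ (i / p) := by
        rw [← zpow_natCast a r, ← hr, ← zpow_mul, ← zpow_add, Int.emod_add_mul_ediv]
      rw [h3, actW_mul, (actW_zpow_eq (by rw [zpow_natCast]; exact hpy) _).1] at h1
      exact h1
    have h4 : r = 0 := by
      by_contra h0
      exact hmin r (Nat.pos_of_ne_zero h0) hr' h2
    rw [h4] at hr
    exact Int.dvd_of_emod_eq_zero hr

namespace AddingMachineData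

variable {a : TreeAut} {m p : ℕ}

theorem isSelfReplicating (ha : AddingMachineData a m p) :
    IsSelfReplicating (Subgroup.zpowers a) m := by
  rintro v u hv hu _ ⟨c, rfl⟩
  obtain ⟨k, e, h1, h2⟩ := ha.exists_pow v u hv hu
  obtain ⟨h3, h4⟩ := actW_zpow_eq (ha.actW_period v hv) (c - e)
  rw [ha.secW_period v hv] at h4
  refine ⟨a ^ k * (a ^ (p : ℤ)) ^ (c - e), ⟨k + p * (c - e), by simp only [zpow_add, zpow_mul]⟩,
    ?_, ?_⟩
  · rw [actW_mul, h3, h1]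
  · rw [secW_mul, h3, h2, h4, ← zpow_add, add_sub_cancel]

/-- A fixed point of $a^i$ forces $i=pq$, and then $a^q$ fixes the tail. As $p\ge2$, the exponent
has become smaller, so descent gives $i=0$. -/
theorem zpow_smul_ne (ha : AddingMachineData a m p) (n : ℕ) :
    ∀ (i : ℤ) (w : BinSeq), i.natAbs ≤ n → a ^ i • w = w → i = 0 := by
  induction n with
  | zero => intro i w hi _; omega
  | succ n ih =>
    intro i w hi hw
    by_contra h0
    obtain ⟨v, hv, hvw⟩ := exists_eq_prependWord m w
    rw [hvw, smul_prependWord, prependWord_inj (by simp)] at hw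
    obtain ⟨q, rfl⟩ := ha.dvd_of_fixed v hv i hw.1
    have h1 := hw.2
    rw [zpow_mul, (actW_zpow_eq (ha.actW_period v hv) q).2, ha.secW_period v hv] at h1
    have hq : q ≠ 0 := fun h => h0 (by rw [h, mul_zero])
    refine hq (ih q _ ?_ h1)
    rw [Int.natAbs_mul, Int.natAbs_natCast] at hi
    have := ha.two_le
    have : 0 < q.natAbs := Int.natAbs_pos.2 hq
    nlinarith

theorem injective_zpow_smul (ha : AddingMachineData a m p) (w : BinSeq) :
    Function.Injective fun i : ℤ => a ^ i • w := by
  intro i j hij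
  have h1 : a ^ (-j + i) • w = w := by
    rw [zpow_add, mul_smul, show a ^ i • w = a ^ j • w from hij, zpow_neg, inv_smul_smul]
  have := ha.zpow_smul_ne _ _ w le_rfl h1
  omega

end AddingMachineData

theorem Contracting.pieces_of_addingMachine {G : Subgroup TreeAut} (hG : Contracting G)
    {a : TreeAut} (ha : IsAddingMachine a.1) (hN : nucleus G = {a, a⁻¹, 1}) (w : BinSeq) :
    HasPieces G w 2 ∧ ¬ HasPieces G w 3 := by
  obtain ⟨m, p, hap⟩ := exists_addingMachineData ha
  refine hG.pieces_of_line hap.pos hap.isSelfReplicating (φ := fun i : ℤ => a ^ i • w)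
    (hap.injective_zpow_smul w) (by simp) ?_ hG.finite_nucleus ?_ (fun h hh x => ⟨h, hh, rfl⟩) ?_
  · rintro _ ⟨k, rfl⟩
    exact ⟨|k|, fun i => ⟨k + i, by simp, by simp only [zpow_add, mul_smul]⟩⟩
  · rw [hN]
    rintro d (rfl | rfl | rfl)
    · exact Subgroup.mem_zpowers d
    · exact inv_mem (Subgroup.mem_zpowers a)
    · exact one_mem _
  · exact fun i => ⟨a, hN ▸ Or.inl rfl, by rw [add_comm, zpow_add, zpow_one, mul_smul]⟩

end TreeAut

/-! ### The dihedral group behind Šunić's automata -/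

/-- To prove a property of all binary sequences one can argue by induction on the first letter
that differs from `c`, and treat the constant sequence separately. -/
theorem BinSeq.induction_first_ne {c : Fin 2} {Q : BinSeq → Prop} (hconst : Q fun _ => c)
    (hbase : ∀ u, Q (consSeq (c + 1) u)) (hstep : ∀ u, Q u → Q (consSeq c u)) (x : BinSeq) :
    Q x := by
  by_cases h : ∃ n, x n ≠ c
  · obtain ⟨n, hn⟩ := h
    induction n generalizing x with
    | zero =>
      rw [← consSeq_tailSeq x, fin_two_eq_add_one hn]
      exact hbase _
    | succ n ih =>
      rw [← consSeq_tailSeq x]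
      by_cases h0 : x 0 = c
      · rw [h0]
        exact hstep _ (ih (tailSeq x) hn)
      · rw [fin_two_eq_add_one h0]
        exact hbase _
  · push Not at h
    rw [show x = fun _ => c from funext h]
    exact hconst

namespace TreeAut

theorem smul_const_eq {P : TreeAut → Prop} {c : Fin 2} (hroot : ∀ g, P g → root g = 1)
    (hsec : ∀ g, P g → P (sec g c)) {g : TreeAut} (hg : P g) :
    g • (fun _ => c : BinSeq) = fun _ => c := by
  have hc : (fun _ => c : BinSeq) = consSeq c fun _ => c := by
    funext n
    cases n <;> rfl
  funext n
  induction n generalizing g with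
  | zero => rw [hc, smul_consSeq, hroot g hg]; rfl
  | succ n ih => rw [hc, smul_consSeq, consSeq_succ]; exact ih (hsec g hg)

/-- A swap of the first letter and an element that swaps the letter after the first occurrence
of a letter different from `c`. -/
structure IsDihedralPair (c : Fin 2) (σ β : TreeAut) : Prop where
  root_swap : root σ ≠ 1
  sec_swap : ∀ x, sec σ x = 1
  root_eq : root β = 1
  sec_eq : sec β c = β
  sec_add_one : sec β (c + 1) = σ

namespace IsDihedralPair

variable {c : Fin 2} {σ β : TreeAut}

theorem swap_smul (h : IsDihedralPair c σ β) (x : Fin 2) (u : BinSeq) :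
    σ • consSeq x u = consSeq (x + 1) u := by
  rw [smul_consSeq, perm_fin_two_apply h.root_swap, h.sec_swap, one_smul]

theorem smul_cons (h : IsDihedralPair c σ β) (u : BinSeq) :
    β • consSeq c u = consSeq c (β • u) := by
  rw [smul_consSeq, h.root_eq, h.sec_eq]; rfl

theorem smul_cons_add_one (h : IsDihedralPair c σ β) (u : BinSeq) :
    β • consSeq (c + 1) u = consSeq (c + 1) (σ • u) := by
  rw [smul_consSeq, h.root_eq, h.sec_add_one]; rfl

theorem swap_swap (h : IsDihedralPair c σ β) (x : BinSeq) : σ • σ • x = x := by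
  rw [← consSeq_tailSeq x, h.swap_smul, h.swap_smul, fin_two_add_one_add_one]

theorem swap_inv (h : IsDihedralPair c σ β) : σ⁻¹ = σ :=
  ext_smul fun x => inv_smul_eq_iff.2 (h.swap_swap x).symm

theorem smul_const (h : IsDihedralPair c σ β) : β • (fun _ => c : BinSeq) = fun _ => c :=
  smul_const_eq (P := (· = β)) (by rintro _ rfl; exact h.root_eq) (by rintro _ rfl; exact h.sec_eq)
    rfl

theorem smul_smul (h : IsDihedralPair c σ β) (x : BinSeq) : β • β • x = x := by
  induction x using BinSeq.induction_first_ne (c := c) with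
  | hconst => rw [h.smul_const, h.smul_const]
  | hbase u => rw [h.smul_cons_add_one, h.smul_cons_add_one, h.swap_swap]
  | hstep u ih => rw [h.smul_cons, h.smul_cons, ih]

theorem inv_eq (h : IsDihedralPair c σ β) : β⁻¹ = β :=
  ext_smul fun x => inv_smul_eq_iff.2 (h.smul_smul x).symm

theorem swap_smul_ne (h : IsDihedralPair c σ β) (x : BinSeq) : σ • x ≠ x := by
  rw [← consSeq_tailSeq x, h.swap_smul]
  exact fun he => fin_two_add_one_ne _ (consSeq_inj.1 he).1

theorem eq_const_of_smul_eq (h : IsDihedralPair c σ β) (x : BinSeq) :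
    β • x = x → x = fun _ => c := by
  induction x using BinSeq.induction_first_ne (c := c) with
  | hconst => exact fun _ => rfl
  | hbase u =>
    rw [h.smul_cons_add_one]
    exact fun he => absurd (consSeq_inj.1 he).2 (h.swap_smul_ne u)
  | hstep u ih =>
    rw [h.smul_cons]
    intro he
    rw [ih (consSeq_inj.1 he).2]
    funext n
    cases n <;> rfl

theorem translation_inv (h : IsDihedralPair c σ β) : (β * σ)⁻¹ = σ * β := by
  rw [mul_inv_rev, h.swap_inv, h.inv_eq]

theorem swap_mul_zpow (h : IsDihedralPair c σ β) (i : ℤ) :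
    σ * (β * σ) ^ i = (β * σ) ^ (-i) * σ := by
  have h1 : σ * (β * σ) * σ⁻¹ = (β * σ)⁻¹ := by
    rw [h.translation_inv, ← mul_assoc, mul_inv_cancel_right]
  have h2 : (σ * (β * σ) * σ⁻¹) ^ i = σ * (β * σ) ^ i * σ⁻¹ := conj_zpow
  rw [h1, inv_zpow'] at h2
  rw [h2, inv_mul_cancel_right]

/-- The square of the translation $\beta\sigma$ keeps the first letter and acts on the tail as the
translation or its inverse, which allows descent on exponents. -/
theorem translation_sq_smul (h : IsDihedralPair c σ β) (u : BinSeq) :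
    (β * σ) • (β * σ) • consSeq c u = consSeq c ((β * σ) • u) ∧
      (β * σ) • (β * σ) • consSeq (c + 1) u = consSeq (c + 1) ((β * σ)⁻¹ • u) := by
  rw [h.translation_inv]
  simp only [mul_smul, h.swap_smul, fin_two_add_one_add_one, h.smul_cons, h.smul_cons_add_one,
    and_self]

theorem translation_zpow_smul (h : IsDihedralPair c σ β) (q : ℤ) :
    ∀ u, (β * σ) ^ (q + q) • consSeq c u = consSeq c ((β * σ) ^ q • u) ∧
      (β * σ) ^ (q + q) • consSeq (c + 1) u = consSeq (c + 1) ((β * σ) ^ (-q) • u) := by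
  have hinv : ∀ u, (β * σ)⁻¹ • (β * σ)⁻¹ • consSeq c u = consSeq c ((β * σ)⁻¹ • u) ∧
      (β * σ)⁻¹ • (β * σ)⁻¹ • consSeq (c + 1) u = consSeq (c + 1) ((β * σ) • u) := by
    intro u
    rw [inv_smul_eq_iff, inv_smul_eq_iff, inv_smul_eq_iff, inv_smul_eq_iff,
      (h.translation_sq_smul _).1, (h.translation_sq_smul _).2, smul_inv_smul, inv_smul_smul]
    exact ⟨rfl, rfl⟩
  have hsq := h.translation_sq_smul
  generalize β * σ = T at hsq hinv ⊢
  induction q using Int.induction_on with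
  | zero => simp
  | succ q ih =>
    intro u
    rw [show (q : ℤ) + 1 + (q + 1) = q + q + 1 + 1 by ring, zpow_add_one, zpow_add_one, mul_smul,
      mul_smul, mul_smul, mul_smul, (hsq u).1, (hsq u).2,
      (ih _).1, (ih _).2, zpow_add_one, mul_smul, neg_add, ← sub_eq_add_neg, zpow_sub_one, mul_smul]
    exact ⟨rfl, rfl⟩
  | pred q ih =>
    intro u
    rw [show -(q : ℤ) - 1 + (-q - 1) = -q + -q - 1 - 1 by ring, zpow_sub_one, zpow_sub_one,
      mul_smul, mul_smul, mul_smul, mul_smul, (hinv u).1, (hinv u).2,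
      (ih _).1, (ih _).2, zpow_sub_one, mul_smul, neg_sub', sub_neg_eq_add, zpow_add_one, mul_smul]
    exact ⟨rfl, rfl⟩

theorem root_translation (h : IsDihedralPair c σ β) : root (β * σ) = root σ := by
  rw [root_mul, h.root_eq, one_mul]

/-- Odd powers change the first letter; even powers descend to half the exponent on the tail. -/
theorem translation_zpow_smul_eq (h : IsDihedralPair c σ β) (n : ℕ) :
    ∀ (i : ℤ) (w : BinSeq), i.natAbs ≤ n → (β * σ) ^ i • w = w → i = 0 := by
  induction n with
  | zero => intro i w hi _; omega
  | succ n ih =>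
    intro i w hi hw
    have hlet : ∀ x : BinSeq, ((β * σ) • x) 0 = x 0 + 1 := by
      intro x
      conv_lhs => rw [← consSeq_tailSeq x, smul_consSeq, h.root_translation,
        perm_fin_two_apply h.root_swap]
      rfl
    have heven : ∀ q : ℤ, ((β * σ) ^ (q + q) • w) 0 = w 0 := by
      intro q
      conv_lhs => rw [← consSeq_tailSeq w]
      by_cases h0 : w 0 = c
      · rw [h0, (h.translation_zpow_smul q _).1]; rfl
      · rw [fin_two_eq_add_one h0, (h.translation_zpow_smul q _).2]; rfl
    obtain ⟨q, rfl | rfl⟩ := Int.even_or_odd' i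
    · rw [two_mul] at hw hi ⊢
      rw [← consSeq_tailSeq w] at hw
      by_cases h0 : w 0 = c
      · rw [h0, (h.translation_zpow_smul q _).1] at hw
        have := ih q _ (by omega) (consSeq_inj.1 hw).2
        omega
      · rw [fin_two_eq_add_one h0, (h.translation_zpow_smul q _).2] at hw
        have := ih (-q) _ (by omega) (consSeq_inj.1 hw).2
        omega
    · rw [two_mul, add_comm, zpow_one_add, mul_smul] at hw
      have h1 := hlet ((β * σ) ^ (q + q) • w)
      rw [hw, heven] at h1
      exact absurd h1.symm (fin_two_add_one_ne _)

/-- Every reflection is conjugate to $\sigma$, which has no fixed points, or to $\beta$, whose only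
fixed point is the constant sequence excluded from the orbit by hypothesis. -/
theorem reflection_smul_ne (h : IsDihedralPair c σ β) {w : BinSeq}
    (hw : ∀ j : ℤ, (β * σ) ^ j • w ≠ fun _ => c) (i : ℤ) : σ • (β * σ) ^ i • w ≠ w := by
  intro he
  obtain ⟨j, rfl | rfl⟩ := Int.even_or_odd' i
  · refine h.swap_smul_ne ((β * σ) ^ j • w) ?_
    rw [two_mul, zpow_add, mul_smul, ← mul_smul, h.swap_mul_zpow, mul_smul, zpow_neg,
      inv_smul_eq_iff] at he
    exact he
  · refine hw (j + 1) (h.eq_const_of_smul_eq _ ?_)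
    rw [show 2 * j + 1 = j + (j + 1) by ring, zpow_add, mul_smul, ← mul_smul, h.swap_mul_zpow,
      mul_smul, zpow_neg, inv_smul_eq_iff] at he
    conv_rhs => rw [add_comm, zpow_one_add, mul_smul, ← he, mul_smul, h.swap_swap]

/-- The points of the orbit of `w`, in the order in which the two involutions connect them. -/
def line (σ β : TreeAut) (w : BinSeq) (n : ℤ) : BinSeq :=
  if Even n then (β * σ) ^ (n / 2) • w else σ • (β * σ) ^ (n / 2) • w

theorem line_two_mul (w : BinSeq) (i : ℤ) : line σ β w (2 * i) = (β * σ) ^ i • w := by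
  rw [line, if_pos (even_two_mul i), Int.mul_ediv_cancel_left i two_ne_zero]

theorem line_two_mul_add_one (w : BinSeq) (i : ℤ) :
    line σ β w (2 * i + 1) = σ • (β * σ) ^ i • w := by
  rw [line, if_neg (Int.not_even_two_mul_add_one i), show (2 * i + 1) / 2 = i by omega]

theorem injective_line (h : IsDihedralPair c σ β) {w : BinSeq}
    (hw : ∀ j : ℤ, (β * σ) ^ j • w ≠ fun _ => c) : Function.Injective (line σ β w) := by
  have hT : ∀ i j : ℤ, (β * σ) ^ i • w = (β * σ) ^ j • w → i = j := by
    intro i j hij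
    have h1 : (β * σ) ^ (-j + i) • w = w := by
      rw [zpow_add, mul_smul, hij, zpow_neg, inv_smul_smul]
    have := h.translation_zpow_smul_eq _ _ w le_rfl h1
    omega
  have hR : ∀ i j : ℤ, (β * σ) ^ i • w ≠ σ • (β * σ) ^ j • w := by
    intro i j hij
    refine h.reflection_smul_ne hw (i + j) ?_
    rw [zpow_add, mul_smul, ← mul_smul, h.swap_mul_zpow, mul_smul, ← hij, zpow_neg, inv_smul_smul]
  intro m n hmn
  obtain ⟨i, rfl | rfl⟩ := Int.even_or_odd' m <;> obtain ⟨j, rfl | rfl⟩ := Int.even_or_odd' n <;>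
    simp only [line_two_mul, line_two_mul_add_one] at hmn
  · rw [hT i j hmn]
  · exact absurd hmn (hR i j)
  · exact absurd hmn.symm (hR j i)
  · rw [hT i j (MulAction.injective σ hmn)]

theorem swap_line (h : IsDihedralPair c σ β) (w : BinSeq) (i : ℤ) :
    σ • line σ β w (2 * i) = line σ β w (2 * i + 1) ∧
      σ • line σ β w (2 * i + 1) = line σ β w (2 * i) := by
  rw [line_two_mul, line_two_mul_add_one, h.swap_swap]
  exact ⟨rfl, rfl⟩

theorem smul_line (h : IsDihedralPair c σ β) (w : BinSeq) (i : ℤ) :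
    β • line σ β w (2 * i + 1) = line σ β w (2 * i + 2) ∧
      β • line σ β w (2 * i + 2) = line σ β w (2 * i + 1) := by
  have h1 : β • line σ β w (2 * i + 1) = line σ β w (2 * i + 2) := by
    rw [show 2 * i + 2 = 2 * (i + 1) by ring, line_two_mul, line_two_mul_add_one, add_comm,
      zpow_one_add, mul_smul, mul_smul]
  exact ⟨h1, by rw [← h1, h.smul_smul]⟩

theorem movesBoundedly (h : IsDihedralPair c σ β) (w : BinSeq) {d : TreeAut}
    (hd : d ∈ Subgroup.closure {σ, β}) : MovesBoundedly (line σ β w) d := by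
  have hσ : MovesBoundedly (line σ β w) σ := by
    refine ⟨1, fun n => ?_⟩
    obtain ⟨i, rfl | rfl⟩ := Int.even_or_odd' n
    · exact ⟨2 * i + 1, by simp, (h.swap_line w i).1⟩
    · exact ⟨2 * i, by simp, (h.swap_line w i).2⟩
  have hβ : MovesBoundedly (line σ β w) β := by
    refine ⟨1, fun n => ?_⟩
    obtain ⟨i, rfl | rfl⟩ := Int.even_or_odd' n
    · refine ⟨2 * (i - 1) + 1, by rw [abs_le]; omega, ?_⟩
      rw [← (h.smul_line w (i - 1)).2]
      ring_nf
    · exact ⟨2 * i + 2, by rw [abs_le]; omega, (h.smul_line w i).1⟩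
  have key : MovesBoundedly (line σ β w) d ∧ MovesBoundedly (line σ β w) d⁻¹ := by
    induction hd using Subgroup.closure_induction with
    | mem g hg =>
      rcases hg with rfl | rfl
      · rw [h.swap_inv]; exact ⟨hσ, hσ⟩
      · rw [h.inv_eq]; exact ⟨hβ, hβ⟩
    | one =>
      have : MovesBoundedly (line σ β w) 1 := ⟨0, fun i => ⟨i, by simp, one_smul _ _⟩⟩
      exact ⟨this, by rwa [inv_one]⟩
    | mul g g' _ _ ihg ihg' => exact ⟨ihg.1.mul ihg'.1, by rw [mul_inv_rev]; exact ihg'.2.mul ihg.2⟩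
    | inv g _ ih => exact ⟨ih.2, by rw [inv_inv]; exact ih.1⟩
  exact key.1

/-- The elements $\sigma\beta\sigma$ and $\beta$ fix the letter $c$ and restrict there to $\sigma$
and $\beta$; $\sigma$ moves between letters with trivial restrictions. -/
theorem isSelfReplicating (h : IsDihedralPair c σ β) :
    IsSelfReplicating (Subgroup.closure {σ, β}) 1 := by
  have hσ : σ ∈ Subgroup.closure {σ, β} := Subgroup.subset_closure (Or.inl rfl)
  have hβ : β ∈ Subgroup.closure {σ, β} := Subgroup.subset_closure (Or.inr rfl)
  have hswap : ∀ x, root σ x = x + 1 := perm_fin_two_apply h.root_swap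
  have key : ∀ d ∈ Subgroup.closure {σ, β}, ∃ g ∈ Subgroup.closure {σ, β},
      root g c = c ∧ sec g c = d := by
    intro d hd
    induction hd using Subgroup.closure_induction with
    | mem d hd =>
      rcases hd with rfl | rfl
      · refine ⟨d * β * d, mul_mem (mul_mem hσ hβ) hσ, ?_, ?_⟩
        · simp [hswap, h.root_eq, fin_two_add_one_add_one]
        · simp [hswap, h.root_eq, h.sec_swap, h.sec_add_one]
      · exact ⟨d, hβ, by rw [h.root_eq]; rfl, h.sec_eq⟩
    | one => exact ⟨1, one_mem _, by simp, by simp⟩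
    | mul d d' _ _ ih ih' =>
      obtain ⟨g, hg, h1, h2⟩ := ih
      obtain ⟨g', hg', h1', h2'⟩ := ih'
      exact ⟨g * g', mul_mem hg hg', by simp [h1, h1'], by simp [h1', h2, h2']⟩
    | inv d _ ih =>
      obtain ⟨g, hg, h1, h2⟩ := ih
      refine ⟨g⁻¹, inv_mem hg, ?_, ?_⟩
      · rw [root_inv, Equiv.Perm.inv_eq_iff_eq, h1]
      · conv_lhs => rw [← h1, sec_inv_root, h2]
  have hmove : ∀ x y : Fin 2, ∃ g ∈ Subgroup.closure {σ, β}, root g x = y ∧ sec g x = 1 := by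
    intro x y
    by_cases hxy : y = x
    · exact ⟨1, one_mem _, by simp [hxy], by simp⟩
    · exact ⟨σ, hσ, by rw [hswap, ← fin_two_eq_add_one hxy], h.sec_swap x⟩
  intro v u hv hu d hd
  obtain ⟨x, rfl⟩ := List.length_eq_one_iff.1 hv
  obtain ⟨y, rfl⟩ := List.length_eq_one_iff.1 hu
  obtain ⟨g, hg, h1, h2⟩ := key d hd
  obtain ⟨p, hp, h3, h4⟩ := hmove x c
  obtain ⟨q, hq, h5, h6⟩ := hmove c y
  exact ⟨q * g * p, mul_mem (mul_mem hq hg) hp, by simp [h1, h3, h5], by simp [h1, h2, h3, h4, h6]⟩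

end IsDihedralPair

/-- The pair of involutions generating the dihedral group of the automaton with `k = 1`. -/
theorem isDihedralPair_aut (e : Equiv.Perm (Fin 2)) :
    IsDihedralPair (e 1)
      (((sunicTransducer (AddEquiv.refl (Fin 1 → ZMod 2))
        (Pi.evalAddMonoidHom (fun _ => ZMod 2) 0)).relabel e).aut (Sum.inl 1))
      (((sunicTransducer (AddEquiv.refl (Fin 1 → ZMod 2))
        (Pi.evalAddMonoidHom (fun _ => ZMod 2) 0)).relabel e).aut (Sum.inr 1)) where
  root_swap := root_aut_relabel_inl_one _ _ e
  sec_swap := sec_aut_relabel_inl _ _ e 1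
  root_eq := root_aut_relabel_inr _ _ e 1
  sec_eq := sec_aut_relabel_inr_one _ _ e 1
  sec_add_one := by
    have he : ∀ e : Equiv.Perm (Fin 2), e 1 + 1 = e 0 := by decide
    rw [he, sec_aut_relabel_inr_zero]
    rfl

section Sunic

variable {k : ℕ} (ρ : (Fin k → ZMod 2) ≃+ (Fin k → ZMod 2)) (ω : (Fin k → ZMod 2) →+ ZMod 2)
  (e : Equiv.Perm (Fin 2)) {σ β : TreeAut}

theorem aut_relabel_inr_smul_const (b : Fin k → ZMod 2) :
    ((sunicTransducer ρ ω).relabel e).aut (Sum.inr b) • (fun _ => e 1 : BinSeq) = fun _ => e 1 :=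
  smul_const_eq (P := fun g => ∃ b, g = ((sunicTransducer ρ ω).relabel e).aut (Sum.inr b))
    (by rintro _ ⟨b, rfl⟩; exact root_aut_relabel_inr ρ ω e b)
    (by rintro _ ⟨b, rfl⟩; exact ⟨ρ b, sec_aut_relabel_inr_one ρ ω e b⟩) ⟨b, rfl⟩

theorem aut_relabel_inr_smul_cons_one (b : Fin k → ZMod 2) (u : BinSeq) :
    ((sunicTransducer ρ ω).relabel e).aut (Sum.inr b) • consSeq (e 1) u =
      consSeq (e 1) (((sunicTransducer ρ ω).relabel e).aut (Sum.inr (ρ b)) • u) := by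
  rw [smul_consSeq, root_aut_relabel_inr, sec_aut_relabel_inr_one]; rfl

theorem aut_relabel_inr_smul_cons_zero (b : Fin k → ZMod 2) (u : BinSeq) :
    ((sunicTransducer ρ ω).relabel e).aut (Sum.inr b) • consSeq (e 0) u =
      consSeq (e 0) (((sunicTransducer ρ ω).relabel e).aut (Sum.inl (ω b)) • u) := by
  rw [smul_consSeq, root_aut_relabel_inr, sec_aut_relabel_inr_zero]; rfl

theorem apply_one_add_one (e : Equiv.Perm (Fin 2)) : e 1 + 1 = e 0 := by
  revert e; decide

theorem IsDihedralPair.aut_relabel_inl_one (h : IsDihedralPair (e 1) σ β) :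
    ((sunicTransducer ρ ω).relabel e).aut (Sum.inl 1) = σ :=
  ext_root_sec (perm_fin_two_eq (root_aut_relabel_inl_one ρ ω e) h.root_swap) fun x => by
    rw [sec_aut_relabel_inl, h.sec_swap]

/-- All $b$ and $\beta$ wait for the first letter different from $e(1)$ and then apply 1 or $\sigma$
to the rest. So pointwise $b$ cannot be told from 1 or $\beta$. -/
theorem IsDihedralPair.aut_relabel_inr_smul (h : IsDihedralPair (e 1) σ β)
    (b : Fin k → ZMod 2) (x : BinSeq) :
    ((sunicTransducer ρ ω).relabel e).aut (Sum.inr b) • x = x ∨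
      ((sunicTransducer ρ ω).relabel e).aut (Sum.inr b) • x = β • x := by
  induction x using BinSeq.induction_first_ne (c := e 1) generalizing b with
  | hconst => exact Or.inl (aut_relabel_inr_smul_const ρ ω e b)
  | hbase u =>
    rw [h.smul_cons_add_one, apply_one_add_one, aut_relabel_inr_smul_cons_zero]
    have hω : ∀ z : ZMod 2, z = 0 ∨ z = 1 := by decide
    rcases hω (ω b) with hb | hb
    · rw [hb, aut_relabel_inl_zero, one_smul]; exact Or.inl rfl
    · rw [hb, h.aut_relabel_inl_one]; exact Or.inr rfl
  | hstep u ih =>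
    rw [h.smul_cons, aut_relabel_inr_smul_cons_one]
    exact (ih (ρ b)).imp (fun hu => by rw [hu]) fun hu => by rw [hu]

variable {ω}

/-- Surjectivity of $\omega$ supplies the switch at the first differing letter, and invertibility of
$\rho$ pulls the required $b$ back through the letters before it. -/
theorem IsDihedralPair.exists_aut_relabel_inr_smul (h : IsDihedralPair (e 1) σ β)
    (hω : Function.Surjective ω) (x : BinSeq) :
    ∃ b, ((sunicTransducer ρ ω).relabel e).aut (Sum.inr b) • x = β • x := by
  induction x using BinSeq.induction_first_ne (c := e 1) with
  | hconst => exact ⟨0, by rw [aut_relabel_inr_smul_const, h.smul_const]⟩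
  | hbase u =>
    obtain ⟨b, hb⟩ := hω 1
    exact ⟨b, by rw [h.smul_cons_add_one, apply_one_add_one, aut_relabel_inr_smul_cons_zero, hb,
      h.aut_relabel_inl_one]⟩
  | hstep u ih =>
    obtain ⟨b, hb⟩ := ih
    exact ⟨ρ.symm b, by rw [h.smul_cons, aut_relabel_inr_smul_cons_one, ρ.apply_symm_apply, hb]⟩

variable {G : Subgroup TreeAut}

theorem Contracting.ae_pieces_of_sunic (hG : Contracting G) (hω : Function.Surjective ω)
    (hN : nucleus G = Set.range ((sunicTransducer ρ ω).relabel e).aut) :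
    ∀ᵐ w ∂bernoulliMeasure, HasPieces G w 2 ∧ ¬ HasPieces G w 3 := by
  obtain ⟨σ, β, h⟩ : ∃ σ β, IsDihedralPair (e 1) σ β := ⟨_, _, isDihedralPair_aut e⟩
  -- The dihedral orbits to be avoided are those through the constant sequence: there $\beta$ has a
  -- fixed point, and the orbit is not a line.
  have hnull : ∀ᵐ w ∂bernoulliMeasure, ∀ j : ℤ, (β * σ) ^ j • w ≠ fun _ => e 1 := by
    refine ae_all_iff.2 fun j => ?_
    rw [ae_iff]
    have : {w : BinSeq | ¬ (β * σ) ^ j • w ≠ fun _ => e 1} =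
        {((β * σ) ^ j)⁻¹ • fun _ => e 1} := by
      ext w
      rw [Set.mem_ofPred_eq, not_not, Set.mem_singleton_iff, eq_inv_smul_iff]
    rw [this]
    exact bernoulliMeasure_singleton _
  filter_upwards [hnull] with w hw
  refine hG.pieces_of_line one_pos h.isSelfReplicating (h.injective_line hw) ?_
    (fun d hd => h.movesBoundedly w hd) (E := {1, σ, β}) (Set.toFinite _) ?_ ?_ ?_
  · rw [← mul_zero 2, IsDihedralPair.line_two_mul, zpow_zero, one_smul]
  · rintro d (rfl | hd)
    · exact one_mem _
    · exact Subgroup.subset_closure hd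
  · rw [hN]
    rintro _ ⟨z | b, rfl⟩ x
    · have hz : ∀ z : ZMod 2, z = 0 ∨ z = 1 := by decide
      rcases hz z with rfl | rfl
      · exact ⟨1, Or.inl rfl, by rw [aut_relabel_inl_zero]⟩
      · exact ⟨σ, Or.inr (Or.inl rfl), by rw [h.aut_relabel_inl_one]⟩
    · rcases h.aut_relabel_inr_smul ρ ω e b x with hb | hb
      · exact ⟨1, Or.inl rfl, by rw [hb, one_smul]⟩
      · exact ⟨β, Or.inr (Or.inr rfl), hb⟩
  · rw [hN]
    intro n
    obtain ⟨i, rfl | rfl⟩ := Int.even_or_odd' n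
    · exact ⟨_, ⟨Sum.inl 1, rfl⟩, by rw [h.aut_relabel_inl_one, (h.swap_line w i).1]⟩
    · obtain ⟨b, hb⟩ := h.exists_aut_relabel_inr_smul ρ e hω (IsDihedralPair.line σ β w (2 * i + 1))
      exact ⟨_, ⟨Sum.inr b, rfl⟩, by rw [hb, (h.smul_line w i).1, add_assoc]; rfl⟩

end Sunic

end TreeAut

/-! ### Conclusion -/

theorem mainTheorem9 {S : Type*} (A : Transducer S (Fin 2)) (hA : A.IsBounded) :
    (∀ᵐ w ∂bernoulliMeasure, HasTwoEnds (A.schreierGraph w)) ↔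
      (∃ a : Equiv.Perm (ℕ → Fin 2), IsAddingMachine a ∧ IsNucleus A.group {a, a⁻¹, 1}) ∨
      (∃ (k : ℕ) (ρ : (Fin k → ZMod 2) ≃+ (Fin k → ZMod 2)) (ω : (Fin k → ZMod 2) →+ ZMod 2)
        (e : Equiv.Perm (Fin 2)), Function.Surjective ω ∧
        IsNucleus A.group (Set.range ((sunicTransducer ρ ω).relabel e).perm)) := by
  have := hA.1
  have hinj : Function.Injective (Set.image treeAut.subtype) :=
    Set.image_injective.2 treeAut.subtype_injective
  have hmachine : ∀ a : TreeAut,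
      treeAut.subtype '' {a, a⁻¹, 1} = {a.1, a.1⁻¹, 1} := fun a => by
    simp [Set.image_insert_eq]
  have hsunic : ∀ {T : Type} (B : Transducer T (Fin 2)),
      treeAut.subtype '' Set.range B.aut = Set.range B.perm := fun B => by
    rw [← Set.range_comp]; rfl
  -- Boundedness already provides the nucleus, so being the nucleus is an equality with a known set
  -- and existence costs nothing.
  have hnucleus : ∀ N, IsNucleus A.group N ↔ N = treeAut.subtype '' TreeAut.nucleus A.treeGroup :=
    A.map_treeGroup ▸ fun N => TreeAut.isNucleus_iff hA.contracting
  simp only [hnucleus]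
  constructor
  · intro h
    rcases hA.nucleus_of_ae_hasTwoEnds h with ⟨a, ha, hN⟩ | ⟨k, ρ, ω, e, hω, hN⟩
    · exact Or.inl ⟨a.1, ha, by rw [hN, hmachine]⟩
    · exact Or.inr ⟨k, ρ, ω, e, hω, by rw [hN, hsunic]⟩
  · simp only [Transducer.hasTwoEnds_iff]
    rintro (⟨a, ha, hN⟩ | ⟨k, ρ, ω, e, hω, hN⟩)
    · have hmem : a ∈ treeAut.subtype '' TreeAut.nucleus A.treeGroup := hN ▸ Or.inl rfl
      obtain ⟨a, -, rfl⟩ := hmem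
      exact Filter.Eventually.of_forall fun w =>
        hA.contracting.pieces_of_addingMachine ha (hinj (hN.symm.trans (hmachine a).symm)) w
    · exact hA.contracting.ae_pieces_of_sunic ρ e hω (hinj (hN.symm.trans (hsunic _).symm))
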